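/- **Setting.** Let $X$ and $A\neq\emptyset$ be finite, $L\ge 1$, $T\ge 1$, $d\ge 0$, and let $X$ be the disjoint union of layers $X_0,\dots,X_L$ with $X_0=\{x_0\}$, $X_L=\{x_L\}$; $k(x)$ is the index of the layer of $x$. A transition function $P$ gives, for $x\in X_k$ ($k<L$) and $a\in A$, a probability distribution $P(\cdot\mid x,a)$ on $X_{k+1}$. A (stationary stochastic) policy $\pi$ gives a distribution $\pi(\cdot\mid x)$ on $A$ for every $x\ne x_L$. A trajectory is $U=(x_0,a_0,\dots,x_{L-1},a_{L-1},x_L)$ with $x_k\in X_k$, drawn by $a_k\sim\pi(\cdot\mid x_k)$, $x_{k+1}\sim P(\cdot\mid x_k,a_k)$. For $\ell:X\times A\times X\to[0,1]^d$ let $\mathbb E[\ell(U)\mid P,\pi]\in(\mathbb R^d)^L$ be the sequence of the expectations of $\ell(x_k,a_k,x_{k+1})$, $0\le k<L$, and let $q^{P,\pi}(x,a,x')=\Pr[x_k=x,a_k=a,x_{k+1}=x'\mid P,\pi]$ with $k=k(x)$. Let $\mathcal C:(\mathbb R^d)^L\to\mathbb R_{\ge0}$ be convexly-measurable with criterion function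 $f$: for every loss function $\ell:X\times A\times X\to[0,1]^d$ the function $f(\cdot\,;\ell):[0,1]^{|X|\times|A|\times|X|}\to\mathbb R_{\ge 0}$ is convex, and $\mathcal C(\mathbb E[\ell(U)\mid P',\pi])=f(q^{P',\pi};\ell)$ for all transition functions $P'$ and policies $\pi$. Let $F>0$ and suppose that every $f(\cdot\,;\ell)$ is $F$-Lipschitz with respect to the $L_1$ norm. Fix the true transition function $P$ (unknown to the learner), an arbitrary sequence of loss functions $\ell_1,\dots,\ell_T:X\times A\times X\to[0,1]^d$, and $0<\delta<1$. **Algorithm (UC-O-REPS with parameters $\eta,\delta$).** Start with $q_1(x,a,x')=\frac1{|X_k||A||X_{k+1}|}$ on $X_k\times A\times X_{k+1}$ for all $k<L$ (and $0$ elsewhere), and $\pi_1(a\mid x)=1/|A|$. In episode $t$ the trajectory $U_t$ is drawn using $P$ and $\pi_t$, where $\pi_t$ depends only on $U_1,\dots,U_{t-1}$, and then $\ell_t$ is revealed. Episodes are grouped into epochs: $N_i(x,a)$ and $M_i(x'\mid x,a)$ count the visits to $(x,a)$ and the transitions $(x,a,x')$ in all episodes before epoch $i$, and epoch $i$ ends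 after the first episode at whose end, for some $(x,a)\in X\times A$, the number $n_i(x,a)$ of visits within the epoch satisfies $n_i(x,a)\ge N_i(x,a)$. (The theorem is asserted both for this rule and for the rule $n_i(x,a)\ge\max\{1,N_i(x,a)\}$.) Let $i(t)$ be the epoch of episode $t$ and $$\bar P_i(x'\mid x,a)=\frac{M_i(x'\mid x,a)}{\max\{1,N_i(x,a)\}},\qquad \epsilon_i(x,a)=\sqrt{\frac{2|X_{k(x)+1}|\ln\frac{T|X||A|}{\delta}}{\max\{1,N_i(x,a)\}}}.$$ The confidence set $\Delta(M,i)$ consists of all $q\in[0,1]^{|X|\times|A|\times|X|}$ vanishing outside $\bigcup_{k<L}X_k\times A\times X_{k+1}$ such that $\sum_{x\in X_k,a,x'\in X_{k+1}}q(x,a,x')=1$ for $0\le k<L$; $\sum_{x'\in X_{k+1},a}q(x,a,x')=\sum_{x'\in X_{k-1},a}q(x',a,x)$ for $0<k<L$, $x\in X_k$; and $\|P^q(\cdot\mid x,a)-\bar P_i(\cdot\mid x,a)\|_1\le\epsilon_i(x,a)$ for all $(x,a)$ with $q(x,a):=\sum_{y\in X_{k(x)+1}}q(x,a,y)\neq 0$,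 where $P^q(x'\mid x,a)=q(x,a,x')/q(x,a)$. After episode $t$ the learner takes any sub-gradient $z_t\in\partial f(q_t;\ell_t)$ and sets $$q_{t+1}=\arg\min_{q\in\Delta(M,i(t+1))}\ \eta\langle q,z_t\rangle+D(q\|q_t),\qquad \pi_{t+1}(a\mid x)=\frac{q_{t+1}(x,a)}{\sum_{b\in A}q_{t+1}(x,b)},$$ where $D(q\|q')=\sum_{x,a,x'}\big(q\ln\frac{q}{q'}-q+q'\big)(x,a,x')$ is the unnormalized KL divergence (with $0\ln\frac{0}{\cdot}=0$). **Theorem.** Let $\eta=\sqrt{\ln\frac{|X|^2|A|}{L^2}\big/(F^2T)}$. Then, with probability at least $1-2\delta$, the regret of UC-O-REPS satisfies $$\hat R^{\mathcal C}_{1:T}=\sum_{t=1}^T\mathcal C\big(\mathbb E[\ell_t(U)\mid P,\pi_t]\big)-\min_{\pi}\sum_{t=1}^T\mathcal C\big(\mathbb E[\ell_t(U)\mid P,\pi]\big)\ \le\ 15\,F\,L|X|\sqrt{T|A|\ln\frac{T|X||A|}{\delta}},$$ where the minimum is over all stationary stochastic policies. -/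

import Mathlib

open scoped BigOperators NNReal

noncomputable section

namespace UCOREPS

/-- A decomposition of the state space `X` into consecutive layers `X_0, …, X_L`
whose first and last layers are singletons. -/
structure Layering (X : Type*) (L : ℕ) where
  /-- `layer x` is the index `k(x)` of the layer that contains `x`. -/
  layer : X → Fin (L + 1)
  start : X
  final : X
  layer_eq_zero_iff : ∀ x, layer x = 0 ↔ x = start
  layer_eq_last_iff : ∀ x, layer x = Fin.last L ↔ x = final

variable {X A : Type*} [Fintype X] [Fintype A] [DecidableEq X] [DecidableEq A] {L d : ℕ}

/-- The layer `X_k`. -/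
def Layering.states (S : Layering X L) (k : ℕ) : Finset X :=
  Finset.univ.filter fun x => (S.layer x : ℕ) = k

/-- The layer `X_{k(x)+1}` that follows the layer of `x` (empty for the final state). -/
def Layering.next (S : Layering X L) (x : X) : Finset X := S.states (S.layer x + 1)

/-- `P x a x'` is the probability `P(x' | x, a)`.  Transitions are only possible between consecutive
layers; in the final state no action is taken and there is no further transition. -/
structure IsTransition (S : Layering X L) (P : X → A → X → ℝ) : Prop where
  nonneg : ∀ x a x', 0 ≤ P x a x'
  loop_free : ∀ x a x', x' ∉ S.next x → P x a x' = 0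
  sum_eq_one : ∀ x a, S.layer x ≠ Fin.last L → ∑ x', P x a x' = 1

/-- Stationary stochastic policies: `π x a` is the probability `π(a | x)`.
No action is taken in the final state. -/
structure IsPolicy (S : Layering X L) (π : X → A → ℝ) : Prop where
  nonneg : ∀ x a, 0 ≤ π x a
  sum_eq_one : ∀ x, S.layer x ≠ Fin.last L → ∑ a, π x a = 1

/-- Trajectories `(x_0, a_0, …, x_{L-1}, a_{L-1}, x_L)` through the consecutive layers. -/
abbrev Trajectory (S : Layering X L) (A : Type*) : Type _ :=
  {u : (Fin (L + 1) → X) × (Fin L → A) // ∀ k, S.layer (u.1 k) = k}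

namespace Trajectory
variable {S : Layering X L}

/-- The state `x_k`, for `k < L`. -/
def state (U : Trajectory S A) (k : Fin L) : X := U.1.1 k.castSucc

/-- The action `a_k`. -/
def action (U : Trajectory S A) (k : Fin L) : A := U.1.2 k

/-- The state `x_{k+1}`. -/
def nextState (U : Trajectory S A) (k : Fin L) : X := U.1.1 k.succ

end Trajectory

/-- Probability of the trajectory `U` (which starts in the initial state) under the
transition function `P` and the policy `π`. -/
def trajProb (S : Layering X L) (P : X → A → X → ℝ) (π : X → A → ℝ) (U : Trajectory S A) : ℝ :=
  ∏ k : Fin L, π (U.state k) (U.action k) * P (U.state k) (U.action k) (U.nextState k)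

/-- Loss functions `ℓ : X × A × X → [0,1]^d`. -/
def IsLoss (l : X → A → X → Fin d → ℝ) : Prop := ∀ x a x' i, l x a x' i ∈ Set.Icc (0 : ℝ) 1

/-- `𝔼[ℓ(U) | P, π]`, the sequence of the `L` expected losses of a trajectory. -/
def expectedLosses (S : Layering X L) (P : X → A → X → ℝ) (π : X → A → ℝ)
    (l : X → A → X → Fin d → ℝ) : Fin L → Fin d → ℝ := fun k i =>
  ∑ U : Trajectory S A, trajProb S P π U * l (U.state k) (U.action k) (U.nextState k) i

/-- The occupancy measure `q^{P,π}(x,a,x') = Pr[x_k = x, a_k = a, x_{k+1} = x' | P, π]`,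
with `k = k(x)`. -/
def occupancy (S : Layering X L) (P : X → A → X → ℝ) (π : X → A → ℝ) : X → A → X → ℝ :=
  fun x a x' =>
    ∑ U : Trajectory S A with ∃ k : Fin L,
      k.castSucc = S.layer x ∧ U.state k = x ∧ U.action k = a ∧ U.nextState k = x',
      trajProb S P π U

/-- The cube `[0,1]^{|X|×|A|×|X|}`. -/
def cube (X A : Type*) : Set (X → A → X → ℝ) := {q | ∀ x a x', q x a x' ∈ Set.Icc (0 : ℝ) 1}

/-- `⟨q, z⟩ = ∑_{x,a,x'} q(x,a,x') z(x,a,x')`. -/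
def pairing (q z : X → A → X → ℝ) : ℝ := ∑ x, ∑ a, ∑ x', q x a x' * z x a x'

/-- The performance criterion `C : (ℝ^d)^L → ℝ_{≥0}` is convexly-measurable with criterion
function `f`; here `f l q` stands for `f^C(q; ℓ)`. -/
structure IsCriterionFunction (S : Layering X L) (C : (Fin L → Fin d → ℝ) → ℝ≥0)
    (f : (X → A → X → Fin d → ℝ) → (X → A → X → ℝ) → ℝ) : Prop where
  nonneg : ∀ l, IsLoss l → ∀ q ∈ cube X A, 0 ≤ f l q
  convex : ∀ l, IsLoss l → ConvexOn ℝ (cube X A) (f l)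
  eq_occupancy : ∀ l, IsLoss l → ∀ P, IsTransition S P → ∀ π, IsPolicy S π →
    (C (expectedLosses S P π l) : ℝ) = f l (occupancy S P π)

/-- `f(·; ℓ)` is `F`-Lipschitz on the cube, with respect to the `L₁` norm, for every loss `ℓ`. -/
def IsLipschitzCriterion (F : ℝ) (f : (X → A → X → Fin d → ℝ) → (X → A → X → ℝ) → ℝ) : Prop :=
  ∀ l, IsLoss l → ∀ q ∈ cube X A, ∀ q' ∈ cube X A,
    |f l q - f l q'| ≤ F * ∑ x, ∑ a, ∑ x', |q x a x' - q' x a x'|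

/-- `z` is a sub-gradient at `q` of the function `g` on the cube. -/
def IsSubgradient (g : (X → A → X → ℝ) → ℝ) (q z : X → A → X → ℝ) : Prop :=
  ∀ q' ∈ cube X A, g q + pairing (q' - q) z ≤ g q'

/-- The unnormalized Kullback-Leibler divergence `D(q || q')`. -/
def unnormKL (q q' : X → A → X → ℝ) : ℝ :=
  ∑ x, ∑ a, ∑ x',
    (q x a x' * Real.log (q x a x' / q' x a x') - q x a x' + q' x a x')

/-- `q(x,a) = ∑_{y ∈ X_{k(x)+1}} q(x,a,y)`. -/
def pairMass (S : Layering X L) (q : X → A → X → ℝ) (x : X) (a : A) : ℝ := ∑ y ∈ S.next x, q x a y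

/-- The transition function `P^q` induced by `q`. -/
def inducedTransition (S : Layering X L) (q : X → A → X → ℝ) : X → A → X → ℝ :=
  fun x a x' => q x a x' / pairMass S q x a

/-- The policy `π^q` induced by `q`. -/
def inducedPolicy (S : Layering X L) (q : X → A → X → ℝ) : X → A → ℝ :=
  fun x a => pairMass S q x a / ∑ b, pairMass S q x b

/-- The counters kept by the algorithm: `n`, `m` count the visits to `(x,a)` and the transitions
`(x,a,x')` in the current epoch, `N`, `M` those in all earlier epochs. -/
structure Counters (X A : Type*) where
  n : X → A → ℕ
  m : X → A → X → ℕ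
  N : X → A → ℕ
  M : X → A → X → ℕ

/-- The number of visits to `(x,a)` along the trajectory `U`. -/
def visits {S : Layering X L} (U : Trajectory S A) (x : X) (a : A) : ℕ :=
  (Finset.univ.filter fun k : Fin L => U.state k = x ∧ U.action k = a).card

/-- The number of transitions `(x,a,x')` along the trajectory `U`. -/
def transits {S : Layering X L} (U : Trajectory S A) (x : X) (a : A) (x' : X) : ℕ :=
  (Finset.univ.filter fun k : Fin L =>
    U.state k = x ∧ U.action k = a ∧ U.nextState k = x').card

/-- Update of the counters at the end of an episode with trajectory `U`.  A new epoch starts if, for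
some `(x,a)`, the number of visits in the current epoch has reached the number of earlier
visits.  The parameter `r` is the number of visits that is required at least: `r = 0` is the rule
`n(x,a) ≥ N(x,a)`, and `r = 1` the rule `n(x,a) ≥ max {1, N(x,a)}`, for which a pair without any
visit does not count as doubled. -/
def Counters.update {S : Layering X L} (r : ℕ) (c : Counters X A) (U : Trajectory S A) :
    Counters X A :=
  let n' : X → A → ℕ := fun x a => c.n x a + visits U x a
  let m' : X → A → X → ℕ := fun x a x' => c.m x a x' + transits U x a x'
  if ∃ x a, max r (c.N x a) ≤ n' x a then
    { n := fun _ _ => 0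
      m := fun _ _ _ => 0
      N := fun x a => c.N x a + n' x a
      M := fun x a x' => c.M x a x' + m' x a x' }
  else
    { n := n', m := m', N := c.N, M := c.M }

/-- The counters after the trajectories `h 0, …, h (t-1)` of the first `t` episodes. -/
def countersAt (S : Layering X L) (r : ℕ) : (t : ℕ) → (Fin t → Trajectory S A) → Counters X A
  | 0, _ => ⟨fun _ _ => 0, fun _ _ _ => 0, fun _ _ => 0, fun _ _ _ => 0⟩
  | t + 1, h => (countersAt S r t (Fin.init h)).update r (h (Fin.last t))

/-- The estimate `P̄_i(x' | x, a) = M_i(x' | x, a) / max {1, N_i(x,a)}`. -/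
def Counters.estimate (c : Counters X A) : X → A → X → ℝ :=
  fun x a x' => (c.M x a x' : ℝ) / max 1 (c.N x a : ℝ)

/-- The confidence radius `ε_i(x,a)`. -/
def Counters.radius (S : Layering X L) (T : ℕ) (δ : ℝ) (c : Counters X A) (x : X) (a : A) : ℝ :=
  Real.sqrt (2 * ((S.next x).card : ℝ)
    * Real.log (T * Fintype.card X * Fintype.card A / δ) / max 1 (c.N x a : ℝ))

/-- The confidence set `Δ(M,i)` determined by the counters at the start of epoch `i`.
The induced transition probabilities `P^q(· | x, a)` are defined, and constrained, only where
`q(x,a) ≠ 0`. -/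
structure InConfidenceSet (S : Layering X L) (T : ℕ) (δ : ℝ) (c : Counters X A)
    (q : X → A → X → ℝ) : Prop where
  mem_cube : q ∈ cube X A
  loop_free : ∀ x a x', x' ∉ S.next x → q x a x' = 0
  sum_one : ∀ k < L, ∑ x ∈ S.states k, ∑ a, ∑ x' ∈ S.states (k + 1), q x a x' = 1
  flow : ∀ k, k + 1 < L → ∀ x ∈ S.states (k + 1),
    ∑ x' ∈ S.states (k + 2), ∑ a, q x a x' = ∑ x' ∈ S.states k, ∑ a, q x' a x
  l1_dist : ∀ x a, pairMass S q x a ≠ 0 →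
    ∑ x', |inducedTransition S q x a x' - c.estimate x a x'| ≤ c.radius S T δ x a

/-- The first occupancy measure: uniform on `X_k × A × X_{k+1}` for every `k < L`. -/
def initialMeasure (S : Layering X L) : X → A → X → ℝ := fun x _ x' =>
  if x' ∈ S.next x then
    1 / (((S.states (S.layer x)).card : ℝ) * Fintype.card A * ((S.next x).card : ℝ))
  else 0

/-- `q` is a run of UC-O-REPS.  `q t h` is the occupancy measure chosen for the episode with
(zero-based) index `t` when the earlier episodes have produced the trajectories `h`.  After
episode `t` the learner takes an arbitrary sub-gradient of the criterion function of that episode,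
and solves the mirror descent problem on the current confidence set. -/
structure IsUCOREPS (S : Layering X L) (r T : ℕ) (η δ : ℝ)
    (f : (X → A → X → Fin d → ℝ) → (X → A → X → ℝ) → ℝ)
    (l : Fin T → X → A → X → Fin d → ℝ)
    (q : (t : ℕ) → (Fin t → Trajectory S A) → X → A → X → ℝ) : Prop where
  init : ∀ h, q 0 h = initialMeasure S
  step : ∀ t : Fin T, ∀ h : Fin (t + 1) → Trajectory S A, ∃ z : X → A → X → ℝ,
    IsSubgradient (f (l t)) (q t (Fin.init h)) z ∧
    InConfidenceSet S T δ (countersAt S r (t + 1) h) (q (t + 1) h) ∧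
    IsMinOn (fun p => η * pairing p z + unnormKL p (q t (Fin.init h)))
      {p | InConfidenceSet S T δ (countersAt S r (t + 1) h) p} (q (t + 1) h)

/-- The policies executed by the algorithm: uniform in the first episode, then induced by the
chosen occupancy measures. -/
def learnerPolicy (S : Layering X L)
    (q : (t : ℕ) → (Fin t → Trajectory S A) → X → A → X → ℝ) :
    (t : ℕ) → (Fin t → Trajectory S A) → X → A → ℝ
  | 0, _ => fun _ _ => 1 / (Fintype.card A : ℝ)
  | t + 1, h => inducedPolicy S (q (t + 1) h)

/-- Probability that the first `T` episodes produce the trajectories `h`, when the policy of each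
episode is chosen by `π` from the trajectories of the earlier episodes. -/
def historyProb (S : Layering X L) (P : X → A → X → ℝ)
    (π : (t : ℕ) → (Fin t → Trajectory S A) → X → A → ℝ) :
    (T : ℕ) → (Fin T → Trajectory S A) → ℝ
  | 0, _ => 1
  | T + 1, h =>
    historyProb S P π T (Fin.init h) * trajProb S P (π T (Fin.init h)) (h (Fin.last T))

/-- Probability of an event about the trajectories of the first `T` episodes. -/
def eventProb (S : Layering X L) (P : X → A → X → ℝ)
    (π : (t : ℕ) → (Fin t → Trajectory S A) → X → A → ℝ) (T : ℕ)
    (E : Set (Fin T → Trajectory S A)) : ℝ :=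
  ∑ h, E.indicator (historyProb S P π T) h

/-- The regret with respect to the performance criterion `C`, when the episodes have produced the
trajectories `h`: the total loss of the policies `π_t` executed by the learner minus the least
total loss of a stationary policy. -/
def regret (S : Layering X L) (P : X → A → X → ℝ) (C : (Fin L → Fin d → ℝ) → ℝ≥0) {T : ℕ}
    (l : Fin T → X → A → X → Fin d → ℝ)
    (π : (t : ℕ) → (Fin t → Trajectory S A) → X → A → ℝ) (h : Fin T → Trajectory S A) : ℝ :=
  (∑ t : Fin T, (C (expectedLosses S P (π t fun s => h (s.castLE t.2.le)) (l t)) : ℝ))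
    - ⨅ ρ : {ρ : X → A → ℝ // IsPolicy S ρ},
        ∑ t : Fin T, (C (expectedLosses S P ρ.1 (l t)) : ℝ)

end UCOREPS

end

open UCOREPS

/-!
Regret of UC-O-REPS.

Off two events of probability at most `δ` each, the regret bound holds for every history.

* `transitionBadEvent`: some empirical transition probability leaves its confidence ball.  By
  `sum_abs_sub_estimate_le`, off this event the true transition function lies in all the balls, so
  that the occupancy measure of every stationary policy is a member of all the confidence sets.  The
  probability is bounded by a union over `(x,a)`, the number `n` of visits and the sets `B` of next
  states; for each of them, an exponential supermartingale counts the transitions into `B` during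
  the first `n` visits, which takes the place of a sequence of independent samples.
* `sumBadEvent`: the transition errors met along the trajectories fall short of their conditional
  expectations by more than the Azuma-Hoeffding deviation.

Both use `eventProb_cumul_ge_le`, the Markov inequality for exponential supermartingales over the
episodes, with Hoeffding's lemma for the increments.

The regret is split at the occupancy measures `q_t` of the algorithm.  Against a comparator in all
confidence sets, the `q_t` have the regret of mirror descent (`IsUCOREPS.sum_sub_le`): the
first-order optimality of the projections telescopes the divergences (`three_point_of_isMin`), and
the cost of one step is bounded in each layer by Gibbs' variational principle with Hoeffding's lemma
(`sum_sub_mul_le_klTerm`).  That optimality and the boundedness of the sub-gradients require that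
`q_t` is positive on all admissible triples, which holds because the slope of the divergence is
infinite at the boundary (`pos_of_isMin`).

By the Lipschitz condition the policies executed cost more than the `q_t` by at most `F` times
the distance of `q_t` from the true occupancy measure of its policy.  This distance is at most `L`
times the expected sum of the transition errors along a trajectory (`sum_abs_sub_occupancy_le`).
Off the bad events these errors are at most twice the confidence radii, and the doubling rule of the
epochs bounds the sum of the radii along the trajectories (`sum_transitionDist_le`).  The number of
epochs plays no role, which is why the bound also holds for the rule under which a pair without any
visit ends every epoch after one episode.
-/

set_option linter.unusedSectionVars false

noncomputable section

namespace UCOREPS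

/-! ### Sums over trajectories -/

section

variable {X A : Type*} [Fintype X] [Fintype A] [DecidableEq X] [DecidableEq A] {L : ℕ}

lemma Layering.mem_states {S : Layering X L} {k : ℕ} {x : X} :
    x ∈ S.states k ↔ (S.layer x : ℕ) = k := by
  simp [Layering.states]

lemma Layering.mem_next {S : Layering X L} {x y : X} :
    y ∈ S.next x ↔ (S.layer y : ℕ) = S.layer x + 1 := by
  simp [Layering.next, Layering.mem_states]

lemma Layering.layer_start (S : Layering X L) : S.layer S.start = 0 :=
  (S.layer_eq_zero_iff _).2 rfl

lemma Layering.layer_final (S : Layering X L) : S.layer S.final = Fin.last L :=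
  (S.layer_eq_last_iff _).2 rfl

lemma Layering.states_zero (S : Layering X L) : S.states 0 = {S.start} := by
  ext x
  rw [Layering.mem_states, Finset.mem_singleton, ← S.layer_eq_zero_iff, Fin.ext_iff, Fin.val_zero]

lemma Layering.ne_last_of_lt {S : Layering X L} {x : X} (h : (S.layer x : ℕ) < L) :
    S.layer x ≠ Fin.last L := by
  intro h'
  rw [h', Fin.val_last] at h
  exact lt_irrefl _ h

lemma Layering.lt_of_ne_last {S : Layering X L} {x : X} (h : S.layer x ≠ Fin.last L) :
    (S.layer x : ℕ) < L :=
  Fin.val_lt_last h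

lemma Layering.next_eq_empty {S : Layering X L} {x : X} (h : S.layer x = Fin.last L) :
    S.next x = ∅ := by
  ext y
  have := (S.layer y).2
  simp only [Layering.mem_next, h, Fin.val_last, Finset.notMem_empty, iff_false]
  omega

lemma Layering.next_eq {S : Layering X L} {x : X} {k : ℕ} (h : x ∈ S.states k) :
    S.next x = S.states (k + 1) := by
  rw [Layering.next, Layering.mem_states.1 h]

/-- A sum over all states, arranged by layers; the final state is left out if it contributes
nothing. -/
lemma Layering.sum_eq_sum_states (S : Layering X L) (g : X → ℝ)
    (hg : ∀ x, S.layer x = Fin.last L → g x = 0) :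
    ∑ x, g x = ∑ k ∈ Finset.range L, ∑ x ∈ S.states k, g x := by
  have h1 : ∑ x, g x = ∑ k ∈ Finset.range (L + 1), ∑ x ∈ S.states k, g x := by
    rw [← Finset.sum_fiberwise_of_maps_to (s := Finset.univ) (t := Finset.range (L + 1))
      (g := fun x => (S.layer x : ℕ))]
    · rfl
    · intro x _
      exact Finset.mem_range.2 (S.layer x).2
  rw [h1, Finset.sum_range_succ]
  have h2 : ∑ x ∈ S.states L, g x = 0 := by
    refine Finset.sum_eq_zero fun x hx => hg x ?_
    exact Fin.ext (by rw [Layering.mem_states.1 hx, Fin.val_last])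
  rw [h2, add_zero]

/-- A sum over `X × A × X` of a function that vanishes unless the last state follows the
first one, arranged by layers. -/
lemma Layering.sum_eq_sum_layers (S : Layering X L) (g : X → A → X → ℝ)
    (hg : ∀ x a x', x' ∉ S.next x → g x a x' = 0) :
    ∑ x, ∑ a, ∑ x', g x a x' =
      ∑ k ∈ Finset.range L, ∑ x ∈ S.states k, ∑ a, ∑ x' ∈ S.states (k + 1), g x a x' := by
  rw [S.sum_eq_sum_states]
  · refine Finset.sum_congr rfl fun k _ => Finset.sum_congr rfl fun x hx =>
      Finset.sum_congr rfl fun a _ => ?_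
    rw [← S.next_eq hx]
    exact (Finset.sum_subset (Finset.subset_univ _) fun x' _ h => hg x a x' h).symm
  · intro x hx
    refine Finset.sum_eq_zero fun a _ => Finset.sum_eq_zero fun x' _ => hg x a x' ?_
    simp [S.next_eq_empty hx]

/-- `forward ν w k y` is the total weight of the paths with `k` steps that end in `y`, when
the initial states are weighted by `ν` and the steps `(x, a, x')` at time `j` by `w j`. -/
def forward (ν : X → ℝ) (w : ℕ → X → A → X → ℝ) : ℕ → X → ℝ
  | 0 => ν
  | k + 1 => fun y => ∑ x, ∑ a, forward ν w k x * w k x a y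

lemma sum_paths_eq_forward (ν : X → ℝ) (w : ℕ → X → A → X → ℝ) (n : ℕ) (g : X → ℝ) :
    ∑ u : Fin (n + 1) → X, ∑ b : Fin n → A,
      ν (u 0) * (∏ k : Fin n, w k (u k.castSucc) (b k) (u k.succ)) * g (u (Fin.last n)) =
      ∑ y, forward ν w n y * g y := by
  induction n generalizing g with
  | zero =>
    rw [← (Equiv.funUnique (Fin 1) X).symm.sum_comp]
    simp [forward]
  | succ n ih =>
    rw [← (Fin.snocEquiv fun _ : Fin (n + 2) => X).sum_comp]
    rw [Fintype.sum_prod_type]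
    have h1 : ∀ (y : X) (u : Fin (n + 1) → X),
        ∑ b : Fin (n + 1) → A,
          ν ((Fin.snocEquiv fun _ : Fin (n + 2) => X) (y, u) 0) *
            (∏ k : Fin (n + 1), w k ((Fin.snocEquiv fun _ : Fin (n + 2) => X) (y, u) k.castSucc)
              (b k) ((Fin.snocEquiv fun _ : Fin (n + 2) => X) (y, u) k.succ)) *
            g ((Fin.snocEquiv fun _ : Fin (n + 2) => X) (y, u) (Fin.last (n + 1))) =
        ∑ b : Fin n → A, ν (u 0) * (∏ k : Fin n, w k (u k.castSucc) (b k) (u k.succ)) *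
          ((∑ a, w n (u (Fin.last n)) a y) * g y) := by
      intro y u
      rw [← (Fin.snocEquiv fun _ : Fin (n + 1) => A).sum_comp, Fintype.sum_prod_type,
        Finset.sum_comm]
      refine Finset.sum_congr rfl fun b _ => ?_
      rw [Finset.sum_mul, Finset.mul_sum]
      refine Finset.sum_congr rfl fun a _ => ?_
      rw [Fin.prod_univ_castSucc]
      have e0 : (Fin.snoc u y : Fin (n + 2) → X) 0 = u 0 := by
        simp
      simp only [Fin.snocEquiv, Equiv.coe_fn_mk, Fin.snoc_castSucc, Fin.snoc_last, e0,
        Fin.succ_castSucc, Fin.succ_last, Fin.val_last, Fin.val_castSucc]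
      ring
    simp_rw [h1]
    have h2 : ∀ y : X, ∑ u : Fin (n + 1) → X, ∑ b : Fin n → A,
        ν (u 0) * (∏ k : Fin n, w k (u k.castSucc) (b k) (u k.succ)) *
          ((∑ a, w n (u (Fin.last n)) a y) * g y) = forward ν w (n + 1) y * g y := by
      intro y
      rw [ih fun x => (∑ a, w n x a y) * g y]
      simp only [forward, Finset.sum_mul, Finset.mul_sum]
      refine Finset.sum_congr rfl fun x _ => Finset.sum_congr rfl fun a _ => ?_
      ring
    simp_rw [h2]

variable {S : Layering X L} {P : X → A → X → ℝ} {π : X → A → ℝ}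

lemma forward_layer {w : ℕ → X → A → X → ℝ} (hw : ∀ k x a x', x' ∉ S.next x → w k x a x' = 0)
    (k : ℕ) (y : X) (hy : y ∉ S.states k) : forward (Pi.single S.start 1) w k y = 0 := by
  induction k generalizing y with
  | zero =>
    rw [S.states_zero, Finset.mem_singleton] at hy
    simp [forward, hy]
  | succ k ih =>
    refine Finset.sum_eq_zero fun x _ => Finset.sum_eq_zero fun a _ => ?_
    by_cases hx : x ∈ S.states k
    · rw [hw, mul_zero]
      rwa [S.next_eq hx]
    · rw [ih x hx, zero_mul]

/-- Trajectories are the paths from the initial state with steps to the respective next layer;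
all other paths have weight zero. -/
lemma sum_trajectory (hP : IsTransition S P) (g : ℕ → X → A → X → ℝ) :
    ∑ U : Trajectory S A, trajProb S P π U *
      ∏ k : Fin L, g k (U.state k) (U.action k) (U.nextState k) =
    ∑ y, forward (Pi.single S.start 1)
      (fun k x a x' => π x a * P x a x' * g k x a x') L y := by
  have h0 := sum_paths_eq_forward (Pi.single S.start 1)
    (fun k x a x' => π x a * P x a x' * g k x a x') L fun _ => 1
  simp only [mul_one] at h0
  rw [← h0, ← Fintype.sum_prod_type']
  set G : (Fin (L + 1) → X) × (Fin L → A) → ℝ := fun u =>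
    (Pi.single S.start 1 : X → ℝ) (u.1 0) * ∏ k : Fin L, π (u.1 k.castSucc) (u.2 k) *
      P (u.1 k.castSucc) (u.2 k) (u.1 k.succ) * g k (u.1 k.castSucc) (u.2 k) (u.1 k.succ) with hG
  have h1 : ∑ u, G u = ∑ u with ∀ k, S.layer (u.1 k) = k, G u := by
    symm
    rw [Finset.sum_filter]
    refine Finset.sum_congr rfl fun u _ => ?_
    split_ifs with hu
    · rfl
    · by_contra hne
      have hne' : G u ≠ 0 := fun h => hne h.symm
      apply hu
      have hs : u.1 0 = S.start := by
        by_contra h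
        exact hne' (by simp [hG, h])
      have hk : ∀ k : Fin L, u.1 k.succ ∈ S.next (u.1 k.castSucc) := by
        intro k
        by_contra h
        apply hne'
        rw [hG]
        refine mul_eq_zero_of_right _ (Finset.prod_eq_zero (Finset.mem_univ k) ?_)
        rw [hP.loop_free _ _ _ h]
        ring
      intro k
      induction k using Fin.induction with
      | zero => rw [hs, S.layer_start]
      | succ k ih =>
        apply Fin.ext
        rw [Layering.mem_next.1 (hk k), ih]
        simp
  change _ = ∑ u, G u
  rw [h1, Finset.sum_subtype (p := fun u : (Fin (L + 1) → X) × (Fin L → A) =>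
    ∀ k, S.layer (u.1 k) = k) _ (by simp)]
  refine Finset.sum_congr rfl fun U _ => ?_
  have hU : U.1.1 0 = S.start := (S.layer_eq_zero_iff _).1 (U.2 0)
  simp only [trajProb, hG, Trajectory.state, Trajectory.action, Trajectory.nextState, hU,
    Pi.single_eq_same, one_mul, ← Finset.prod_mul_distrib]

/-- The probability that the trajectory visits the state `x`. -/
def stateProb (S : Layering X L) (P : X → A → X → ℝ) (π : X → A → ℝ) (x : X) : ℝ :=
  forward (Pi.single S.start 1) (fun _ x a x' => π x a * P x a x') (S.layer x) x

lemma forward_eq_stateProb {k : ℕ} {x : X} (hx : x ∈ S.states k) :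
    forward (Pi.single S.start 1) (fun _ x a x' => π x a * P x a x') k x = stateProb S P π x := by
  rw [stateProb, Layering.mem_states.1 hx]

lemma stateProb_start : stateProb S P π S.start = 1 := by
  simp [stateProb, S.layer_start, forward]

lemma stateProb_succ (hP : IsTransition S P) {k : ℕ} {y : X} (hy : y ∈ S.states (k + 1)) :
    stateProb S P π y = ∑ x ∈ S.states k, ∑ a, stateProb S P π x * (π x a * P x a y) := by
  rw [← forward_eq_stateProb hy]
  simp only [forward]
  rw [← Finset.sum_subset (Finset.subset_univ (S.states k))]
  · refine Finset.sum_congr rfl fun x hx => Finset.sum_congr rfl fun a _ => ?_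
    rw [forward_eq_stateProb hx]
  · intro x _ hx
    refine Finset.sum_eq_zero fun a _ => ?_
    rw [forward_layer _ k x hx, zero_mul]
    intro k x a x' h
    rw [hP.loop_free _ _ _ h, mul_zero]

lemma stateProb_nonneg (hP : IsTransition S P) (hπ : IsPolicy S π) (x : X) :
    0 ≤ stateProb S P π x := by
  obtain ⟨k, hk⟩ : ∃ k, x ∈ S.states k := ⟨_, Layering.mem_states.2 rfl⟩
  induction k generalizing x with
  | zero =>
    rw [S.states_zero, Finset.mem_singleton] at hk
    rw [hk, stateProb_start]
    exact zero_le_one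
  | succ k ih =>
    rw [stateProb_succ hP hk]
    exact Finset.sum_nonneg fun y hy => Finset.sum_nonneg fun a _ =>
      mul_nonneg (ih y hy) (mul_nonneg (hπ.nonneg _ _) (hP.nonneg _ _ _))

lemma IsTransition.sum_next (hP : IsTransition S P) {x : X} (hx : S.layer x ≠ Fin.last L) (a : A) :
    ∑ x' ∈ S.next x, P x a x' = 1 := by
  rw [← hP.sum_eq_one x a hx]
  exact Finset.sum_subset (Finset.subset_univ _) fun x' _ h => hP.loop_free x a x' h

/-- Weights of one step that add up to one preserve the total weight. -/
lemma sum_forward_succ {w : ℕ → X → A → X → ℝ} {ν : X → ℝ} {k : ℕ}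
    (h : ∀ x, forward ν w k x ≠ 0 → ∑ a, ∑ x', w k x a x' = 1) :
    ∑ y, forward ν w (k + 1) y = ∑ x, forward ν w k x := by
  simp only [forward]
  rw [Finset.sum_comm]
  refine Finset.sum_congr rfl fun x _ => ?_
  rw [Finset.sum_comm]
  simp_rw [← Finset.mul_sum]
  by_cases hx : forward ν w k x = 0
  · rw [hx, zero_mul]
  · rw [h x hx, mul_one]

lemma sum_policy_transition (hP : IsTransition S P) (hπ : IsPolicy S π) {x : X}
    (hx : S.layer x ≠ Fin.last L) : ∑ a, ∑ x', π x a * P x a x' = 1 := by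
  simp_rw [← Finset.mul_sum, hP.sum_eq_one x _ hx, mul_one]
  exact hπ.sum_eq_one x hx

lemma sum_stateProb (hP : IsTransition S P) (hπ : IsPolicy S π) {k : ℕ} (hk : k ≤ L) :
    ∑ x ∈ S.states k, stateProb S P π x = 1 := by
  have hw : ∀ (k : ℕ) x a x', x' ∉ S.next x → π x a * P x a x' = 0 := by
    intro _ x a x' h
    rw [hP.loop_free _ _ _ h, mul_zero]
  have h1 : ∑ x, forward (Pi.single S.start 1) (fun _ x a x' => π x a * P x a x') k x = 1 := by
    induction k with
    | zero => simp [forward]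
    | succ k ih =>
      rw [sum_forward_succ, ih (by omega)]
      intro x hx
      refine sum_policy_transition hP hπ ?_
      have : x ∈ S.states k := by
        by_contra h
        exact hx (forward_layer hw k x h)
      rw [Layering.mem_states] at this
      exact S.ne_last_of_lt (by omega)
  rw [← h1, ← Finset.sum_subset (Finset.subset_univ (S.states k))
    fun x _ hx => forward_layer hw k x hx]
  exact Finset.sum_congr rfl fun x hx => (forward_eq_stateProb hx).symm

lemma sum_trajProb_mul (hP : IsTransition S P) (hπ : IsPolicy S π) (k : Fin L)
    (G : X → A → X → ℝ) :
    ∑ U : Trajectory S A, trajProb S P π U * G (U.state k) (U.action k) (U.nextState k) =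
      ∑ x ∈ S.states k, ∑ a, ∑ x', stateProb S P π x * (π x a * P x a x') * G x a x' := by
  have h0 := sum_trajectory (π := π) hP fun j x a x' => if j = (k : ℕ) then G x a x' else 1
  have h1 : ∀ U : Trajectory S A, (∏ j : Fin L, if (j : ℕ) = (k : ℕ) then
      G (U.state j) (U.action j) (U.nextState j) else 1) =
      G (U.state k) (U.action k) (U.nextState k) := by
    intro U
    rw [Finset.prod_eq_single k]
    · simp
    · intro j _ hj
      rw [if_neg]
      exact fun h => hj (Fin.ext h)
    · simp
  simp_rw [h1] at h0
  rw [h0]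
  set w : ℕ → X → A → X → ℝ := fun j x a x' =>
    π x a * P x a x' * if j = (k : ℕ) then G x a x' else 1 with hw_def
  have hw : ∀ (k : ℕ) x a x', x' ∉ S.next x → w k x a x' = 0 := by
    intro _ x a x' h
    simp [hw_def, hP.loop_free _ _ _ h]
  have hle : ∀ j ≤ (k : ℕ), forward (Pi.single S.start 1) w j =
      forward (Pi.single S.start 1) (fun _ x a x' => π x a * P x a x') j := by
    intro j
    induction j with
    | zero => intro _; rfl
    | succ j ih =>
      intro hj
      funext y
      simp only [forward, ih (by omega)]
      refine Finset.sum_congr rfl fun x _ => Finset.sum_congr rfl fun a _ => ?_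
      simp only [hw_def]
      rw [if_neg (by omega), mul_one]
  have hge : ∀ j, (k : ℕ) + 1 + j ≤ L → ∑ y, forward (Pi.single S.start 1) w (k + 1 + j) y =
      ∑ y, forward (Pi.single S.start 1) w (k + 1) y := by
    intro j
    induction j with
    | zero => intro _; rfl
    | succ j ih =>
      intro hj
      rw [← ih (by omega)]
      refine sum_forward_succ fun x hx => ?_
      have hxs : x ∈ S.states (k + 1 + j) := by
        by_contra h
        exact hx (forward_layer hw _ x h)
      rw [Layering.mem_states] at hxs
      rw [← sum_policy_transition hP hπ (S.ne_last_of_lt (x := x) (by omega))]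
      refine Finset.sum_congr rfl fun a _ => Finset.sum_congr rfl fun x' _ => ?_
      simp only [hw_def]
      rw [if_neg (by change ¬ ((k : ℕ) + 1 + j = k); omega), mul_one]
  have hL : (k : ℕ) + 1 + (L - (k + 1)) = L := by omega
  have h2 := hge (L - (k + 1)) (by omega)
  rw [hL] at h2
  rw [h2]
  simp only [forward]
  rw [Finset.sum_comm, hle k le_rfl]
  rw [← Finset.sum_subset (Finset.subset_univ (S.states k))]
  · refine Finset.sum_congr rfl fun x hx => ?_
    rw [Finset.sum_comm]
    refine Finset.sum_congr rfl fun a _ => Finset.sum_congr rfl fun x' _ => ?_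
    rw [forward_eq_stateProb hx]
    simp only [hw_def, if_true]
    ring
  · intro x _ hx
    refine Finset.sum_eq_zero fun y _ => Finset.sum_eq_zero fun a _ => ?_
    rw [← hle k le_rfl, forward_layer hw k x hx, zero_mul]

lemma trajProb_nonneg (hP : IsTransition S P) (hπ : IsPolicy S π) (U : Trajectory S A) :
    0 ≤ trajProb S P π U :=
  Finset.prod_nonneg fun _ _ => mul_nonneg (hπ.nonneg _ _) (hP.nonneg _ _ _)

lemma sum_trajProb (hL : 0 < L) (hP : IsTransition S P) (hπ : IsPolicy S π) :
    ∑ U : Trajectory S A, trajProb S P π U = 1 := by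
  have h := sum_trajProb_mul hP hπ ⟨0, hL⟩ fun _ _ _ => 1
  simp only [mul_one] at h
  rw [h]
  simp_rw [← Finset.mul_sum]
  rw [← sum_stateProb hP hπ (Nat.zero_le L)]
  refine Finset.sum_congr rfl fun x hx => ?_
  rw [Layering.mem_states] at hx
  have h1 := sum_policy_transition hP hπ (S.ne_last_of_lt (x := x) (by omega))
  simp_rw [← Finset.mul_sum] at h1
  rw [h1, mul_one]

lemma occupancy_eq (hP : IsTransition S P) (hπ : IsPolicy S π) (x : X) (a : A) (x' : X) :
    occupancy S P π x a x' = stateProb S P π x * (π x a * P x a x') := by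
  by_cases hx : S.layer x = Fin.last L
  · rw [hP.loop_free x a x' (by simp [S.next_eq_empty hx]), mul_zero, mul_zero, occupancy]
    refine Finset.sum_eq_zero fun U hU => ?_
    obtain ⟨k, hk, -⟩ := (Finset.mem_filter.1 hU).2
    rw [hx] at hk
    exact absurd hk (Fin.castSucc_lt_last k).ne
  · have hlt := S.lt_of_ne_last hx
    have h := sum_trajProb_mul hP hπ ⟨S.layer x, hlt⟩
      fun y b y' => if y = x ∧ b = a ∧ y' = x' then 1 else 0
    rw [occupancy, Finset.sum_filter]
    trans ∑ U : Trajectory S A, trajProb S P π U *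
      if U.state ⟨S.layer x, hlt⟩ = x ∧ U.action ⟨S.layer x, hlt⟩ = a ∧
        U.nextState ⟨S.layer x, hlt⟩ = x' then 1 else 0
    · refine Finset.sum_congr rfl fun U _ => ?_
      rw [mul_ite, mul_one, mul_zero]
      refine if_congr ?_ rfl rfl
      constructor
      · rintro ⟨k, hk, h⟩
        have hk' : k = ⟨S.layer x, hlt⟩ := by
          apply Fin.ext
          have h1 := congrArg Fin.val hk
          exact h1
        rwa [hk'] at h
      · intro h
        exact ⟨_, Fin.ext rfl, h⟩
    · rw [h, Finset.sum_eq_single x, Finset.sum_eq_single a, Finset.sum_eq_single x']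
      · simp
      · intro y _ hy; simp [hy]
      · simp
      · intro b _ hb; simp [hb]
      · simp
      · intro y _ hy; simp [hy]
      · intro h; exact absurd (Layering.mem_states.2 rfl) h

end

/-! ### Exponential supermartingales over the episodes -/

section

variable {X A : Type*} [Fintype X] [Fintype A] [DecidableEq X] [DecidableEq A] {L : ℕ}

/-- Hoeffding's lemma for a distribution with finite support. -/
lemma sum_mul_exp_le {ι : Type*} [Fintype ι] {p W : ι → ℝ} (hp : ∀ i, 0 ≤ p i)
    (hp1 : ∑ i, p i = 1) {a b : ℝ} (hW : ∀ i, W i ∈ Set.Icc a b) (s : ℝ) :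
    ∑ i, p i * Real.exp (s * (W i - ∑ j, p j * W j)) ≤ Real.exp (s ^ 2 * (b - a) ^ 2 / 8) := by
  let _ : MeasurableSpace ι := ⊤
  let μ : PMF ι := PMF.ofFintype (fun i => ENNReal.ofReal (p i)) (by
    rw [← ENNReal.ofReal_sum_of_nonneg fun i _ => hp i, hp1, ENNReal.ofReal_one])
  have hint : ∀ g : ι → ℝ, ∫ i, g i ∂μ.toMeasure = ∑ i, p i * g i := by
    intro g
    rw [PMF.integral_eq_sum]
    refine Finset.sum_congr rfl fun i _ => ?_
    simp [μ, ENNReal.toReal_ofReal (hp i)]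
  have h := (ProbabilityTheory.hasSubgaussianMGF_of_mem_Icc (μ := μ.toMeasure) (X := W) (a := a)
    (b := b) (Measurable.of_discrete).aemeasurable (Filter.Eventually.of_forall hW)).mgf_le s
  rw [ProbabilityTheory.mgf, hint, hint] at h
  refine h.trans (le_of_eq ?_)
  congr 1
  simp only [NNReal.coe_pow, NNReal.coe_div, coe_nnnorm, Real.norm_eq_abs, NNReal.coe_ofNat,
    div_pow, sq_abs]
  ring

variable {S : Layering X L} {P : X → A → X → ℝ}
  {π : (t : ℕ) → (Fin t → Trajectory S A) → X → A → ℝ}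

lemma sum_historyProb_succ (t : ℕ) (G : (Fin t → Trajectory S A) → Trajectory S A → ℝ) :
    ∑ h : Fin (t + 1) → Trajectory S A,
      historyProb S P π (t + 1) h * G (Fin.init h) (h (Fin.last t)) =
    ∑ h : Fin t → Trajectory S A,
      historyProb S P π t h * ∑ U, trajProb S P (π t h) U * G h U := by
  rw [← (Fin.snocEquiv fun _ : Fin (t + 1) => Trajectory S A).sum_comp, Fintype.sum_prod_type,
    Finset.sum_comm]
  refine Finset.sum_congr rfl fun h _ => ?_
  rw [Finset.mul_sum]
  refine Finset.sum_congr rfl fun U _ => ?_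
  simp only [Fin.snocEquiv, Equiv.coe_fn_mk, historyProb, Fin.init_snoc, Fin.snoc_last]
  ring

lemma historyProb_nonneg (hP : IsTransition S P) {T : ℕ} (hπ : ∀ t < T, ∀ h, IsPolicy S (π t h))
    (h : Fin T → Trajectory S A) : 0 ≤ historyProb S P π T h := by
  induction T with
  | zero => exact zero_le_one
  | succ T ih =>
    exact mul_nonneg (ih (fun t ht => hπ t (by omega)) _)
      (trajProb_nonneg hP (hπ T (by omega) _) _)

lemma sum_historyProb (hL : 0 < L) (hP : IsTransition S P) {T : ℕ}
    (hπ : ∀ t < T, ∀ h, IsPolicy S (π t h)) :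
    ∑ h : Fin T → Trajectory S A, historyProb S P π T h = 1 := by
  induction T with
  | zero => simp [historyProb]
  | succ T ih =>
    have h := sum_historyProb_succ (P := P) (π := π) T fun _ _ => 1
    simp only [mul_one] at h
    rw [h, ← ih fun t ht => hπ t (by omega)]
    refine Finset.sum_congr rfl fun h _ => ?_
    rw [sum_trajProb hL hP (hπ T (by omega) h), mul_one]

lemma eventProb_mono (hP : IsTransition S P) {T : ℕ} (hπ : ∀ t < T, ∀ h, IsPolicy S (π t h))
    {E E' : Set (Fin T → Trajectory S A)} (h : E ⊆ E') :
    eventProb S P π T E ≤ eventProb S P π T E' :=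
  Finset.sum_le_sum fun _ _ =>
    Set.indicator_le_indicator_of_subset h (fun _ => historyProb_nonneg hP hπ _) _

lemma eventProb_compl (hL : 0 < L) (hP : IsTransition S P) {T : ℕ}
    (hπ : ∀ t < T, ∀ h, IsPolicy S (π t h)) (E : Set (Fin T → Trajectory S A)) :
    eventProb S P π T Eᶜ = 1 - eventProb S P π T E := by
  rw [eq_sub_iff_add_eq, ← sum_historyProb hL hP hπ, eventProb, eventProb,
    ← Finset.sum_add_distrib]
  exact Finset.sum_congr rfl fun h _ => by rw [add_comm, Set.indicator_self_add_compl_apply]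

lemma eventProb_union_le (hP : IsTransition S P) {T : ℕ} (hπ : ∀ t < T, ∀ h, IsPolicy S (π t h))
    (E E' : Set (Fin T → Trajectory S A)) :
    eventProb S P π T (E ∪ E') ≤ eventProb S P π T E + eventProb S P π T E' := by
  rw [eventProb, eventProb, eventProb, ← Finset.sum_add_distrib]
  refine Finset.sum_le_sum fun h _ => ?_
  have h0 := historyProb_nonneg hP hπ h
  by_cases h1 : h ∈ E <;> by_cases h2 : h ∈ E' <;> simp [h1, h2, h0]

lemma eventProb_iUnion_le (hP : IsTransition S P) {T : ℕ}
    (hπ : ∀ t < T, ∀ h, IsPolicy S (π t h)) {ι : Type*} (s : Finset ι)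
    (E : ι → Set (Fin T → Trajectory S A)) :
    eventProb S P π T {h | ∃ i ∈ s, h ∈ E i} ≤ ∑ i ∈ s, eventProb S P π T (E i) := by
  classical
  induction s using Finset.induction_on with
  | empty => simp [eventProb]
  | insert i s hi ih =>
    rw [Finset.sum_insert hi]
    refine (eventProb_mono hP hπ ?_).trans
      ((eventProb_union_le hP hπ (E i) {h | ∃ j ∈ s, h ∈ E j}).trans (add_le_add le_rfl ih))
    rintro h ⟨j, hj, hh⟩
    rcases Finset.mem_insert.1 hj with rfl | hj
    · exact Or.inl hh
    · exact Or.inr ⟨j, hj, hh⟩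

/-- The sum of increments `φ s`, each of which depends on the trajectory of the episode `s` and on
those of the earlier episodes. -/
def cumul (φ : (t : ℕ) → (Fin t → Trajectory S A) → Trajectory S A → ℝ) :
    (t : ℕ) → (Fin t → Trajectory S A) → ℝ
  | 0, _ => 0
  | t + 1, h => cumul φ t (Fin.init h) + φ t (Fin.init h) (h (Fin.last t))

lemma sum_historyProb_exp_cumul_le (hP : IsTransition S P) {T : ℕ}
    (hπ : ∀ t < T, ∀ h, IsPolicy S (π t h))
    (φ : (t : ℕ) → (Fin t → Trajectory S A) → Trajectory S A → ℝ)
    (hφ : ∀ t < T, ∀ h, ∑ U, trajProb S P (π t h) U * Real.exp (φ t h U) ≤ 1) :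
    ∑ h, historyProb S P π T h * Real.exp (cumul φ T h) ≤ 1 := by
  induction T with
  | zero => simp [historyProb, cumul]
  | succ T ih =>
    have h1 := sum_historyProb_succ (P := P) (π := π) T
      fun h U => Real.exp (cumul φ T h + φ T h U)
    simp only [cumul]
    rw [h1]
    refine le_trans (Finset.sum_le_sum fun h _ => ?_)
      (ih (fun t ht => hπ t (by omega)) fun t ht => hφ t (by omega))
    refine mul_le_mul_of_nonneg_left ?_ (historyProb_nonneg hP (fun t ht => hπ t (by omega)) h)
    have h2 : ∀ U, trajProb S P (π T h) U * Real.exp (cumul φ T h + φ T h U) =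
        Real.exp (cumul φ T h) * (trajProb S P (π T h) U * Real.exp (φ T h U)) := by
      intro U
      rw [Real.exp_add]
      ring
    simp_rw [h2, ← Finset.mul_sum]
    exact mul_le_of_le_one_right (Real.exp_pos _).le (hφ T (by omega) h)

/-- If the exponential increments have conditional expectation at most one, then the sum of the
increments reaches `b` with probability at most `exp (-b)`. -/
lemma eventProb_cumul_ge_le (hP : IsTransition S P) {T : ℕ}
    (hπ : ∀ t < T, ∀ h, IsPolicy S (π t h))
    (φ : (t : ℕ) → (Fin t → Trajectory S A) → Trajectory S A → ℝ)
    (hφ : ∀ t < T, ∀ h, ∑ U, trajProb S P (π t h) U * Real.exp (φ t h U) ≤ 1) (b : ℝ) :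
    eventProb S P π T {h | b ≤ cumul φ T h} ≤ Real.exp (-b) := by
  have h1 := sum_historyProb_exp_cumul_le hP hπ φ hφ
  have h2 : eventProb S P π T {h | b ≤ cumul φ T h} ≤
      ∑ h, Real.exp (-b) * (historyProb S P π T h * Real.exp (cumul φ T h)) := by
    refine Finset.sum_le_sum fun h _ => ?_
    have h0 := historyProb_nonneg hP hπ h
    by_cases hb : b ≤ cumul φ T h
    · rw [Set.indicator_of_mem (show h ∈ {h | b ≤ cumul φ T h} from hb)]
      have h3 : 1 ≤ Real.exp (-b) * Real.exp (cumul φ T h) := by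
        rw [← Real.exp_add]
        exact Real.one_le_exp (by linarith)
      nlinarith
    · rw [Set.indicator_of_notMem (show h ∉ {h | b ≤ cumul φ T h} from hb)]
      positivity
  rw [← Finset.mul_sum] at h2
  exact h2.trans (mul_le_of_le_one_right (Real.exp_pos _).le h1)

/-- The first `t` trajectories of an infinite sequence. -/
def prefixOf (H : ℕ → Trajectory S A) (t : ℕ) : Fin t → Trajectory S A := fun s => H s

@[simp] lemma init_prefixOf (H : ℕ → Trajectory S A) (t : ℕ) :
    Fin.init (prefixOf H (t + 1)) = prefixOf H t := rfl

@[simp] lemma prefixOf_last (H : ℕ → Trajectory S A) (t : ℕ) :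
    prefixOf H (t + 1) (Fin.last t) = H t := rfl

lemma cumul_prefixOf (φ : (t : ℕ) → (Fin t → Trajectory S A) → Trajectory S A → ℝ)
    (H : ℕ → Trajectory S A) (t : ℕ) :
    cumul φ t (prefixOf H t) = ∑ s ∈ Finset.range t, φ s (prefixOf H s) (H s) := by
  induction t with
  | zero => simp [cumul]
  | succ t ih => rw [cumul, init_prefixOf, prefixOf_last, ih, Finset.sum_range_succ]

lemma exists_prefixOf_eq {T : ℕ} (hT : 0 < T) (h : Fin T → Trajectory S A) :
    ∃ H : ℕ → Trajectory S A, prefixOf H T = h := by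
  refine ⟨fun n => if hn : n < T then h ⟨n, hn⟩ else h ⟨0, hT⟩, ?_⟩
  funext s
  simp [prefixOf]

end

/-! ### Visit counts and epochs -/

section

variable {X A : Type*} [Fintype X] [Fintype A] [DecidableEq X] [DecidableEq A] {L : ℕ}
variable {S : Layering X L}

lemma Trajectory.layer_state (U : Trajectory S A) (k : Fin L) : (S.layer (U.state k) : ℕ) = k := by
  rw [Trajectory.state, U.2]
  rfl

lemma Trajectory.layer_nextState (U : Trajectory S A) (k : Fin L) :
    (S.layer (U.nextState k) : ℕ) = k + 1 := by
  rw [Trajectory.nextState, U.2]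
  rfl

lemma visits_eq (U : Trajectory S A) (k : Fin L) {x : X} (hx : (S.layer x : ℕ) = k) (a : A) :
    visits U x a = if U.state k = x ∧ U.action k = a then 1 else 0 := by
  have h : ∀ j, U.state j = x ∧ U.action j = a → j = k := by
    rintro j ⟨rfl, -⟩
    exact Fin.ext ((U.layer_state j).symm.trans hx)
  rw [visits]
  split_ifs with hk
  · rw [Finset.card_eq_one]
    refine ⟨k, Finset.ext fun j => ?_⟩
    simp only [Finset.mem_filter, Finset.mem_univ, true_and, Finset.mem_singleton]
    exact ⟨h j, fun hj => hj ▸ hk⟩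
  · rw [Finset.card_eq_zero, Finset.filter_eq_empty_iff]
    intro j _ hj
    exact hk (h j hj ▸ hj)

lemma transits_eq (U : Trajectory S A) (k : Fin L) {x : X} (hx : (S.layer x : ℕ) = k) (a : A)
    (x' : X) :
    transits U x a x' =
      if U.state k = x ∧ U.action k = a ∧ U.nextState k = x' then 1 else 0 := by
  have h : ∀ j, U.state j = x ∧ U.action j = a ∧ U.nextState j = x' → j = k := by
    rintro j ⟨rfl, -⟩
    exact Fin.ext ((U.layer_state j).symm.trans hx)
  rw [transits]
  split_ifs with hk
  · rw [Finset.card_eq_one]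
    refine ⟨k, Finset.ext fun j => ?_⟩
    simp only [Finset.mem_filter, Finset.mem_univ, true_and, Finset.mem_singleton]
    exact ⟨h j, fun hj => hj ▸ hk⟩
  · rw [Finset.card_eq_zero, Finset.filter_eq_empty_iff]
    intro j _ hj
    exact hk (h j hj ▸ hj)

lemma visits_of_last (U : Trajectory S A) {x : X} (hx : S.layer x = Fin.last L) (a : A) :
    visits U x a = 0 := by
  rw [visits, Finset.card_eq_zero, Finset.filter_eq_empty_iff]
  rintro j _ ⟨rfl, -⟩
  have := U.layer_state j
  rw [hx, Fin.val_last] at this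
  omega

lemma visits_le_one (U : Trajectory S A) (x : X) (a : A) : visits U x a ≤ 1 := by
  by_cases hx : S.layer x = Fin.last L
  · rw [visits_of_last U hx]
    exact zero_le_one
  · rw [visits_eq U ⟨_, S.lt_of_ne_last hx⟩ rfl]
    split_ifs <;> simp

lemma transits_of_notMem (U : Trajectory S A) {x x' : X} (hx : x' ∉ S.next x) (a : A) :
    transits U x a x' = 0 := by
  rw [transits, Finset.card_eq_zero, Finset.filter_eq_empty_iff]
  rintro j _ ⟨rfl, -, rfl⟩
  apply hx
  rw [Layering.mem_next, U.layer_state, U.layer_nextState]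

lemma sum_transits (U : Trajectory S A) (x : X) (a : A) (B : Finset X) :
    ∑ x' ∈ B, transits U x a x' =
      (Finset.univ.filter fun k : Fin L =>
        (U.state k = x ∧ U.action k = a) ∧ U.nextState k ∈ B).card := by
  simp only [transits]
  rw [Finset.card_eq_sum_card_fiberwise (t := B) (f := fun k => U.nextState k)]
  · refine Finset.sum_congr rfl fun x' hx' => ?_
    congr 1
    ext k
    simp only [Finset.mem_filter, Finset.mem_univ, true_and]
    constructor
    · rintro ⟨h1, h2, rfl⟩
      exact ⟨⟨⟨h1, h2⟩, hx'⟩, rfl⟩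
    · rintro ⟨⟨⟨h1, h2⟩, -⟩, h3⟩
      exact ⟨h1, h2, h3⟩
  · intro k hk
    exact (Finset.mem_filter.1 hk).2.2

lemma sum_univ_transits (U : Trajectory S A) (x : X) (a : A) :
    ∑ x', transits U x a x' = visits U x a := by
  rw [sum_transits, visits]
  simp

lemma sum_states_visits_mul (U : Trajectory S A) (k : Fin L) (g : X → A → ℝ) :
    ∑ x ∈ S.states k, ∑ a, (visits U x a : ℝ) * g x a = g (U.state k) (U.action k) := by
  rw [Finset.sum_eq_single (U.state k), Finset.sum_eq_single (U.action k)]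
  · rw [visits_eq U k (U.layer_state k)]
    simp
  · intro a _ ha
    rw [visits_eq U k (U.layer_state k), if_neg (fun h => ha h.2.symm)]
    simp
  · simp
  · intro x hx hne
    refine Finset.sum_eq_zero fun a _ => ?_
    rw [visits_eq U k (Layering.mem_states.1 hx), if_neg (fun h => hne h.1.symm)]
    simp
  · intro h
    exact absurd (Layering.mem_states.2 (U.layer_state k)) h

/-- The number of visits to `(x,a)` in the episodes before `t`. -/
def totalVisits (H : ℕ → Trajectory S A) (t : ℕ) (x : X) (a : A) : ℕ :=
  ∑ s ∈ Finset.range t, visits (H s) x a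

/-- The number of transitions `(x,a,x')` in the episodes before `t`. -/
def totalTransits (H : ℕ → Trajectory S A) (t : ℕ) (x : X) (a : A) (x' : X) : ℕ :=
  ∑ s ∈ Finset.range t, transits (H s) x a x'

lemma totalVisits_succ (H : ℕ → Trajectory S A) (t : ℕ) (x : X) (a : A) :
    totalVisits H (t + 1) x a = totalVisits H t x a + visits (H t) x a :=
  Finset.sum_range_succ _ _

lemma totalTransits_succ (H : ℕ → Trajectory S A) (t : ℕ) (x : X) (a : A) (x' : X) :
    totalTransits H (t + 1) x a x' = totalTransits H t x a x' + transits (H t) x a x' :=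
  Finset.sum_range_succ _ _

lemma totalVisits_mono (H : ℕ → Trajectory S A) (x : X) (a : A) {s t : ℕ} (h : s ≤ t) :
    totalVisits H s x a ≤ totalVisits H t x a :=
  Finset.sum_le_sum_of_subset (Finset.range_subset_range.2 h)

lemma totalVisits_le (H : ℕ → Trajectory S A) (x : X) (a : A) (t : ℕ) :
    totalVisits H t x a ≤ t := by
  refine (Finset.sum_le_card_nsmul _ _ 1 fun s _ => visits_le_one (H s) x a).trans ?_
  simp

lemma sum_totalTransits (H : ℕ → Trajectory S A) (t : ℕ) (x : X) (a : A) :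
    ∑ x' ∈ S.next x, totalTransits H t x a x' = totalVisits H t x a := by
  simp only [totalTransits, totalVisits]
  rw [Finset.sum_comm]
  refine Finset.sum_congr rfl fun s _ => ?_
  rw [← sum_univ_transits]
  exact Finset.sum_subset (Finset.subset_univ _) fun x' _ h => transits_of_notMem _ h a

lemma totalTransits_of_notMem (H : ℕ → Trajectory S A) (t : ℕ) {x x' : X} (hx : x' ∉ S.next x)
    (a : A) : totalTransits H t x a x' = 0 :=
  Finset.sum_eq_zero fun _ _ => transits_of_notMem _ hx a

/-- The counters `N`, `M` are the counts of some earlier time `e` (the start of the epoch), and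
within an epoch no pair is visited more than `max {1, N(x,a)}` times. -/
lemma countersAt_prefixOf {r : ℕ} (hr : r ≤ 1) (H : ℕ → Trajectory S A) (t : ℕ) :
    ∃ e ≤ t, (∀ x a, (countersAt S r t (prefixOf H t)).N x a = totalVisits H e x a) ∧
      (∀ x a x', (countersAt S r t (prefixOf H t)).M x a x' = totalTransits H e x a x') ∧
      (∀ x a, (countersAt S r t (prefixOf H t)).N x a + (countersAt S r t (prefixOf H t)).n x a =
        totalVisits H t x a) ∧
      (∀ x a x', (countersAt S r t (prefixOf H t)).M x a x' +
        (countersAt S r t (prefixOf H t)).m x a x' = totalTransits H t x a x') ∧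
      ∀ x a, (countersAt S r t (prefixOf H t)).n x a <
        max 1 ((countersAt S r t (prefixOf H t)).N x a) := by
  induction t with
  | zero => exact ⟨0, le_rfl, by simp [countersAt, totalVisits, totalTransits]⟩
  | succ t ih =>
    obtain ⟨e, he, hN, hM, hn, hm, hlt⟩ := ih
    rw [countersAt, init_prefixOf, prefixOf_last]
    set c := countersAt S r t (prefixOf H t) with hc
    simp only [Counters.update]
    split_ifs with hex
    · refine ⟨t + 1, le_rfl, ?_, ?_, ?_, ?_, ?_⟩
      · intro x a
        rw [totalVisits_succ, ← hn x a, add_assoc]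
      · intro x a x'
        rw [totalTransits_succ, ← hm x a x', add_assoc]
      · intro x a
        rw [totalVisits_succ, ← hn x a, add_zero, add_assoc]
      · intro x a x'
        rw [totalTransits_succ, ← hm x a x', add_zero, add_assoc]
      · intro x a
        exact lt_max_of_lt_left zero_lt_one
    · refine ⟨e, by omega, hN, hM, ?_, ?_, ?_⟩
      · intro x a
        rw [totalVisits_succ, ← hn x a, add_assoc]
      · intro x a x'
        rw [totalTransits_succ, ← hm x a x', add_assoc]
      · intro x a
        have h1 : ¬ max r (c.N x a) ≤ c.n x a + visits (H t) x a := fun h => hex ⟨x, a, h⟩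
        exact (not_le.1 h1).trans_le (max_le_max hr le_rfl)

/-- The doubling rule keeps the number of visits before the epoch within a factor two of the number
of visits before the episode. -/
lemma totalVisits_add_one_le {r : ℕ} (hr : r ≤ 1) (H : ℕ → Trajectory S A) (t : ℕ) (x : X) (a : A) :
    totalVisits H t x a + 1 ≤ 2 * max 1 ((countersAt S r t (prefixOf H t)).N x a) := by
  obtain ⟨e, -, -, -, hn, -, hlt⟩ := countersAt_prefixOf hr H t
  have h1 := hn x a
  have h2 := hlt x a
  omega

lemma inv_sqrt_add_one_le (n : ℕ) :
    1 / Real.sqrt (n + 1) ≤ 2 * (Real.sqrt (n + 1) - Real.sqrt n) := by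
  have h1 : (0 : ℝ) < n + 1 := by positivity
  have h2 := Real.sq_sqrt h1.le
  have h3 := Real.sq_sqrt (Nat.cast_nonneg n : (0 : ℝ) ≤ n)
  have h4 := Real.sqrt_pos.2 h1
  rw [div_le_iff₀ h4]
  nlinarith [sq_nonneg (Real.sqrt (n + 1) - Real.sqrt n)]

lemma sum_visits_div_sqrt_le {r : ℕ} (hr : r ≤ 1) (H : ℕ → Trajectory S A) (T : ℕ) (x : X) (a : A) :
    ∑ t ∈ Finset.range T, (visits (H t) x a : ℝ) /
      Real.sqrt (max 1 ((countersAt S r t (prefixOf H t)).N x a : ℝ)) ≤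
      2 * Real.sqrt 2 * Real.sqrt (totalVisits H T x a) := by
  induction T with
  | zero => simp [totalVisits]
  | succ T ih =>
    rw [Finset.sum_range_succ]
    set N := (countersAt S r T (prefixOf H T)).N x a with hN
    have h2 := totalVisits_add_one_le hr H T x a
    rw [← hN] at h2
    have h3 : ((totalVisits H T x a : ℝ) + 1) ≤ 2 * max 1 (N : ℝ) := by exact_mod_cast h2
    rw [totalVisits_succ]
    rcases Nat.le_one_iff_eq_zero_or_eq_one.1 (visits_le_one (H T) x a) with h | h
    · rw [h]
      simpa using ih
    · rw [h]
      have h4 := inv_sqrt_add_one_le (totalVisits H T x a)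
      have h5 : (1 : ℝ) / Real.sqrt (max 1 (N : ℝ)) ≤
          Real.sqrt 2 * (1 / Real.sqrt (totalVisits H T x a + 1)) := by
        rw [mul_one_div, div_le_div_iff₀ (Real.sqrt_pos.2 (by positivity))
          (Real.sqrt_pos.2 (by positivity)), one_mul, ← Real.sqrt_mul (by norm_num)]
        exact Real.sqrt_le_sqrt h3
      have h6 := mul_le_mul_of_nonneg_left h4 (Real.sqrt_nonneg 2)
      push_cast
      linarith

lemma sum_states_totalVisits (H : ℕ → Trajectory S A) (T : ℕ) (k : Fin L) :
    ∑ x ∈ S.states k, ∑ a, (totalVisits H T x a : ℝ) = T := by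
  induction T with
  | zero => simp [totalVisits]
  | succ T ih =>
    simp only [totalVisits_succ, Nat.cast_add, Finset.sum_add_distrib, ih]
    have := sum_states_visits_mul (H T) k fun _ _ => 1
    simp only [mul_one] at this
    rw [this]
    simp

end

/-! ### Concentration of the empirical transition function -/

section

variable {X A : Type*} [Fintype X] [Fintype A] [DecidableEq X] [DecidableEq A] {L : ℕ}
variable {S : Layering X L} {P : X → A → X → ℝ}

lemma sum_trajProb_exp_le {ρ : X → A → ℝ} (hP : IsTransition S P) (hρ : IsPolicy S ρ) (k : Fin L)
    (G : X → A → X → ℝ)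
    (hG : ∀ x ∈ S.states k, ∀ a, ∑ x', P x a x' * Real.exp (G x a x') ≤ 1) :
    ∑ U : Trajectory S A, trajProb S P ρ U *
      Real.exp (G (U.state k) (U.action k) (U.nextState k)) ≤ 1 := by
  rw [sum_trajProb_mul hP hρ k fun x a x' => Real.exp (G x a x'), ← sum_stateProb hP hρ k.2.le]
  refine Finset.sum_le_sum fun x hx => ?_
  have h1 : ∀ a, ∑ x', stateProb S P ρ x * (ρ x a * P x a x') * Real.exp (G x a x') ≤
      stateProb S P ρ x * ρ x a := by
    intro a
    have h2 : ∀ x', stateProb S P ρ x * (ρ x a * P x a x') * Real.exp (G x a x') =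
        stateProb S P ρ x * ρ x a * (P x a x' * Real.exp (G x a x')) := fun x' => by ring
    simp_rw [h2, ← Finset.mul_sum]
    exact mul_le_of_le_one_right
      (mul_nonneg (stateProb_nonneg hP hρ x) (hρ.nonneg x a)) (hG x hx a)
  refine (Finset.sum_le_sum fun a _ => h1 a).trans ?_
  rw [← Finset.mul_sum, hρ.sum_eq_one, mul_one]
  have := k.2
  rw [Layering.mem_states] at hx
  exact S.ne_last_of_lt (by omega)

/-- The increment, in one episode, of the exponent of the supermartingale that compares the number
of transitions from `(x,a)` into `B` with its expectation, during the first `n` visits. -/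
def transitionIncrement (P : X → A → X → ℝ) (x : X) (a : A) (n : ℕ) (B : Finset X) (s : ℝ) (t : ℕ)
    (h : Fin t → Trajectory S A) (U : Trajectory S A) : ℝ :=
  if ∑ i, visits (h i) x a < n then
    s * (((∑ x' ∈ B, transits U x a x' : ℕ) : ℝ) - visits U x a * ∑ x' ∈ B, P x a x')
      - visits U x a * (s ^ 2 / 8)
  else 0

lemma sum_trajProb_exp_transitionIncrement_le {ρ : X → A → ℝ} (hP : IsTransition S P)
    (hρ : IsPolicy S ρ) {x : X} (hx : S.layer x ≠ Fin.last L) (a : A) (n : ℕ) (B : Finset X)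
    (s : ℝ) (t : ℕ) (h : Fin t → Trajectory S A) :
    ∑ U, trajProb S P ρ U * Real.exp (transitionIncrement P x a n B s t h U) ≤ 1 := by
  set k : Fin L := ⟨S.layer x, S.lt_of_ne_last hx⟩ with hk
  have hkx : (S.layer x : ℕ) = k := rfl
  let G : X → A → X → ℝ := fun y b y' =>
    if ∑ i, visits (h i) x a < n then
      if y = x ∧ b = a then
        s * ((if y' ∈ B then 1 else 0) - ∑ x' ∈ B, P x a x') - s ^ 2 / 8
      else 0
    else 0
  have hGU : ∀ U, transitionIncrement P x a n B s t h U =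
      G (U.state k) (U.action k) (U.nextState k) := by
    intro U
    simp only [transitionIncrement, G]
    split_ifs with h1 h2 h3
    · rw [visits_eq U k hkx, if_pos h2]
      have : ∑ x' ∈ B, transits U x a x' = 1 := by
        simp only [transits_eq U k hkx, h2, true_and]
        rw [Finset.sum_ite_eq, if_pos h3]
      rw [this]
      simp
    · rw [visits_eq U k hkx, if_pos h2]
      have : ∑ x' ∈ B, transits U x a x' = 0 := by
        simp only [transits_eq U k hkx, h2, true_and]
        rw [Finset.sum_ite_eq, if_neg h3]
      rw [this]
      simp
    · rw [visits_eq U k hkx, if_neg h2]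
      have : ∑ x' ∈ B, transits U x a x' = 0 := by
        refine Finset.sum_eq_zero fun x' _ => ?_
        rw [transits_eq U k hkx, if_neg fun hh => h2 ⟨hh.1, hh.2.1⟩]
      rw [this]
      simp
    · rfl
  simp_rw [hGU]
  refine sum_trajProb_exp_le hP hρ k G fun y hy b => ?_
  have hy' : S.layer y ≠ Fin.last L := by
    have := k.2
    rw [Layering.mem_states] at hy
    exact S.ne_last_of_lt (by omega)
  have htriv : ∑ y', P y b y' * Real.exp 0 ≤ 1 := by
    simp only [Real.exp_zero, mul_one]
    exact (hP.sum_eq_one y b hy').le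
  simp only [G]
  by_cases h1 : ∑ i, visits (h i) x a < n
  · by_cases h2 : y = x ∧ b = a
    · obtain ⟨rfl, rfl⟩ := h2
      simp only [h1, and_self, if_true]
      have hH := sum_mul_exp_le (hP.nonneg y b) (hP.sum_eq_one y b hy')
        (W := fun y' => if y' ∈ B then 1 else 0) (a := 0) (b := 1)
        (fun y' => by split_ifs <;> simp) s
      have hmean : ∑ y', P y b y' * (if y' ∈ B then (1 : ℝ) else 0) = ∑ y' ∈ B, P y b y' := by
        simp
      rw [hmean] at hH
      have hE : ∀ y', P y b y' * Real.exp (s * ((if y' ∈ B then (1 : ℝ) else 0) -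
          ∑ x' ∈ B, P y b x') - s ^ 2 / 8) = Real.exp (-(s ^ 2 / 8)) * (P y b y' *
          Real.exp (s * ((if y' ∈ B then (1 : ℝ) else 0) - ∑ x' ∈ B, P y b x'))) := by
        intro y'
        rw [sub_eq_add_neg _ (s ^ 2 / 8), Real.exp_add]
        ring
      simp_rw [hE]
      rw [← Finset.mul_sum]
      refine (mul_le_mul_of_nonneg_left hH (Real.exp_pos _).le).trans ?_
      rw [← Real.exp_add]
      refine Real.exp_le_one_iff.2 (le_of_eq ?_)
      ring
    · simpa only [h2, if_false, if_true, h1] using htriv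
  · simpa only [h1, if_false] using htriv

lemma sum_visits_prefixOf (H : ℕ → Trajectory S A) (t : ℕ) (x : X) (a : A) :
    ∑ i, visits (prefixOf H t i) x a = totalVisits H t x a := by
  rw [totalVisits, ← Fin.sum_univ_eq_sum_range fun s => visits (H s) x a]
  rfl

/-- After the `n`-th visit the sum of the increments is constant. -/
lemma cumul_transitionIncrement (H : ℕ → Trajectory S A) {x : X} {a : A} {n : ℕ} {B : Finset X}
    {s : ℝ} {t T : ℕ} (htT : t ≤ T) (ht : totalVisits H t x a = n) :
    cumul (transitionIncrement P x a n B s) T (prefixOf H T) =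
      s * (((∑ x' ∈ B, totalTransits H t x a x' : ℕ) : ℝ) - n * ∑ x' ∈ B, P x a x')
        - n * (s ^ 2 / 8) := by
  rw [cumul_prefixOf]
  induction T, htT using Nat.le_induction with
  | base =>
    rw [← ht]
    have hstep : ∀ i ∈ Finset.range t, transitionIncrement P x a n B s i (prefixOf H i) (H i) =
        s * (((∑ x' ∈ B, transits (H i) x a x' : ℕ) : ℝ) - visits (H i) x a * ∑ x' ∈ B, P x a x')
        - visits (H i) x a * (s ^ 2 / 8) := by
      intro i hi
      rw [transitionIncrement, sum_visits_prefixOf]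
      split_ifs with hlt
      · rfl
      · -- the pair is not visited again between the `n`-th visit and the episode `t`
        have h1 := totalVisits_mono H x a (Finset.mem_range.1 hi)
        rw [Nat.succ_eq_add_one, totalVisits_succ] at h1
        have h2 : visits (H i) x a = 0 := by omega
        have h3 : ∑ x' ∈ B, transits (H i) x a x' = 0 := by
          have h4 : ∑ x' ∈ B, transits (H i) x a x' ≤ ∑ x', transits (H i) x a x' :=
            Finset.sum_le_sum_of_subset (Finset.subset_univ B)
          rw [sum_univ_transits] at h4
          omega
        rw [h2, h3]
        simp
    rw [ht, Finset.sum_congr rfl hstep, Finset.sum_sub_distrib, ← Finset.mul_sum,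
      Finset.sum_sub_distrib, ← Finset.sum_mul, ← Finset.sum_mul]
    have h1 : ∑ i ∈ Finset.range t, (visits (H i) x a : ℝ) = n := by
      rw [← ht, totalVisits]
      push_cast
      rfl
    have h2 : ∑ i ∈ Finset.range t, ((∑ x' ∈ B, transits (H i) x a x' : ℕ) : ℝ) =
        ((∑ x' ∈ B, totalTransits H t x a x' : ℕ) : ℝ) := by
      simp only [totalTransits]
      push_cast
      exact Finset.sum_comm
    rw [h1, h2]
  | succ T hT ih =>
    rw [Finset.sum_range_succ, ih, transitionIncrement, sum_visits_prefixOf, if_neg, add_zero]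
    have := totalVisits_mono H x a hT
    omega

/-- The distance of two functions of equal sum is twice the largest excess over a subset. -/
lemma sum_abs_sub_eq {ι : Type*} (s : Finset ι) (u v : ι → ℝ) (h : ∑ i ∈ s, u i = ∑ i ∈ s, v i) :
    ∑ i ∈ s, |u i - v i| = 2 * ∑ i ∈ s with u i < v i, (v i - u i) := by
  have h1 : ∀ i, |u i - v i| = 2 * (if u i < v i then v i - u i else 0) + (u i - v i) := by
    intro i
    split_ifs with hi
    · rw [abs_of_neg (by linarith)]; ring
    · rw [abs_of_nonneg (by linarith)]; ring
  simp_rw [h1]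
  rw [Finset.sum_add_distrib, Finset.sum_sub_distrib, h, sub_self, add_zero, ← Finset.mul_sum,
    Finset.sum_filter]

/-- The nonempty proper subsets of the layer that follows `x`. -/
def properSubsets (S : Layering X L) (x : X) : Finset (Finset X) :=
  (S.next x).powerset.filter fun B => B ≠ ∅ ∧ B ≠ S.next x

lemma start_ne_final (hL : 0 < L) (S : Layering X L) : S.start ≠ S.final := by
  intro h
  have h1 := S.layer_start
  rw [h, S.layer_final, Fin.ext_iff, Fin.val_last, Fin.val_zero] at h1
  omega

lemma two_le_card (hL : 0 < L) (S : Layering X L) : 2 ≤ Fintype.card X := by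
  have := Fintype.one_lt_card_iff.2 ⟨_, _, start_ne_final hL S⟩
  omega

lemma four_le_card (hL : 0 < L) {x : X} (hx : 2 ≤ (S.next x).card) : 4 ≤ Fintype.card X := by
  have hs : S.start ∉ S.next x := by
    rw [Layering.mem_next, S.layer_start]
    simp
  have hf : S.final ∉ S.next x := by
    intro hf
    have h1 : S.next x ⊆ {S.final} := by
      intro y hy
      rw [Finset.mem_singleton, ← S.layer_eq_last_iff, ← S.layer_final]
      rw [Layering.mem_next] at hf hy
      exact Fin.ext (hy.trans hf.symm)
    have := Finset.card_le_card h1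
    rw [Finset.card_singleton] at this
    omega
  have h2 : (insert S.start (insert S.final (S.next x))).card = (S.next x).card + 1 + 1 := by
    rw [Finset.card_insert_of_notMem, Finset.card_insert_of_notMem hf]
    simp [start_ne_final hL S, hs]
  have h3 := Finset.card_le_univ (insert S.start (insert S.final (S.next x)))
  omega

lemma card_properSubsets_mul_pow_le (hL : 0 < L) (S : Layering X L) (x : X) {y : ℝ} (hy : 0 ≤ y)
    (hyX : y * Fintype.card X ≤ 1) :
    (properSubsets S x).card * y ^ (S.next x).card ≤ y := by
  rcases lt_or_ge (S.next x).card 2 with h | h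
  · have h0 : properSubsets S x = ∅ := by
      refine Finset.filter_eq_empty_iff.2 fun B hB ⟨h1, h2⟩ => ?_
      rw [Finset.mem_powerset] at hB
      have h3 := Finset.card_lt_card (hB.ssubset_of_ne h2)
      have h4 := Finset.card_pos.2 (Finset.nonempty_iff_ne_empty.2 h1)
      omega
    simpa [h0] using hy
  · have h4 : (4 : ℝ) ≤ Fintype.card X := by exact_mod_cast four_le_card hL h
    have hy4 : y ≤ 1 / 4 := by nlinarith
    have h1 : ((properSubsets S x).card : ℝ) ≤ 2 ^ (S.next x).card := by
      have := Finset.card_filter_le (S.next x).powerset fun B => B ≠ ∅ ∧ B ≠ S.next x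
      rw [Finset.card_powerset] at this
      exact_mod_cast this
    calc (properSubsets S x).card * y ^ (S.next x).card
        ≤ 2 ^ (S.next x).card * y ^ (S.next x).card := by gcongr
      _ = (2 * y) ^ (S.next x).card := (mul_pow _ _ _).symm
      _ ≤ (2 * y) ^ 2 := pow_le_pow_of_le_one (by positivity) (by linarith) h
      _ ≤ y := by nlinarith

/-- The event that, for some `(x,a)` and some number `n` of visits, the empirical frequency of the
transitions into some set of states exceeds its probability by half of the confidence radius.
The slope `2 √(2 c / n)`, `c = |X_{k(x)+1}| ln (T|X||A|/δ)`, optimizes the exponential bound. -/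
def transitionBadEvent (S : Layering X L) (P : X → A → X → ℝ) (T : ℕ) (δ : ℝ) :
    Set (Fin T → Trajectory S A) :=
  {h | ∃ i ∈ (Finset.univ : Finset (X × A)) ×ˢ Finset.Icc 1 T, h ∈
    {h | ∃ B ∈ properSubsets S i.1.1, h ∈ {h |
      (S.next i.1.1).card * Real.log (T * Fintype.card X * Fintype.card A / δ) ≤
        cumul (transitionIncrement P i.1.1 i.1.2 i.2 B (2 * Real.sqrt (2 * (S.next i.1.1).card *
          Real.log (T * Fintype.card X * Fintype.card A / δ) / i.2))) T h}}}

lemma eventProb_transitionBadEvent_le [Nonempty A] (hL : 0 < L) {T : ℕ} (hT : 0 < T)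
    (hP : IsTransition S P) {π : (t : ℕ) → (Fin t → Trajectory S A) → X → A → ℝ}
    (hπ : ∀ t < T, ∀ h, IsPolicy S (π t h)) {δ : ℝ} (hδ : 0 < δ) (hδ1 : δ < 1) :
    eventProb S P π T (transitionBadEvent S P T δ) ≤ δ := by
  have hX : (0 : ℝ) < Fintype.card X := by
    have := two_le_card hL S
    positivity
  have hA : (0 : ℝ) < Fintype.card A := by exact_mod_cast Fintype.card_pos
  have hA1 : (1 : ℝ) ≤ Fintype.card A := by exact_mod_cast Fintype.card_pos
  have hT0 : (0 : ℝ) < T := by exact_mod_cast hT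
  have hT1 : (1 : ℝ) ≤ T := by exact_mod_cast hT
  set y : ℝ := δ / (T * Fintype.card X * Fintype.card A) with hy
  have hy0 : 0 < y := by positivity
  have hyX : y * Fintype.card X ≤ 1 := by
    rw [hy, div_mul_eq_mul_div, div_le_one (by positivity)]
    have h1 : (1 : ℝ) ≤ T * Fintype.card A := by nlinarith
    nlinarith
  have hexp : ∀ m : ℕ, Real.exp (-(m * Real.log (T * Fintype.card X * Fintype.card A / δ))) =
      y ^ m := by
    intro m
    rw [← mul_neg, ← Real.log_inv, inv_div, ← hy, Real.exp_nat_mul, Real.exp_log hy0]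
  have hone : ∀ i ∈ (Finset.univ : Finset (X × A)) ×ˢ Finset.Icc 1 T, eventProb S P π T
      {h | ∃ B ∈ properSubsets S i.1.1, h ∈ {h |
      (S.next i.1.1).card * Real.log (T * Fintype.card X * Fintype.card A / δ) ≤
        cumul (transitionIncrement P i.1.1 i.1.2 i.2 B (2 * Real.sqrt (2 * (S.next i.1.1).card *
          Real.log (T * Fintype.card X * Fintype.card A / δ) / i.2))) T h}} ≤ y := by
    intro i _
    refine (eventProb_iUnion_le hP hπ _ _).trans ?_
    have hsum : ∑ _B ∈ properSubsets S i.1.1, y ^ (S.next i.1.1).card ≤ y := by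
      rw [Finset.sum_const, nsmul_eq_mul]
      exact card_properSubsets_mul_pow_le hL S i.1.1 hy0.le hyX
    refine le_trans (Finset.sum_le_sum fun B hB => ?_) hsum
    rw [← hexp]
    refine eventProb_cumul_ge_le hP hπ _ (fun t ht h => ?_) _
    refine sum_trajProb_exp_transitionIncrement_le hP (hπ t ht h) ?_ _ _ _ _ _ _
    intro hlast
    have h1 := Finset.mem_filter.1 hB
    rw [S.next_eq_empty hlast, Finset.powerset_empty, Finset.mem_singleton] at h1
    exact h1.2.1 h1.1
  refine (eventProb_iUnion_le hP hπ _ _).trans ((Finset.sum_le_sum hone).trans ?_)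
  rw [Finset.sum_const, nsmul_eq_mul, Finset.card_product, Finset.card_univ, Fintype.card_prod,
    Nat.card_Icc, hy]
  push_cast
  apply le_of_eq
  field_simp

lemma log_two_le_log [Nonempty A] (hL : 0 < L) (S : Layering X L) {T : ℕ} (hT : 0 < T) {δ : ℝ}
    (hδ : 0 < δ) (hδ1 : δ < 1) :
    Real.log 2 ≤ Real.log (T * Fintype.card X * Fintype.card A / δ) := by
  refine Real.log_le_log (by norm_num) ?_
  rw [le_div_iff₀ hδ]
  have h1 : (2 : ℝ) ≤ Fintype.card X := by exact_mod_cast two_le_card hL S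
  have h2 : (1 : ℝ) ≤ Fintype.card A := by exact_mod_cast Fintype.card_pos
  have h3 : (1 : ℝ) ≤ T := by exact_mod_cast hT
  have h4 : (2 : ℝ) ≤ T * Fintype.card X := by nlinarith
  nlinarith

lemma half_le_log [Nonempty A] (hL : 0 < L) (S : Layering X L) {T : ℕ} (hT : 0 < T) {δ : ℝ}
    (hδ : 0 < δ) (hδ1 : δ < 1) :
    1 / 2 ≤ Real.log (T * Fintype.card X * Fintype.card A / δ) := by
  have h1 := log_two_le_log (A := A) hL S hT hδ hδ1
  have h2 := Real.log_two_gt_d9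
  linarith

lemma IsTransition.next_nonempty (hP : IsTransition S P) [Nonempty A] {x : X}
    (hx : S.layer x ≠ Fin.last L) : (S.next x).Nonempty := by
  by_contra h
  rw [Finset.not_nonempty_iff_eq_empty] at h
  have h1 := hP.sum_next hx (Classical.arbitrary A)
  rw [h, Finset.sum_empty] at h1
  exact zero_ne_one h1

/-- A pair without visits has a confidence radius of at least one, so that its confidence ball
contains every distribution. -/
lemma one_le_radius [Nonempty A] (hL : 0 < L) (hP : IsTransition S P) {T : ℕ} (hT : 0 < T) {δ : ℝ}
    (hδ : 0 < δ) (hδ1 : δ < 1) {c : Counters X A} {x : X} (hx : S.layer x ≠ Fin.last L) {a : A}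
    (hN : c.N x a = 0) : 1 ≤ c.radius S T δ x a := by
  rw [Counters.radius, Real.one_le_sqrt, hN]
  have h1 : (1 : ℝ) ≤ (S.next x).card := by
    exact_mod_cast Finset.card_pos.2 (hP.next_nonempty hx)
  have h2 := half_le_log (A := A) hL S hT hδ hδ1
  rw [Nat.cast_zero, max_eq_left zero_le_one, div_one]
  nlinarith

/-- Off the bad event the true transition function lies in all confidence balls. -/
lemma sum_abs_sub_estimate_le [Nonempty A] (hL : 0 < L) (hP : IsTransition S P) {T : ℕ} (hT : 0 < T)
    {δ : ℝ} (hδ : 0 < δ) (hδ1 : δ < 1) {r : ℕ} (hr : r ≤ 1) {H : ℕ → Trajectory S A}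
    (hH : prefixOf H T ∉ transitionBadEvent S P T δ) {t : ℕ} (ht : t ≤ T) {x : X}
    (hx : S.layer x ≠ Fin.last L) (a : A) :
    ∑ x', |P x a x' - (countersAt S r t (prefixOf H t)).estimate x a x'| ≤
      (countersAt S r t (prefixOf H t)).radius S T δ x a := by
  obtain ⟨e, he, hN, hM, -⟩ := countersAt_prefixOf hr H t
  set c := countersAt S r t (prefixOf H t) with hc
  set Λ := Real.log (T * Fintype.card X * Fintype.card A / δ) with hΛ
  have hΛ2 := half_le_log (A := A) hL S hT hδ hδ1
  have hsum : ∑ x', |P x a x' - c.estimate x a x'| =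
      ∑ x' ∈ S.next x, |P x a x' - c.estimate x a x'| := by
    refine (Finset.sum_subset (Finset.subset_univ _) fun x' _ h => ?_).symm
    rw [hP.loop_free x a x' h, Counters.estimate, hM, totalTransits_of_notMem H e h]
    simp
  rw [hsum]
  rcases Nat.eq_zero_or_pos (c.N x a) with h0 | hpos
  · refine le_trans (le_of_eq ?_) (one_le_radius hL hP hT hδ hδ1 hx h0)
    rw [← hP.sum_next hx a]
    refine Finset.sum_congr rfl fun x' hx' => ?_
    have h1 := sum_totalTransits H e x a
    rw [← hN, h0, Finset.sum_eq_zero_iff] at h1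
    rw [Counters.estimate, hM, h1 x' hx', Nat.cast_zero, zero_div, sub_zero,
      abs_of_nonneg (hP.nonneg _ _ _)]
  · set n := c.N x a with hn
    have hn0 : (0 : ℝ) < n := by exact_mod_cast hpos
    have hmax : max 1 (n : ℝ) = n := max_eq_right (by exact_mod_cast hpos)
    have hest : ∀ x', c.estimate x a x' = (totalTransits H e x a x' : ℝ) / n := by
      intro x'
      rw [Counters.estimate, hM, ← hn, hmax]
    have hest1 : ∑ x' ∈ S.next x, c.estimate x a x' = 1 := by
      simp_rw [hest]
      rw [← Finset.sum_div, ← Nat.cast_sum, sum_totalTransits, ← hN, div_self hn0.ne']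
    have hrad : c.radius S T δ x a = Real.sqrt (2 * (S.next x).card * Λ / n) := by
      rw [Counters.radius, ← hn, hmax]
    set ε := c.radius S T δ x a with hε
    have hε0 : 0 ≤ ε := Real.sqrt_nonneg _
    have hεsq : n * ε ^ 2 = 2 * (S.next x).card * Λ := by
      rw [hrad, Real.sq_sqrt (by positivity)]
      field_simp
    rw [sum_abs_sub_eq _ _ _ ((hP.sum_next hx a).trans hest1.symm)]
    set B := {x' ∈ S.next x | P x a x' < c.estimate x a x'} with hB
    by_contra! hlt
    have hBp : B ∈ properSubsets S x := by
      rw [properSubsets, Finset.mem_filter, Finset.mem_powerset]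
      refine ⟨Finset.filter_subset _ _, fun h => ?_, fun h => ?_⟩
      · rw [h, Finset.sum_empty, mul_zero] at hlt
        linarith
      · rw [h, Finset.sum_sub_distrib, hest1, hP.sum_next hx a, sub_self, mul_zero] at hlt
        linarith
    apply hH
    have hnT : n ≤ T := (hN x a).le.trans ((totalVisits_le H x a e).trans (he.trans ht))
    refine ⟨((x, a), n), ?_, B, hBp, ?_⟩
    · simp only [Finset.mem_product, Finset.mem_univ, true_and, Finset.mem_Icc]
      exact ⟨hpos, hnT⟩
    · change (S.next x).card * Λ ≤ cumul (transitionIncrement P x a n B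
        (2 * Real.sqrt (2 * (S.next x).card * Λ / n))) T (prefixOf H T)
      rw [cumul_transitionIncrement H (he.trans ht) (hN x a).symm, ← hrad]
      have h2 : ((∑ x' ∈ B, totalTransits H e x a x' : ℕ) : ℝ) =
          n * ∑ x' ∈ B, c.estimate x a x' := by
        simp_rw [hest]
        rw [← Finset.sum_div, mul_div_cancel₀ _ hn0.ne']
        push_cast
        rfl
      rw [h2, ← mul_sub, ← Finset.sum_sub_distrib]
      have h3 : n * ε * ε ≤ n * ε * (2 * ∑ x' ∈ B, (c.estimate x a x' - P x a x')) :=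
        mul_le_mul_of_nonneg_left hlt.le (by positivity)
      nlinarith

end

/-! ### Occupancy measures -/

section

variable {X A : Type*} [Fintype X] [Fintype A] [DecidableEq X] [DecidableEq A] {L : ℕ}
variable {S : Layering X L} {P : X → A → X → ℝ}

/-- Occupancy measures of the layered state space: the members of a confidence set without the
condition on the induced transition function. -/
structure IsOccupancyMeasure (S : Layering X L) (q : X → A → X → ℝ) : Prop where
  mem_cube : q ∈ cube X A
  loop_free : ∀ x a x', x' ∉ S.next x → q x a x' = 0
  sum_one : ∀ k < L, ∑ x ∈ S.states k, ∑ a, ∑ x' ∈ S.states (k + 1), q x a x' = 1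
  flow : ∀ k, k + 1 < L → ∀ x ∈ S.states (k + 1),
    ∑ x' ∈ S.states (k + 2), ∑ a, q x a x' = ∑ x' ∈ S.states k, ∑ a, q x' a x

lemma InConfidenceSet.isOccupancyMeasure {T : ℕ} {δ : ℝ} {c : Counters X A} {q : X → A → X → ℝ}
    (h : InConfidenceSet S T δ c q) : IsOccupancyMeasure S q :=
  ⟨h.mem_cube, h.loop_free, h.sum_one, h.flow⟩

lemma Layering.ne_last_of_mem {x : X} {k : ℕ} (hk : k < L) (hx : x ∈ S.states k) :
    S.layer x ≠ Fin.last L :=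
  S.ne_last_of_lt (by rwa [Layering.mem_states.1 hx])

lemma stateProb_le_one (hP : IsTransition S P) {π : X → A → ℝ} (hπ : IsPolicy S π) (x : X) :
    stateProb S P π x ≤ 1 := by
  rw [← sum_stateProb hP hπ (Nat.lt_succ_iff.1 (S.layer x).2)]
  exact Finset.single_le_sum (fun y _ => stateProb_nonneg hP hπ y) (Layering.mem_states.2 rfl)

lemma IsTransition.sum_states (hP : IsTransition S P) {x : X} {k : ℕ} (hk : k < L)
    (hx : x ∈ S.states k) (a : A) : ∑ x' ∈ S.states (k + 1), P x a x' = 1 := by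
  rw [← S.next_eq hx]
  exact hP.sum_next (S.ne_last_of_mem hk hx) a

lemma isOccupancyMeasure_occupancy (hP : IsTransition S P) {π : X → A → ℝ} (hπ : IsPolicy S π) :
    IsOccupancyMeasure S (occupancy S P π) := by
  have heq : occupancy S P π = fun x a x' => stateProb S P π x * (π x a * P x a x') := by
    funext x a x'
    exact occupancy_eq hP hπ x a x'
  rw [heq]
  refine ⟨fun x a x' => ⟨?_, ?_⟩, fun x a x' h => ?_, fun k hk => ?_, fun k hk x hx => ?_⟩
  · exact mul_nonneg (stateProb_nonneg hP hπ x) (mul_nonneg (hπ.nonneg _ _) (hP.nonneg _ _ _))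
  · by_cases hx : S.layer x = Fin.last L
    · rw [hP.loop_free x a x' (by simp [S.next_eq_empty hx])]
      simp
    · refine mul_le_one₀ (stateProb_le_one hP hπ x)
        (mul_nonneg (hπ.nonneg _ _) (hP.nonneg _ _ _)) (mul_le_one₀ ?_ (hP.nonneg _ _ _) ?_)
      · rw [← hπ.sum_eq_one x hx]
        exact Finset.single_le_sum (fun b _ => hπ.nonneg x b) (Finset.mem_univ a)
      · rw [← hP.sum_eq_one x a hx]
        exact Finset.single_le_sum (fun y _ => hP.nonneg x a y) (Finset.mem_univ x')
  · rw [hP.loop_free x a x' h, mul_zero, mul_zero]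
  · rw [← sum_stateProb hP hπ hk.le]
    refine Finset.sum_congr rfl fun x hx => ?_
    simp_rw [← Finset.mul_sum, hP.sum_states hk hx, mul_one]
    rw [hπ.sum_eq_one x (S.ne_last_of_mem hk hx), mul_one]
  · rw [← stateProb_succ hP hx, Finset.sum_comm]
    simp_rw [← Finset.mul_sum, hP.sum_states hk hx, mul_one]
    rw [hπ.sum_eq_one x (S.ne_last_of_mem hk hx), mul_one]

lemma pairMass_occupancy (hP : IsTransition S P) {π : X → A → ℝ} (hπ : IsPolicy S π) {x : X}
    (hx : S.layer x ≠ Fin.last L) (a : A) :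
    pairMass S (occupancy S P π) x a = stateProb S P π x * π x a := by
  rw [pairMass]
  simp_rw [occupancy_eq hP hπ, ← Finset.mul_sum]
  rw [hP.sum_next hx, mul_one]

lemma inConfidenceSet_occupancy (hP : IsTransition S P) {π : X → A → ℝ} (hπ : IsPolicy S π)
    {T : ℕ} {δ : ℝ} {c : Counters X A}
    (hc : ∀ x a, S.layer x ≠ Fin.last L → ∑ x', |P x a x' - c.estimate x a x'| ≤
      c.radius S T δ x a) :
    InConfidenceSet S T δ c (occupancy S P π) := by
  have h := isOccupancyMeasure_occupancy hP hπ
  refine ⟨h.mem_cube, h.loop_free, h.sum_one, h.flow, fun x a hm => ?_⟩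
  have hx : S.layer x ≠ Fin.last L := by
    intro hx
    rw [pairMass, S.next_eq_empty hx, Finset.sum_empty] at hm
    exact hm rfl
  refine le_trans (le_of_eq (Finset.sum_congr rfl fun x' _ => ?_)) (hc x a hx)
  rw [inducedTransition, occupancy_eq hP hπ, ← mul_assoc]
  rw [pairMass_occupancy hP hπ hx] at hm ⊢
  rw [mul_div_cancel_left₀ _ hm]

lemma stateProb_pos (hP : IsTransition S P) (hpos : ∀ x a x', x' ∈ S.next x → 0 < P x a x')
    {π : X → A → ℝ} [Nonempty A] (hπ : ∀ x a, 0 < π x a) (hne : ∀ k ≤ L, (S.states k).Nonempty)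
    (x : X) : 0 < stateProb S P π x := by
  obtain ⟨k, hk⟩ : ∃ k, x ∈ S.states k := ⟨_, Layering.mem_states.2 rfl⟩
  induction k generalizing x with
  | zero =>
    rw [S.states_zero, Finset.mem_singleton] at hk
    rw [hk, stateProb_start]
    exact zero_lt_one
  | succ k ih =>
    rw [stateProb_succ hP hk]
    have hkL : k + 1 ≤ L := by
      have := (S.layer x).2
      rw [Layering.mem_states] at hk
      omega
    refine Finset.sum_pos (fun y hy => Finset.sum_pos (fun a _ => ?_) Finset.univ_nonempty)
      (hne k (by omega))
    exact mul_pos (ih y hy) (mul_pos (hπ _ _) (hpos _ _ _ (by rwa [S.next_eq hy])))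

lemma IsTransition.states_nonempty [Nonempty A] (hP : IsTransition S P) {k : ℕ} (hk : k ≤ L) :
    (S.states k).Nonempty := by
  induction k with
  | zero => simp [S.states_zero]
  | succ k ih =>
    obtain ⟨x, hx⟩ := ih (by omega)
    rw [← S.next_eq hx]
    exact hP.next_nonempty (S.ne_last_of_mem (by omega) hx)

lemma isPolicy_uniform [Nonempty A] (S : Layering X L) :
    IsPolicy S fun (_ : X) (_ : A) => 1 / (Fintype.card A : ℝ) :=
  ⟨fun _ _ => by positivity, fun x _ => by simp⟩

/-- Every confidence set contains an occupancy measure that is positive on all admissible triples: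
mix a little of the uniform transition function into the empirical one. -/
lemma exists_pos_mem_confidenceSet [Nonempty A] (hL : 0 < L) (hP : IsTransition S P) {T : ℕ}
    (hT : 0 < T) {δ : ℝ} (hδ : 0 < δ) (hδ1 : δ < 1) {r : ℕ} (hr : r ≤ 1) (H : ℕ → Trajectory S A)
    (t : ℕ) : ∃ q, InConfidenceSet S T δ (countersAt S r t (prefixOf H t)) q ∧
      ∀ x a x', x' ∈ S.next x → 0 < q x a x' := by
  obtain ⟨e, he, hN, hM, -⟩ := countersAt_prefixOf hr H t
  set c := countersAt S r t (prefixOf H t) with hc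
  let u : X → X → ℝ := fun x x' => if x' ∈ S.next x then 1 / ((S.next x).card : ℝ) else 0
  have hu0 : ∀ x x', 0 ≤ u x x' := fun x x' => by
    simp only [u]
    split_ifs <;> positivity
  have hupos : ∀ x x', x' ∈ S.next x → 0 < u x x' := fun x x' h => by
    have := Finset.card_pos.2 ⟨x', h⟩
    simp only [u, if_pos h]
    positivity
  have husum : ∀ x, S.layer x ≠ Fin.last L → ∑ x', u x x' = 1 := fun x hx => by
    have : (0 : ℝ) < (S.next x).card := by
      exact_mod_cast Finset.card_pos.2 (hP.next_nonempty hx)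
    simp only [u]
    rw [Finset.sum_ite_mem, Finset.univ_inter, Finset.sum_const, nsmul_eq_mul, mul_one_div,
      div_self this.ne']
  have hest0 : ∀ x a x', 0 ≤ c.estimate x a x' := fun x a x' => by
    rw [Counters.estimate]
    positivity
  have hestnext : ∀ x a x', x' ∉ S.next x → c.estimate x a x' = 0 := fun x a x' h => by
    rw [Counters.estimate, hM, totalTransits_of_notMem H e h]
    simp
  have hestsum : ∀ x a, 0 < c.N x a → ∑ x', c.estimate x a x' = 1 := fun x a h => by
    have h1 : (0 : ℝ) < c.N x a := by exact_mod_cast h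
    have h2 : max 1 (c.N x a : ℝ) = c.N x a := max_eq_right (by exact_mod_cast h)
    rw [← Finset.sum_subset (Finset.subset_univ (S.next x)) fun x' _ h => hestnext x a x' h]
    simp only [Counters.estimate, h2, hM]
    rw [← Finset.sum_div, ← Nat.cast_sum, sum_totalTransits, ← hN, div_self h1.ne']
  let w : X → A → ℝ := fun x a => if c.N x a = 0 then 1 else min 1 (c.radius S T δ x a / 2)
  have hradpos : ∀ x a, S.layer x ≠ Fin.last L → 0 < c.radius S T δ x a := fun x a hx => by
    have h1 : (0 : ℝ) < (S.next x).card := by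
      exact_mod_cast Finset.card_pos.2 (hP.next_nonempty hx)
    have h2 := half_le_log (A := A) hL S hT hδ hδ1
    rw [Counters.radius]
    have h3 : 0 < Real.log (T * Fintype.card X * Fintype.card A / δ) := by linarith
    refine Real.sqrt_pos.2 (div_pos (by positivity) (by positivity))
  have hw0 : ∀ x a, 0 ≤ w x a := fun x a => by
    have : 0 ≤ c.radius S T δ x a := Real.sqrt_nonneg _
    simp only [w]
    split_ifs
    · exact zero_le_one
    · positivity
  have hw1 : ∀ x a, w x a ≤ 1 := fun x a => by
    simp only [w]
    split_ifs
    · exact le_rfl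
    · exact min_le_left _ _
  have hwpos : ∀ x a, S.layer x ≠ Fin.last L → 0 < w x a := fun x a hx => by
    have := hradpos x a hx
    simp only [w]
    split_ifs
    · exact zero_lt_one
    · positivity
  have hQ : IsTransition S fun x a x' => (1 - w x a) * c.estimate x a x' + w x a * u x x' := by
    refine ⟨fun x a x' => ?_, fun x a x' h => ?_, fun x a hx => ?_⟩
    · have := hw1 x a
      exact add_nonneg (mul_nonneg (by linarith) (hest0 x a x')) (mul_nonneg (hw0 x a) (hu0 x x'))
    · simp [hestnext x a x' h, u, h]
    · rw [Finset.sum_add_distrib, ← Finset.mul_sum, ← Finset.mul_sum, husum x hx]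
      rcases Nat.eq_zero_or_pos (c.N x a) with h0 | hpos
      · simp [w, h0]
      · rw [hestsum x a hpos]
        ring
  have hQpos : ∀ x a x', x' ∈ S.next x →
      0 < (1 - w x a) * c.estimate x a x' + w x a * u x x' := fun x a x' h => by
    have hx : S.layer x ≠ Fin.last L := by
      intro hx
      simp [S.next_eq_empty hx] at h
    have h1 := hw1 x a
    exact add_pos_of_nonneg_of_pos (mul_nonneg (by linarith) (hest0 x a x'))
      (mul_pos (hwpos x a hx) (hupos x x' h))
  have hπ := isPolicy_uniform (A := A) S
  refine ⟨occupancy S _ _, inConfidenceSet_occupancy hQ hπ fun x a hx => ?_, fun x a x' h => ?_⟩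
  · rcases Nat.eq_zero_or_pos (c.N x a) with h0 | hpos
    · refine le_trans (le_of_eq ?_) (one_le_radius hL hP hT hδ hδ1 hx h0)
      have hz : ∀ x' ∈ S.next x, c.estimate x a x' = 0 := fun x' hx' => by
        have h1 := sum_totalTransits H e x a
        rw [← hN, h0, Finset.sum_eq_zero_iff] at h1
        rw [Counters.estimate, hM, h1 x' hx']
        simp
      rw [← husum x hx]
      refine Finset.sum_congr rfl fun x' _ => ?_
      have hz' : c.estimate x a x' = 0 := by
        by_cases h : x' ∈ S.next x
        · exact hz x' h
        · exact hestnext x a x' h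
      simp [hz', w, h0, abs_of_nonneg (hu0 x x')]
    · have h1 : ∀ x', |(1 - w x a) * c.estimate x a x' + w x a * u x x' - c.estimate x a x'| ≤
          w x a * (u x x' + c.estimate x a x') := by
        intro x'
        have h2 : (1 - w x a) * c.estimate x a x' + w x a * u x x' - c.estimate x a x' =
            w x a * (u x x' - c.estimate x a x') := by ring
        rw [h2, abs_mul, abs_of_nonneg (hw0 x a)]
        refine mul_le_mul_of_nonneg_left ?_ (hw0 x a)
        rw [abs_le]
        have := hu0 x x'
        have := hest0 x a x'
        constructor <;> linarith
      refine (Finset.sum_le_sum fun x' _ => h1 x').trans ?_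
      rw [← Finset.mul_sum, Finset.sum_add_distrib, husum x hx, hestsum x a hpos]
      have : w x a ≤ c.radius S T δ x a / 2 := by
        simp only [w, if_neg hpos.ne']
        exact min_le_right _ _
      linarith
  · rw [occupancy_eq hQ hπ]
    have := stateProb_pos hQ hQpos (π := fun _ (_ : A) => 1 / (Fintype.card A : ℝ))
      (fun _ _ => by positivity) (fun k hk => hP.states_nonempty hk) x
    exact mul_pos this (mul_pos (by positivity) (hQpos x a x' h))

/-! ### Distance of occupancy measures with the same policy -/

/-- The distance of the transition probabilities induced by `q` from the true ones. -/
def transitionDist (S : Layering X L) (P q : X → A → X → ℝ) (x : X) (a : A) : ℝ :=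
  ∑ x', |inducedTransition S q x a x' - P x a x'|

/-- The expected sum of `g` along a trajectory. -/
def expectedSum (S : Layering X L) (P : X → A → X → ℝ) (π g : X → A → ℝ) : ℝ :=
  ∑ k ∈ Finset.range L, ∑ x ∈ S.states k, ∑ a, stateProb S P π x * π x a * g x a

section
variable {q : X → A → X → ℝ}

lemma IsOccupancyMeasure.nonneg (hq : IsOccupancyMeasure S q) (x : X) (a : A) (x' : X) :
    0 ≤ q x a x' := (hq.mem_cube x a x').1

lemma pairMass_pos (hpos : ∀ x a x', x' ∈ S.next x → 0 < q x a x') {x : X}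
    (hx : (S.next x).Nonempty) (a : A) : 0 < pairMass S q x a :=
  Finset.sum_pos (fun x' h => hpos x a x' h) hx

lemma sum_inducedTransition (hq : IsOccupancyMeasure S q) {x : X} {a : A}
    (h : pairMass S q x a ≠ 0) : ∑ x', inducedTransition S q x a x' = 1 := by
  simp only [inducedTransition]
  rw [← Finset.sum_div, ← Finset.sum_subset (Finset.subset_univ (S.next x))
    fun x' _ h => hq.loop_free x a x' h]
  exact div_self h

lemma inducedTransition_nonneg (hq : IsOccupancyMeasure S q) (x : X) (a : A) (x' : X) :
    0 ≤ inducedTransition S q x a x' :=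
  div_nonneg (hq.nonneg x a x') (Finset.sum_nonneg fun y _ => hq.nonneg x a y)

lemma transitionDist_nonneg (S : Layering X L) (P q : X → A → X → ℝ) (x : X) (a : A) :
    0 ≤ transitionDist S P q x a :=
  Finset.sum_nonneg fun _ _ => abs_nonneg _

lemma transitionDist_le_two (hP : IsTransition S P) (hq : IsOccupancyMeasure S q) {x : X} {a : A}
    (hx : S.layer x ≠ Fin.last L) (h : pairMass S q x a ≠ 0) : transitionDist S P q x a ≤ 2 := by
  have h1 : ∀ x', |inducedTransition S q x a x' - P x a x'| ≤
      inducedTransition S q x a x' + P x a x' := fun x' => by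
    have h1 := inducedTransition_nonneg hq x a x'
    have h2 := hP.nonneg x a x'
    rw [abs_le]
    constructor <;> linarith
  refine (Finset.sum_le_sum fun x' _ => h1 x').trans ?_
  rw [Finset.sum_add_distrib, sum_inducedTransition hq h, hP.sum_eq_one x a hx]
  norm_num

lemma isPolicy_inducedPolicy [Nonempty A] (hP : IsTransition S P) (hq : IsOccupancyMeasure S q)
    (hpos : ∀ x a x', x' ∈ S.next x → 0 < q x a x') : IsPolicy S (inducedPolicy S q) := by
  have h0 : ∀ x a, 0 ≤ pairMass S q x a := fun x a => Finset.sum_nonneg fun y _ => hq.nonneg x a y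
  refine ⟨fun x a => div_nonneg (h0 x a) (Finset.sum_nonneg fun b _ => h0 x b), fun x hx => ?_⟩
  have h1 : 0 < ∑ b, pairMass S q x b :=
    Finset.sum_pos (fun b _ => pairMass_pos hpos (hP.next_nonempty hx) b) Finset.univ_nonempty
  simp only [inducedPolicy]
  rw [← Finset.sum_div, div_self h1.ne']

/-- The distance of an occupancy measure from the one that its policy has under the true
transition function: an error made in one layer persists in the later ones. -/
lemma sum_abs_sub_occupancy_le [Nonempty A] (hP : IsTransition S P) (hq : IsOccupancyMeasure S q)
    (hpos : ∀ x a x', x' ∈ S.next x → 0 < q x a x') {π : X → A → ℝ} (hπ : IsPolicy S π)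
    (hπq : ∀ x a, S.layer x ≠ Fin.last L → π x a = inducedPolicy S q x a) :
    ∑ x, ∑ a, ∑ x', |q x a x' - occupancy S P π x a x'| ≤
      L * expectedSum S P π (transitionDist S P q) := by
  have hocc := isOccupancyMeasure_occupancy hP hπ
  rw [S.sum_eq_sum_layers _ fun x a x' h => by rw [hq.loop_free x a x' h, hocc.loop_free x a x' h,
    sub_zero, abs_zero]]
  set m : X → ℝ := fun x => ∑ a, pairMass S q x a with hm
  set e : ℕ → ℝ := fun k => ∑ x ∈ S.states k, ∑ a, ∑ x' ∈ S.states (k + 1),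
    |q x a x' - occupancy S P π x a x'| with he
  set b : ℕ → ℝ := fun k => ∑ x ∈ S.states k, ∑ a,
    stateProb S P π x * π x a * transitionDist S P q x a with hb
  set D : ℕ → ℝ := fun k => ∑ x ∈ S.states k, |m x - stateProb S P π x| with hD
  have hb0 : ∀ k, 0 ≤ b k := fun k => Finset.sum_nonneg fun x _ => Finset.sum_nonneg fun a _ =>
    mul_nonneg (mul_nonneg (stateProb_nonneg hP hπ x) (hπ.nonneg x a))
      (transitionDist_nonneg S P q x a)
  have heD : ∀ k < L, e k ≤ D k + b k := by
    intro k hk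
    simp only [he, hD, hb]
    rw [← Finset.sum_add_distrib]
    refine Finset.sum_le_sum fun x hx => ?_
    have hxl := S.ne_last_of_mem hk hx
    have hne := hP.next_nonempty hxl
    have hpm : ∀ a, 0 < pairMass S q x a := fun a => pairMass_pos hpos hne a
    have hmx : 0 < m x := Finset.sum_pos (fun a _ => hpm a) Finset.univ_nonempty
    have hdec : ∀ a x', q x a x' = m x * π x a * inducedTransition S q x a x' := by
      intro a x'
      rw [hπq x a hxl, inducedPolicy, inducedTransition, mul_div_cancel₀ _ hmx.ne',
        mul_div_cancel₀ _ (hpm a).ne']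
    have hμ := stateProb_nonneg hP hπ x
    have h1 : ∀ a x', |q x a x' - occupancy S P π x a x'| ≤
        |m x - stateProb S P π x| * (π x a * inducedTransition S q x a x') +
          stateProb S P π x * π x a * |inducedTransition S q x a x' - P x a x'| := by
      intro a x'
      rw [hdec, occupancy_eq hP hπ]
      have h2 : m x * π x a * inducedTransition S q x a x' -
          stateProb S P π x * (π x a * P x a x') =
          (m x - stateProb S P π x) * (π x a * inducedTransition S q x a x') +
          stateProb S P π x * π x a * (inducedTransition S q x a x' - P x a x') := by ring
      rw [h2]
      refine (abs_add_le _ _).trans (le_of_eq ?_)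
      rw [abs_mul, abs_mul (stateProb S P π x * π x a), abs_of_nonneg (mul_nonneg (hπ.nonneg x a)
        (inducedTransition_nonneg hq x a x')), abs_of_nonneg (mul_nonneg hμ (hπ.nonneg x a))]
    have h3 : ∀ a, ∑ x' ∈ S.states (k + 1), |q x a x' - occupancy S P π x a x'| ≤
        |m x - stateProb S P π x| * π x a +
          stateProb S P π x * π x a * transitionDist S P q x a := by
      intro a
      refine (Finset.sum_le_sum_of_subset_of_nonneg (Finset.subset_univ _)
        fun _ _ _ => abs_nonneg _).trans ((Finset.sum_le_sum fun x' _ => h1 a x').trans ?_)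
      rw [Finset.sum_add_distrib, ← Finset.mul_sum, ← Finset.mul_sum, ← Finset.mul_sum,
        sum_inducedTransition hq (hpm a).ne', mul_one, transitionDist]
    refine (Finset.sum_le_sum fun a _ => h3 a).trans ?_
    rw [Finset.sum_add_distrib, ← Finset.mul_sum, hπ.sum_eq_one x hxl, mul_one]
  have hD0 : 0 < L → D 0 = 0 := by
    intro hL
    have h1 := hq.sum_one 0 hL
    simp only [hD]
    rw [S.states_zero, Finset.sum_singleton] at h1 ⊢
    have h2 : m S.start = 1 := by
      rw [← h1]
      simp only [hm, pairMass]
      rw [S.next_eq (k := 0) (by simp [S.states_zero])]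
    rw [h2, stateProb_start]
    simp
  have hDe : ∀ k, k + 1 < L → D (k + 1) ≤ e k := by
    intro k hk
    have h1 : ∀ y ∈ S.states (k + 1), |m y - stateProb S P π y| ≤
        ∑ x ∈ S.states k, ∑ a, |q x a y - occupancy S P π x a y| := by
      intro y hy
      have h2 : m y = ∑ x ∈ S.states k, ∑ a, q x a y := by
        rw [← hq.flow k hk y hy, Finset.sum_comm]
        simp only [hm, pairMass]
        rw [S.next_eq hy]
      rw [h2, stateProb_succ hP hy, ← Finset.sum_sub_distrib]
      refine (Finset.abs_sum_le_sum_abs _ _).trans (Finset.sum_le_sum fun x _ => ?_)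
      rw [← Finset.sum_sub_distrib]
      refine (Finset.abs_sum_le_sum_abs _ _).trans (Finset.sum_le_sum fun a _ => ?_)
      rw [occupancy_eq hP hπ]
    refine (Finset.sum_le_sum h1).trans (le_of_eq ?_)
    simp only [he]
    rw [Finset.sum_comm]
    exact Finset.sum_congr rfl fun x _ => Finset.sum_comm
  have hek : ∀ k, k < L → e k ≤ ∑ j ∈ Finset.range (k + 1), b j := by
    intro k
    induction k with
    | zero =>
      intro hk
      have := heD 0 hk
      rw [hD0 hk] at this
      simpa using this
    | succ k ih =>
      intro hk
      rw [Finset.sum_range_succ]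
      have h1 := heD (k + 1) hk
      have h2 := hDe k hk
      have h3 := ih (by omega)
      linarith
  have hfin : ∀ k ∈ Finset.range L, e k ≤ ∑ j ∈ Finset.range L, b j := by
    intro k hk
    rw [Finset.mem_range] at hk
    exact (hek k hk).trans (Finset.sum_le_sum_of_subset_of_nonneg
      (Finset.range_subset_range.2 hk) fun j _ _ => hb0 j)
  refine (Finset.sum_le_sum hfin).trans (le_of_eq ?_)
  rw [Finset.sum_const, nsmul_eq_mul, Finset.card_range]
  rfl

end

/-! ### Concentration of the transition errors along the trajectories -/

/-- One step of the exponential supermartingale that compares a sum along the trajectory with its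
expectation. -/
def sumIncrement (S : Layering X L) (P : X → A → X → ℝ)
    (π g : (t : ℕ) → (Fin t → Trajectory S A) → X → A → ℝ) (s : ℝ) (t : ℕ)
    (h : Fin t → Trajectory S A) (U : Trajectory S A) : ℝ :=
  s * (expectedSum S P (π t h) (g t h) - ∑ k, g t h (U.state k) (U.action k)) -
    s ^ 2 * (L : ℝ) ^ 2 / 2

lemma sum_trajProb_mul_sum (hP : IsTransition S P) {ρ : X → A → ℝ} (hρ : IsPolicy S ρ)
    (g : X → A → ℝ) :
    ∑ U : Trajectory S A, trajProb S P ρ U * ∑ k, g (U.state k) (U.action k) =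
      expectedSum S P ρ g := by
  simp_rw [Finset.mul_sum]
  rw [Finset.sum_comm, expectedSum, ← Fin.sum_univ_eq_sum_range
    fun k => ∑ x ∈ S.states k, ∑ a, stateProb S P ρ x * ρ x a * g x a]
  refine Finset.sum_congr rfl fun k _ => ?_
  rw [sum_trajProb_mul hP hρ k fun x a _ => g x a]
  refine Finset.sum_congr rfl fun x hx => Finset.sum_congr rfl fun a _ => ?_
  rw [← Finset.sum_mul, ← Finset.mul_sum, ← Finset.mul_sum,
    hP.sum_eq_one x a (S.ne_last_of_mem k.2 hx), mul_one]

lemma sum_trajProb_exp_sumIncrement_le (hL : 0 < L) (hP : IsTransition S P)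
    {π g : (t : ℕ) → (Fin t → Trajectory S A) → X → A → ℝ} {t : ℕ} {h : Fin t → Trajectory S A}
    (hπ : IsPolicy S (π t h))
    (hg : ∀ x a, S.layer x ≠ Fin.last L → g t h x a ∈ Set.Icc (0 : ℝ) 2) (s : ℝ) :
    ∑ U, trajProb S P (π t h) U * Real.exp (sumIncrement S P π g s t h U) ≤ 1 := by
  have hW : ∀ U : Trajectory S A,
      ∑ k, g t h (U.state k) (U.action k) ∈ Set.Icc (0 : ℝ) (2 * L) := by
    intro U
    have hk : ∀ k : Fin L, g t h (U.state k) (U.action k) ∈ Set.Icc (0 : ℝ) 2 := fun k =>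
      hg _ _ (S.ne_last_of_mem k.2 (Layering.mem_states.2 (U.layer_state k)))
    refine ⟨Finset.sum_nonneg fun k _ => (hk k).1, ?_⟩
    refine (Finset.sum_le_sum fun k _ => (hk k).2).trans (le_of_eq ?_)
    simp [mul_comm]
  have hH := sum_mul_exp_le (fun U => trajProb_nonneg hP hπ U) (sum_trajProb hL hP hπ) hW (-s)
  rw [sum_trajProb_mul_sum hP hπ] at hH
  have hE : ∀ U, trajProb S P (π t h) U * Real.exp (sumIncrement S P π g s t h U) =
      Real.exp (-(s ^ 2 * (L : ℝ) ^ 2 / 2)) * (trajProb S P (π t h) U *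
        Real.exp (-s * (∑ k, g t h (U.state k) (U.action k) -
          expectedSum S P (π t h) (g t h)))) := by
    intro U
    rw [mul_left_comm, ← Real.exp_add, sumIncrement]
    congr 2
    ring
  simp_rw [hE]
  rw [← Finset.mul_sum]
  refine (mul_le_mul_of_nonneg_left hH (Real.exp_pos _).le).trans ?_
  rw [← Real.exp_add]
  refine Real.exp_le_one_iff.2 (le_of_eq ?_)
  ring

/-- The event that the sums along the trajectories fall short of their expectations by more than
the deviation that has probability `δ`. -/
def sumBadEvent (S : Layering X L) (P : X → A → X → ℝ)
    (π g : (t : ℕ) → (Fin t → Trajectory S A) → X → A → ℝ) (T : ℕ) (δ : ℝ) :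
    Set (Fin T → Trajectory S A) :=
  {h | Real.log (1 / δ) ≤
    cumul (sumIncrement S P π g (Real.sqrt (2 * T * Real.log (1 / δ)) / (T * L))) T h}

lemma eventProb_sumBadEvent_le (hL : 0 < L) (hP : IsTransition S P)
    {π g : (t : ℕ) → (Fin t → Trajectory S A) → X → A → ℝ} {T : ℕ}
    (hπ : ∀ t < T, ∀ h, IsPolicy S (π t h))
    (hg : ∀ t < T, ∀ h x a, S.layer x ≠ Fin.last L → g t h x a ∈ Set.Icc (0 : ℝ) 2)
    {δ : ℝ} (hδ : 0 < δ) :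
    eventProb S P π T (sumBadEvent S P π g T δ) ≤ δ := by
  refine (eventProb_cumul_ge_le hP hπ _ (fun t ht h =>
    sum_trajProb_exp_sumIncrement_le hL hP (hπ t ht h) (hg t ht h) _) _).trans (le_of_eq ?_)
  rw [← Real.log_inv, one_div, inv_inv, Real.exp_log hδ]

lemma sum_expectedSum_le (hL : 0 < L)
    {π g : (t : ℕ) → (Fin t → Trajectory S A) → X → A → ℝ} {T : ℕ} (hT : 0 < T)
    {δ : ℝ} (hδ : 0 < δ) (hδ1 : δ < 1) {H : ℕ → Trajectory S A}
    (hH : prefixOf H T ∉ sumBadEvent S P π g T δ) :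
    ∑ t ∈ Finset.range T, expectedSum S P (π t (prefixOf H t)) (g t (prefixOf H t)) ≤
      ∑ t ∈ Finset.range T, ∑ k, g t (prefixOf H t) ((H t).state k) ((H t).action k) +
        L * Real.sqrt (2 * T * Real.log (1 / δ)) := by
  by_contra! hlt
  apply hH
  set R := Real.sqrt (2 * T * Real.log (1 / δ)) with hR
  have hT0 : (0 : ℝ) < T := by exact_mod_cast hT
  have hL0 : (0 : ℝ) < L := by exact_mod_cast hL
  have hlog : 0 < Real.log (1 / δ) := Real.log_pos (by rw [lt_div_iff₀ hδ]; linarith)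
  have hR2 : R ^ 2 = 2 * T * Real.log (1 / δ) := Real.sq_sqrt (by positivity)
  have hR0 : 0 ≤ R := Real.sqrt_nonneg _
  change Real.log (1 / δ) ≤ cumul (sumIncrement S P π g (R / (T * L))) T (prefixOf H T)
  rw [cumul_prefixOf]
  simp only [sumIncrement]
  rw [Finset.sum_sub_distrib, ← Finset.mul_sum, Finset.sum_sub_distrib, Finset.sum_const,
    nsmul_eq_mul, Finset.card_range]
  have h1 : R / (T * L) * (L * R) ≤ R / (T * L) *
      (∑ t ∈ Finset.range T, expectedSum S P (π t (prefixOf H t)) (g t (prefixOf H t)) -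
        ∑ t ∈ Finset.range T, ∑ k, g t (prefixOf H t) ((H t).state k) ((H t).action k)) :=
    mul_le_mul_of_nonneg_left (by linarith) (by positivity)
  have h2 : R / (T * L) * (L * R) = 2 * Real.log (1 / δ) := by
    have : R / (T * L) * (L * R) = R ^ 2 / T := by field_simp
    rw [this, hR2]
    field_simp
  have h3 : (T : ℝ) * ((R / (T * L)) ^ 2 * (L : ℝ) ^ 2 / 2) = Real.log (1 / δ) := by
    have : (T : ℝ) * ((R / (T * L)) ^ 2 * (L : ℝ) ^ 2 / 2) = R ^ 2 / (2 * T) := by field_simp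
    rw [this, hR2]
    field_simp
  linarith

end

/-! ### Kullback-Leibler projections -/

section

/-- The contribution of one coordinate to the unnormalized Kullback-Leibler divergence. -/
def klTerm (u v : ℝ) : ℝ := u * Real.log (u / v) - u + v

lemma klTerm_zero_left (v : ℝ) : klTerm 0 v = v := by simp [klTerm]

lemma klTerm_convex {u w v s : ℝ} (hu : 0 ≤ u) (hw : 0 ≤ w) (hv : 0 ≤ v)
    (hs : s ∈ Set.Icc (0 : ℝ) 1) :
    klTerm ((1 - s) * u + s * w) v ≤ (1 - s) * klTerm u v + s * klTerm w v := by
  rcases hv.eq_or_lt with rfl | hv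
  · simp only [klTerm, div_zero, Real.log_zero]
    apply le_of_eq
    ring
  · have hform : ∀ y, klTerm y v = y * Real.log y - y * Real.log v - y + v := by
      intro y
      rcases eq_or_ne y 0 with rfl | hy
      · simp [klTerm]
      · rw [klTerm, Real.log_div hy hv.ne']
        ring
    have h := Real.convexOn_mul_log.2 (Set.mem_Ici.2 hu) (Set.mem_Ici.2 hw)
      (sub_nonneg.2 hs.2) hs.1 (by ring)
    simp only [smul_eq_mul] at h
    rw [hform, hform, hform]
    linarith

/-- The Fenchel inequality for the convex function `klTerm · v`. -/
lemma sub_le_klTerm {u v : ℝ} (hu : 0 ≤ u) (hv : 0 ≤ v) (huv : v = 0 → u = 0) (s : ℝ) :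
    u * s - v * Real.exp s + v ≤ klTerm u v := by
  rcases hu.eq_or_lt with rfl | hu
  · rw [klTerm_zero_left]
    have := mul_nonneg hv (Real.exp_pos s).le
    linarith
  · have hv' : 0 < v := lt_of_le_of_ne hv fun h => hu.ne' (huv h.symm)
    have h1 := Real.add_one_le_exp (s - Real.log (u / v))
    rw [Real.exp_sub, Real.exp_log (div_pos hu hv')] at h1
    have h2 := mul_le_mul_of_nonneg_left h1 hu.le
    have h3 : u * (Real.exp s / (u / v)) = v * Real.exp s := by field_simp
    rw [h3] at h2
    rw [klTerm]
    linarith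

lemma klTerm_nonneg {u v : ℝ} (hu : 0 ≤ u) (hv : 0 ≤ v) (huv : v = 0 → u = 0) : 0 ≤ klTerm u v := by
  have := sub_le_klTerm hu hv huv 0
  simpa using this

lemma klTerm_le_sq_div {u v : ℝ} (hu : 0 ≤ u) (hv : 0 ≤ v) (huv : v = 0 → u = 0) :
    klTerm u v ≤ (u - v) ^ 2 / v := by
  rcases hv.eq_or_lt with rfl | hv
  · simp [huv rfl, klTerm]
  · have h1 : u * Real.log (u / v) ≤ u * (u / v - 1) := by
      rcases hu.eq_or_lt with rfl | hu
      · simp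
      · exact mul_le_mul_of_nonneg_left (Real.log_le_sub_one_of_pos (div_pos hu hv)) hu.le
    have h2 : (u - v) ^ 2 / v = u * (u / v - 1) - u + v := by
      field_simp
      ring
    rw [h2, klTerm]
    linarith

lemma klTerm_three_point {u w v : ℝ} (hw : w = 0 → u = 0) (hv : v = 0 → w = 0) :
    klTerm u v = klTerm u w + klTerm w v + (u - w) * Real.log (w / v) := by
  by_cases hw0 : w = 0
  · simp [hw hw0, hw0, klTerm]
  · have hv0 : v ≠ 0 := fun h => hw0 (hv h)
    rcases eq_or_ne u 0 with rfl | hu0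
    · simp only [klTerm]
      ring
    · simp only [klTerm]
      rw [Real.log_div hu0 hv0, Real.log_div hu0 hw0, Real.log_div hw0 hv0]
      ring

section
variable {ι : Type*} [Fintype ι]

/-- The slope of the divergence at a vanishing coordinate is infinite, so that a minimizer is
positive wherever some competitor is. -/
lemma pos_of_isMin {w p v z : ι → ℝ} {η : ℝ} (hw : ∀ i, 0 ≤ w i) (hp : ∀ i, 0 ≤ p i)
    (hv : ∀ i, 0 ≤ v i)
    (hmin : ∀ s ∈ Set.Ioo (0 : ℝ) 1, ∑ i, (η * (w i * z i) + klTerm (w i) (v i)) ≤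
      ∑ i, (η * (((1 - s) * w i + s * p i) * z i) + klTerm ((1 - s) * w i + s * p i) (v i)))
    {c : ι} (hvc : 0 < v c) (hpc : 0 < p c) : 0 < w c := by
  classical
  refine lt_of_le_of_ne (hw c) fun h0 => ?_
  set Jw := ∑ i, (η * (w i * z i) + klTerm (w i) (v i)) with hJw
  set Jp := ∑ i, (η * (p i * z i) + klTerm (p i) (v i)) with hJp
  have key : ∀ s ∈ Set.Ioo (0 : ℝ) 1, 0 ≤ Jp - Jw + p c * Real.log s := by
    intro s hs
    have hterm : ∀ i, η * (((1 - s) * w i + s * p i) * z i) +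
        klTerm ((1 - s) * w i + s * p i) (v i) ≤
        (1 - s) * (η * (w i * z i) + klTerm (w i) (v i)) +
        s * (η * (p i * z i) + klTerm (p i) (v i)) +
        if i = c then s * (p c * Real.log s) else 0 := by
      intro i
      split_ifs with hi
      · subst hi
        rw [← h0, klTerm_zero_left]
        have h1 : klTerm ((1 - s) * 0 + s * p i) (v i) =
            s * klTerm (p i) (v i) + (1 - s) * v i + s * (p i * Real.log s) := by
          rw [mul_zero, zero_add, klTerm, klTerm, mul_div_assoc,
            Real.log_mul hs.1.ne' (div_pos hpc hvc).ne']
          ring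
        rw [h1]
        apply le_of_eq
        ring
      · have := klTerm_convex (hw i) (hp i) (hv i) ⟨hs.1.le, hs.2.le⟩
        linarith
    have h1 := (hmin s hs).trans (Finset.sum_le_sum fun i _ => hterm i)
    rw [Finset.sum_add_distrib, Finset.sum_add_distrib, ← Finset.mul_sum, ← Finset.mul_sum,
      Finset.sum_ite_eq' Finset.univ c, if_pos (Finset.mem_univ c), ← hJw, ← hJp] at h1
    have h2 : 0 ≤ s * (Jp - Jw + p c * Real.log s) := by linarith
    exact nonneg_of_mul_nonneg_right h2 hs.1
  have h1 := key (Real.exp (-((|Jp - Jw| + 1) / p c)))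
    ⟨Real.exp_pos _, Real.exp_lt_one_iff.2 (by
      have : 0 < (|Jp - Jw| + 1) / p c := by positivity
      linarith)⟩
  rw [Real.log_exp, mul_neg, mul_div_cancel₀ _ hpc.ne'] at h1
  have h2 := le_abs_self (Jp - Jw)
  linarith

/-- First-order optimality of a minimizer `w`, in terms of divergences. -/
lemma three_point_of_isMin {w p v z : ι → ℝ} {η : ℝ} (hw : ∀ i, 0 ≤ w i) (hp : ∀ i, 0 ≤ p i)
    (hwp : ∀ i, w i = 0 → p i = 0) (hvw : ∀ i, v i = 0 → w i = 0)
    (hmin : ∀ s ∈ Set.Ioo (0 : ℝ) 1, ∑ i, (η * (w i * z i) + klTerm (w i) (v i)) ≤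
      ∑ i, (η * (((1 - s) * w i + s * p i) * z i) + klTerm ((1 - s) * w i + s * p i) (v i))) :
    η * ∑ i, (w i - p i) * z i ≤
      ∑ i, klTerm (p i) (v i) - ∑ i, klTerm (p i) (w i) - ∑ i, klTerm (w i) (v i) := by
  set Γ := ∑ i, (p i - w i) * (η * z i + Real.log (w i / v i)) with hΓ
  set K := ∑ i, (p i - w i) ^ 2 / w i with hK
  set J := ∑ i, (η * (w i * z i) + klTerm (w i) (v i)) with hJ
  have hK0 : 0 ≤ K := Finset.sum_nonneg fun i _ => div_nonneg (sq_nonneg _) (hw i)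
  have key : ∀ s ∈ Set.Ioo (0 : ℝ) 1, 0 ≤ Γ + s * K := by
    intro s hs
    have hterm : ∀ i, η * (((1 - s) * w i + s * p i) * z i) +
        klTerm ((1 - s) * w i + s * p i) (v i) ≤ (η * (w i * z i) + klTerm (w i) (v i)) +
        s * ((p i - w i) * (η * z i + Real.log (w i / v i))) +
        s ^ 2 * ((p i - w i) ^ 2 / w i) := by
      intro i
      have h0 : w i = 0 → (1 - s) * w i + s * p i = 0 := fun h => by rw [h, hwp i h]; ring
      rw [klTerm_three_point h0 (hvw i)]
      have h1 := klTerm_le_sq_div (u := (1 - s) * w i + s * p i) (v := w i)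
        (add_nonneg (mul_nonneg (by linarith [hs.2]) (hw i)) (mul_nonneg hs.1.le (hp i)))
        (hw i) h0
      have h2 : ((1 - s) * w i + s * p i - w i) ^ 2 / w i = s ^ 2 * ((p i - w i) ^ 2 / w i) := by
        ring
      rw [h2] at h1
      linarith
    have h1 := (hmin s hs).trans (Finset.sum_le_sum fun i _ => hterm i)
    rw [Finset.sum_add_distrib, Finset.sum_add_distrib, ← Finset.mul_sum, ← Finset.mul_sum,
      ← hJ, ← hΓ, ← hK] at h1
    have h2 : 0 ≤ s * (Γ + s * K) := by nlinarith
    exact nonneg_of_mul_nonneg_right h2 hs.1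
  have hΓ0 : 0 ≤ Γ := by
    by_contra! hneg
    have hs0 : 0 < -Γ / (2 * (K - Γ)) := div_pos (by linarith) (by linarith)
    have hs1 : -Γ / (2 * (K - Γ)) < 1 := by
      rw [div_lt_one (by linarith)]
      linarith
    have h1 := key _ ⟨hs0, hs1⟩
    have h2 : -Γ / (2 * (K - Γ)) * K ≤ -Γ / 2 := by
      rw [div_mul_eq_mul_div, div_le_div_iff₀ (by linarith) (by norm_num)]
      nlinarith
    linarith
  have h3 : ∑ i, klTerm (p i) (v i) = ∑ i, klTerm (p i) (w i) + ∑ i, klTerm (w i) (v i) +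
      ∑ i, (p i - w i) * Real.log (w i / v i) := by
    rw [← Finset.sum_add_distrib, ← Finset.sum_add_distrib]
    exact Finset.sum_congr rfl fun i _ => klTerm_three_point (hwp i) (hvw i)
  have h4 : Γ = -(η * ∑ i, (w i - p i) * z i) + ∑ i, (p i - w i) * Real.log (w i / v i) := by
    rw [hΓ, Finset.mul_sum, ← Finset.sum_neg_distrib, ← Finset.sum_add_distrib]
    exact Finset.sum_congr rfl fun i _ => by ring
  linarith

end

/-- The change of a linear functional between two distributions, against their divergence: Gibbs'
variational principle together with Hoeffding's lemma. -/
lemma sum_sub_mul_le_klTerm {ι : Type*} {I : Finset ι} {p q a : ι → ℝ} (hp : ∀ i ∈ I, 0 ≤ p i)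
    (hq : ∀ i ∈ I, 0 ≤ q i) (hqp : ∀ i ∈ I, q i = 0 → p i = 0) (hp1 : ∑ i ∈ I, p i = 1)
    (hq1 : ∑ i ∈ I, q i = 1) {M : ℝ} (ha : ∀ i ∈ I, |a i| ≤ M) :
    ∑ i ∈ I, (q i - p i) * a i ≤ ∑ i ∈ I, klTerm (p i) (q i) + M ^ 2 / 2 := by
  set m := ∑ i ∈ I, q i * a i with hm
  have hH := sum_mul_exp_le (ι := I) (p := fun i => q i) (W := fun i => a i)
    (fun i => hq i i.2) (by rw [Finset.sum_coe_sort I q, hq1]) (a := -M) (b := M)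
    (fun i => abs_le.1 (ha i i.2)) (-1)
  rw [Finset.sum_coe_sort I fun i => q i * a i, ← hm,
    Finset.sum_coe_sort I fun i => q i * Real.exp (-1 * (a i - m))] at hH
  have h1 : ∀ i ∈ I, p i * (m - a i - M ^ 2 / 2) -
      Real.exp (-(M ^ 2 / 2)) * (q i * Real.exp (-1 * (a i - m))) + q i ≤ klTerm (p i) (q i) := by
    intro i hi
    have h2 := sub_le_klTerm (hp i hi) (hq i hi) (hqp i hi) (m - a i - M ^ 2 / 2)
    have h3 : Real.exp (m - a i - M ^ 2 / 2) =
        Real.exp (-(M ^ 2 / 2)) * Real.exp (-1 * (a i - m)) := by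
      rw [← Real.exp_add]
      congr 1
      ring
    rw [h3] at h2
    linarith
  have h2 := Finset.sum_le_sum h1
  rw [Finset.sum_add_distrib, Finset.sum_sub_distrib, ← Finset.mul_sum, hq1] at h2
  have h3 : ∑ i ∈ I, p i * (m - a i - M ^ 2 / 2) = m - ∑ i ∈ I, p i * a i - M ^ 2 / 2 := by
    have : ∀ i, p i * (m - a i - M ^ 2 / 2) = p i * (m - M ^ 2 / 2) - p i * a i := fun i => by ring
    simp_rw [this]
    rw [Finset.sum_sub_distrib, ← Finset.sum_mul, hp1]
    ring
  have h4 : Real.exp (-(M ^ 2 / 2)) * ∑ i ∈ I, q i * Real.exp (-1 * (a i - m)) ≤ 1 := by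
    refine (mul_le_mul_of_nonneg_left hH (Real.exp_pos _).le).trans (le_of_eq ?_)
    rw [← Real.exp_add, Real.exp_eq_one_iff]
    ring
  have h5 : ∑ i ∈ I, (q i - p i) * a i = m - ∑ i ∈ I, p i * a i := by
    simp_rw [sub_mul]
    rw [Finset.sum_sub_distrib]
  rw [h3] at h2
  linarith

variable {X A : Type*} [Fintype X] [Fintype A] [DecidableEq X] [DecidableEq A] {L : ℕ}
variable {S : Layering X L} {P : X → A → X → ℝ}

/-! ### Mirror descent on the confidence sets -/

lemma pairMass_combo (S : Layering X L) (p q : X → A → X → ℝ) (u v : ℝ) (x : X) (a : A) :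
    pairMass S (u • p + v • q) x a = u * pairMass S p x a + v * pairMass S q x a := by
  simp only [pairMass, Pi.add_apply, Pi.smul_apply, smul_eq_mul]
  rw [Finset.sum_add_distrib, Finset.mul_sum, Finset.mul_sum]

/-- The confidence condition in a homogeneous form, which is meaningful at pairs of mass zero. -/
lemma sum_abs_sub_le_iff {T : ℕ} {δ : ℝ} {c : Counters X A} {q : X → A → X → ℝ}
    (h0 : ∀ x a x', 0 ≤ q x a x') (hloop : ∀ x a x', x' ∉ S.next x → q x a x' = 0) (x : X) (a : A) :
    (pairMass S q x a ≠ 0 → ∑ x', |inducedTransition S q x a x' - c.estimate x a x'| ≤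
      c.radius S T δ x a) ↔
    ∑ x', |q x a x' - pairMass S q x a * c.estimate x a x'| ≤
      pairMass S q x a * c.radius S T δ x a := by
  have hm0 : 0 ≤ pairMass S q x a := Finset.sum_nonneg fun y _ => h0 x a y
  rcases hm0.eq_or_lt with hm | hm
  · have hz : ∀ x', q x a x' = 0 := by
      intro x'
      by_cases hx' : x' ∈ S.next x
      · exact (Finset.sum_eq_zero_iff_of_nonneg fun y _ => h0 x a y).1 hm.symm x' hx'
      · exact hloop x a x' hx'
    simp [← hm, hz]
  · have h1 : ∑ x', |q x a x' - pairMass S q x a * c.estimate x a x'| =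
        pairMass S q x a * ∑ x', |inducedTransition S q x a x' - c.estimate x a x'| := by
      rw [Finset.mul_sum]
      refine Finset.sum_congr rfl fun x' _ => ?_
      rw [inducedTransition, ← abs_of_pos hm, ← abs_mul, abs_of_pos hm, mul_sub,
        mul_div_cancel₀ _ hm.ne']
    rw [h1, mul_le_mul_iff_right₀ hm]
    exact ⟨fun h => h hm.ne', fun h _ => h⟩

lemma convex_confidenceSet (S : Layering X L) (T : ℕ) (δ : ℝ) (c : Counters X A) :
    Convex ℝ {p | InConfidenceSet S T δ c p} := by
  intro p hp q hq u v hu hv huv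
  have hp : InConfidenceSet S T δ c p := hp
  have hq : InConfidenceSet S T δ c q := hq
  have hcube : u • p + v • q ∈ cube X A := by
    intro x a x'
    have h1 := hp.mem_cube x a x'
    have h2 := hq.mem_cube x a x'
    exact convex_Icc (0 : ℝ) 1 h1 h2 hu hv huv
  have hloop : ∀ x a x', x' ∉ S.next x → (u • p + v • q) x a x' = 0 := by
    intro x a x' h
    simp [hp.loop_free x a x' h, hq.loop_free x a x' h]
  refine ⟨hcube, hloop, fun k hk => ?_, fun k hk x hx => ?_, fun x a => ?_⟩
  · simp only [Pi.add_apply, Pi.smul_apply, smul_eq_mul, Finset.sum_add_distrib, ← Finset.mul_sum,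
      hp.sum_one k hk, hq.sum_one k hk]
    linarith
  · simp only [Pi.add_apply, Pi.smul_apply, smul_eq_mul, Finset.sum_add_distrib, ← Finset.mul_sum,
      hp.flow k hk x hx, hq.flow k hk x hx]
  · rw [sum_abs_sub_le_iff (fun x a x' => (hcube x a x').1) hloop]
    have h1 := (sum_abs_sub_le_iff (fun x a x' => (hp.mem_cube x a x').1) hp.loop_free x a).1
      (hp.l1_dist x a)
    have h2 := (sum_abs_sub_le_iff (fun x a x' => (hq.mem_cube x a x').1) hq.loop_free x a).1
      (hq.l1_dist x a)
    rw [pairMass_combo]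
    have h3 : ∀ x', |(u • p + v • q) x a x' -
        (u * pairMass S p x a + v * pairMass S q x a) * c.estimate x a x'| ≤
        u * |p x a x' - pairMass S p x a * c.estimate x a x'| +
        v * |q x a x' - pairMass S q x a * c.estimate x a x'| := by
      intro x'
      have h4 : (u • p + v • q) x a x' -
          (u * pairMass S p x a + v * pairMass S q x a) * c.estimate x a x' =
          u * (p x a x' - pairMass S p x a * c.estimate x a x') +
          v * (q x a x' - pairMass S q x a * c.estimate x a x') := by
        simp only [Pi.add_apply, Pi.smul_apply, smul_eq_mul]
        ring
      rw [h4]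
      refine (abs_add_le _ _).trans (le_of_eq ?_)
      rw [abs_mul, abs_mul, abs_of_nonneg hu, abs_of_nonneg hv]
    refine (Finset.sum_le_sum fun x' _ => h3 x').trans ?_
    rw [Finset.sum_add_distrib, ← Finset.mul_sum, ← Finset.mul_sum]
    have h5 := mul_le_mul_of_nonneg_left h1 hu
    have h6 := mul_le_mul_of_nonneg_left h2 hv
    linarith

lemma unnormKL_eq_sum (p q : X → A → X → ℝ) :
    unnormKL p q = ∑ i : X × A × X, klTerm (p i.1 i.2.1 i.2.2) (q i.1 i.2.1 i.2.2) := by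
  simp only [Fintype.sum_prod_type, klTerm, unnormKL]

lemma pairing_eq_sum (p z : X → A → X → ℝ) :
    pairing p z = ∑ i : X × A × X, p i.1 i.2.1 i.2.2 * z i.1 i.2.1 i.2.2 := by
  simp only [Fintype.sum_prod_type, pairing]

lemma sum_of_isMinOn {K : Set (X → A → X → ℝ)} (hK : Convex ℝ K) {η : ℝ} {w p v z : X → A → X → ℝ}
    (hw : w ∈ K) (hp : p ∈ K) (hmin : IsMinOn (fun u => η * pairing u z + unnormKL u v) K w) :
    ∀ s ∈ Set.Ioo (0 : ℝ) 1, ∑ i : X × A × X, (η * (w i.1 i.2.1 i.2.2 * z i.1 i.2.1 i.2.2) +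
      klTerm (w i.1 i.2.1 i.2.2) (v i.1 i.2.1 i.2.2)) ≤
      ∑ i : X × A × X, (η * (((1 - s) * w i.1 i.2.1 i.2.2 + s * p i.1 i.2.1 i.2.2) *
        z i.1 i.2.1 i.2.2) + klTerm ((1 - s) * w i.1 i.2.1 i.2.2 + s * p i.1 i.2.1 i.2.2)
          (v i.1 i.2.1 i.2.2)) := by
  intro s hs
  have h1 := isMinOn_iff.1 hmin _ (hK hw hp (sub_nonneg.2 hs.2.le) hs.1.le (by ring))
  simp only [unnormKL_eq_sum, pairing_eq_sum, Finset.mul_sum, ← Finset.sum_add_distrib,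
    Pi.add_apply, Pi.smul_apply, smul_eq_mul] at h1
  exact h1

/-- A sub-gradient of a Lipschitz function is bounded by the Lipschitz constant in the coordinates
in which the point is interior to the cube. -/
lemma IsSubgradient.abs_apply_le {g : (X → A → X → ℝ) → ℝ} {q z : X → A → X → ℝ} {F : ℝ}
    (hz : IsSubgradient g q z) (hq : q ∈ cube X A)
    (hg : ∀ q ∈ cube X A, ∀ q' ∈ cube X A,
      |g q - g q'| ≤ F * ∑ x, ∑ a, ∑ x', |q x a x' - q' x a x'|)
    {x : X} {a : A} {x' : X} (h0 : 0 < q x a x') (h1 : q x a x' < 1) : |z x a x'| ≤ F := by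
  have key : ∀ e : ℝ, q x a x' + e ∈ Set.Icc (0 : ℝ) 1 → e * z x a x' ≤ F * |e| := by
    intro e he
    let D : X → A → X → ℝ := fun y b y' => if y = x ∧ b = a ∧ y' = x' then e else 0
    have hsum : ∀ G : ℝ → X → A → X → ℝ, (∀ y b y', G 0 y b y' = 0) →
        ∑ y, ∑ b, ∑ y', G (D y b y') y b y' = G e x a x' := by
      intro G hG
      rw [Finset.sum_eq_single x, Finset.sum_eq_single a, Finset.sum_eq_single x']
      · simp [D]
      · intro y _ hy; simp [D, hy, hG]
      · simp
      · intro b _ hb; simp [D, hb, hG]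
      · simp
      · intro y _ hy; simp [D, hy, hG]
      · simp
    have hq' : q + D ∈ cube X A := by
      intro y b y'
      simp only [Pi.add_apply, D]
      split_ifs with h
      · obtain ⟨rfl, rfl, rfl⟩ := h
        exact he
      · rw [add_zero]
        exact hq y b y'
    have h2 := hz _ hq'
    rw [add_sub_cancel_left, pairing, hsum (fun u y b y' => u * z y b y') (by simp)] at h2
    have h3 := (le_abs_self _).trans (hg _ hq' _ hq)
    simp only [Pi.add_apply, add_sub_cancel_left] at h3
    rw [hsum (fun u _ _ _ => |u|) (by simp)] at h3
    linarith
  rw [abs_le]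
  constructor
  · have h2 := key (-q x a x') ⟨by linarith, by linarith⟩
    rw [abs_neg, abs_of_pos h0] at h2
    have h3 : 0 ≤ q x a x' * (F + z x a x') := by linarith
    have := nonneg_of_mul_nonneg_right h3 h0
    linarith
  · have h4 : 0 < 1 - q x a x' := by linarith
    have h2 := key (1 - q x a x') ⟨by linarith, by linarith⟩
    rw [abs_of_pos h4] at h2
    have h3 : 0 ≤ (1 - q x a x') * (F - z x a x') := by linarith
    have := nonneg_of_mul_nonneg_right h3 h4
    linarith

/-- The triples `X_k × A × X_{k+1}`. -/
def layerTriples (S : Layering X L) (A : Type*) [Fintype A] (k : ℕ) : Finset (X × A × X) :=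
  S.states k ×ˢ (Finset.univ : Finset A) ×ˢ S.states (k + 1)

lemma sum_layerTriples (S : Layering X L) (k : ℕ) (g : X × A × X → ℝ) :
    ∑ i ∈ layerTriples S A k, g i =
      ∑ x ∈ S.states k, ∑ a, ∑ x' ∈ S.states (k + 1), g (x, a, x') := by
  rw [layerTriples, Finset.sum_product]
  exact Finset.sum_congr rfl fun x _ => Finset.sum_product _ _ _

lemma sum_triples_eq (S : Layering X L) (g : X × A × X → ℝ)
    (hg : ∀ x a x', x' ∉ S.next x → g (x, a, x') = 0) :
    ∑ i, g i = ∑ k ∈ Finset.range L, ∑ i ∈ layerTriples S A k, g i := by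
  simp_rw [sum_layerTriples]
  rw [← S.sum_eq_sum_layers (fun x a x' => g (x, a, x')) hg, Fintype.sum_prod_type]
  exact Finset.sum_congr rfl fun x _ => Fintype.sum_prod_type _

lemma mem_next_of_mem_layerTriples {k : ℕ} {i : X × A × X} (hi : i ∈ layerTriples S A k) :
    i.2.2 ∈ S.next i.1 := by
  rw [layerTriples, Finset.mem_product, Finset.mem_product] at hi
  rw [S.next_eq hi.1]
  exact hi.2.2

/-- A member of a layer that carries the whole mass of that layer is its only triple. -/
lemma IsOccupancyMeasure.eq_one_of_eq_one {p q : X → A → X → ℝ} (hp : IsOccupancyMeasure S p)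
    (hq : IsOccupancyMeasure S q) (hpos : ∀ x a x', x' ∈ S.next x → 0 < q x a x')
    {x : X} {a : A} {x' : X} (h : q x a x' = 1) : p x a x' = 1 := by
  have hx' : x' ∈ S.next x := by
    by_contra hx'
    rw [hq.loop_free x a x' hx'] at h
    exact zero_ne_one h
  have hx : (S.layer x : ℕ) < L := by
    have h1 := (S.layer x').2
    rw [Layering.mem_next] at hx'
    omega
  set k : ℕ := (S.layer x : ℕ) with hk
  have hxk : x ∈ S.states k := Layering.mem_states.2 rfl
  have hi : (x, a, x') ∈ layerTriples S A k := by
    rw [layerTriples, Finset.mem_product, Finset.mem_product]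
    exact ⟨hxk, Finset.mem_univ _, by rwa [← S.next_eq hxk]⟩
  have h1 : ∑ i ∈ layerTriples S A k, q i.1 i.2.1 i.2.2 = 1 := by
    rw [sum_layerTriples]
    exact hq.sum_one k hx
  have h2 : ∑ i ∈ layerTriples S A k, p i.1 i.2.1 i.2.2 = 1 := by
    rw [sum_layerTriples]
    exact hp.sum_one k hx
  have h3 : ∀ j ∈ layerTriples S A k, j ≠ (x, a, x') → False := by
    intro j hj hne
    have h4 : ∑ i ∈ {(x, a, x'), j}, q i.1 i.2.1 i.2.2 ≤
        ∑ i ∈ layerTriples S A k, q i.1 i.2.1 i.2.2 :=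
      Finset.sum_le_sum_of_subset_of_nonneg (by
        intro i hi'
        rcases Finset.mem_insert.1 hi' with rfl | hi'
        · exact hi
        · rw [Finset.mem_singleton.1 hi']
          exact hj) fun i _ _ => hq.nonneg _ _ _
    rw [Finset.sum_pair hne.symm, h1] at h4
    have h5 := hpos _ j.2.1 _ (mem_next_of_mem_layerTriples hj)
    simp only [h] at h4
    linarith
  rw [Finset.sum_eq_single_of_mem _ hi fun j hj hne => (h3 j hj hne).elim] at h2
  exact h2

/-- One step of mirror descent.  Where `q` is `0` or `1` the sub-gradient may be unbounded, but
there all occupancy measures agree. -/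
lemma pairing_sub_le_unnormKL {p q z : X → A → X → ℝ} (hp : IsOccupancyMeasure S p)
    (hq : IsOccupancyMeasure S q) (hpos : ∀ x a x', x' ∈ S.next x → 0 < q x a x')
    {g : (X → A → X → ℝ) → ℝ} {F : ℝ} (hF : 0 ≤ F) (hz : IsSubgradient g q z)
    (hg : ∀ q ∈ cube X A, ∀ q' ∈ cube X A,
      |g q - g q'| ≤ F * ∑ x, ∑ a, ∑ x', |q x a x' - q' x a x'|) {η : ℝ} (hη : 0 ≤ η) :
    η * pairing (q - p) z ≤ unnormKL p q + L * ((η * F) ^ 2 / 2) := by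
  let z' : X → A → X → ℝ := fun x a x' => if 0 < q x a x' ∧ q x a x' < 1 then z x a x' else 0
  have hz' : ∀ x a x', |η * z' x a x'| ≤ η * F := by
    intro x a x'
    rw [abs_mul, abs_of_nonneg hη]
    refine mul_le_mul_of_nonneg_left ?_ hη
    simp only [z']
    split_ifs with h
    · exact hz.abs_apply_le hq.mem_cube hg h.1 h.2
    · simpa using hF
  have hzero : ∀ x a x', q x a x' = 0 → p x a x' = 0 := by
    intro x a x' h
    refine hp.loop_free x a x' fun hx' => ?_
    exact (hpos x a x' hx').ne' h
  have heq : η * pairing (q - p) z = ∑ i : X × A × X,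
      (q i.1 i.2.1 i.2.2 - p i.1 i.2.1 i.2.2) * (η * z' i.1 i.2.1 i.2.2) := by
    rw [pairing_eq_sum, Finset.mul_sum]
    refine Finset.sum_congr rfl fun i _ => ?_
    obtain ⟨x, a, x'⟩ := i
    simp only [Pi.sub_apply, z']
    split_ifs with h
    · ring
    · have hqp : q x a x' = p x a x' := by
        have h1 := hq.mem_cube x a x'
        rcases h1.1.eq_or_lt with h2 | h2
        · rw [← h2, hzero x a x' h2.symm]
        · have h3 : q x a x' = 1 := le_antisymm h1.2 (not_lt.1 fun h4 => h ⟨h2, h4⟩)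
          rw [h3, hp.eq_one_of_eq_one hq hpos h3]
      rw [hqp]
      ring
  rw [heq, unnormKL_eq_sum, sum_triples_eq S, sum_triples_eq S]
  · have h1 : ∀ k ∈ Finset.range L, ∑ i ∈ layerTriples S A k,
        (q i.1 i.2.1 i.2.2 - p i.1 i.2.1 i.2.2) * (η * z' i.1 i.2.1 i.2.2) ≤
        ∑ i ∈ layerTriples S A k, klTerm (p i.1 i.2.1 i.2.2) (q i.1 i.2.1 i.2.2) +
          (η * F) ^ 2 / 2 := by
      intro k hk
      rw [Finset.mem_range] at hk
      refine sum_sub_mul_le_klTerm (fun i _ => hp.nonneg _ _ _) (fun i _ => hq.nonneg _ _ _)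
        (fun i _ h => hzero _ _ _ h) ?_ ?_ fun i _ => hz' _ _ _
      · rw [sum_layerTriples]
        exact hp.sum_one k hk
      · rw [sum_layerTriples]
        exact hq.sum_one k hk
    refine (Finset.sum_le_sum h1).trans (le_of_eq ?_)
    rw [Finset.sum_add_distrib, Finset.sum_const, nsmul_eq_mul, Finset.card_range]
  · intro x a x' h
    simp [klTerm, hp.loop_free x a x' h, hq.loop_free x a x' h]
  · intro x a x' h
    simp [hp.loop_free x a x' h, hq.loop_free x a x' h]

lemma unnormKL_nonneg {p q : X → A → X → ℝ} (hp : IsOccupancyMeasure S p)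
    (hq : IsOccupancyMeasure S q) (hpos : ∀ x a x', x' ∈ S.next x → 0 < q x a x') :
    0 ≤ unnormKL p q := by
  rw [unnormKL_eq_sum]
  refine Finset.sum_nonneg fun i _ => klTerm_nonneg (hp.nonneg _ _ _) (hq.nonneg _ _ _) fun h => ?_
  exact hp.loop_free _ _ _ fun hx' => (hpos _ _ _ hx').ne' h

/-! ### The initial measure -/

lemma sum_card_states_le (S : Layering X L) :
    ∑ k ∈ Finset.range L, ((S.states k).card : ℝ) ≤ Fintype.card X ∧
    ∑ k ∈ Finset.range L, ((S.states (k + 1)).card : ℝ) ≤ Fintype.card X := by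
  have h1 : ∑ k ∈ Finset.range (L + 1), (S.states k).card = Fintype.card X := by
    rw [← Finset.card_univ, Finset.card_eq_sum_card_fiberwise (t := Finset.range (L + 1))
      (f := fun x => (S.layer x : ℕ))]
    · rfl
    · intro x _
      exact Finset.mem_coe.2 (Finset.mem_range.2 (S.layer x).2)
  constructor
  · rw [Finset.sum_range_succ] at h1
    have : ∑ k ∈ Finset.range L, (S.states k).card ≤ Fintype.card X := by omega
    exact_mod_cast this
  · rw [Finset.sum_range_succ'] at h1
    have : ∑ k ∈ Finset.range L, (S.states (k + 1)).card ≤ Fintype.card X := by omega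
    exact_mod_cast this

lemma initialMeasure_pos [Nonempty A] {x : X} {x' : X} (h : x' ∈ S.next x) (a : A) :
    0 < initialMeasure S x a x' := by
  have h1 : 0 < (S.next x).card := Finset.card_pos.2 ⟨x', h⟩
  have h2 : 0 < (S.states (S.layer x)).card := Finset.card_pos.2 ⟨x, Layering.mem_states.2 rfl⟩
  have h3 : 0 < Fintype.card A := Fintype.card_pos
  rw [initialMeasure, if_pos h]
  positivity

lemma initialMeasure_eq {k : ℕ} {x x' : X} (hx : x ∈ S.states k) (hx' : x' ∈ S.states (k + 1))
    (a : A) : initialMeasure S x a x' = 1 / (((S.states k).card : ℝ) * Fintype.card A *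
      ((S.states (k + 1)).card : ℝ)) := by
  rw [initialMeasure, S.next_eq hx, if_pos hx', Layering.mem_states.1 hx]

lemma isOccupancyMeasure_initialMeasure [Nonempty A] (hP : IsTransition S P) :
    IsOccupancyMeasure S (initialMeasure S : X → A → X → ℝ) := by
  have hA : (1 : ℝ) ≤ Fintype.card A := by exact_mod_cast Fintype.card_pos (α := A)
  have hcard : ∀ k ≤ L, (1 : ℝ) ≤ (S.states k).card := fun k hk => by
    exact_mod_cast Finset.card_pos.2 (hP.states_nonempty hk)
  refine ⟨fun x a x' => ?_, fun x a x' h => by rw [initialMeasure, if_neg h], fun k hk => ?_,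
    fun k hk x hx => ?_⟩
  · by_cases h : x' ∈ S.next x
    · refine ⟨(initialMeasure_pos h a).le, ?_⟩
      have h1 : (1 : ℝ) ≤ (S.next x).card := by exact_mod_cast Finset.card_pos.2 ⟨x', h⟩
      have h2 := hcard (S.layer x) (Nat.lt_succ_iff.1 (S.layer x).2)
      rw [initialMeasure, if_pos h]
      have h3 : 1 ≤ ((S.states (S.layer x)).card : ℝ) * Fintype.card A * (S.next x).card :=
        one_le_mul_of_one_le_of_one_le (one_le_mul_of_one_le_of_one_le h2 hA) h1
      exact div_le_one_of_le₀ h3 (by positivity)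
    · rw [initialMeasure, if_neg h]
      simp
  · have h1 := hcard k hk.le
    have h2 := hcard (k + 1) hk
    rw [Finset.sum_congr rfl fun x hx => Finset.sum_congr rfl fun a _ =>
      Finset.sum_congr rfl fun x' hx' => initialMeasure_eq hx hx' a]
    simp only [Finset.sum_const, nsmul_eq_mul, Finset.card_univ]
    field_simp
  · have h1 := hcard k (by omega)
    have h2 := hcard (k + 1) (by omega)
    have h3 := hcard (k + 2) (by omega)
    rw [Finset.sum_congr rfl fun x' hx' => Finset.sum_congr rfl fun a _ =>
      initialMeasure_eq hx hx' a, Finset.sum_congr rfl fun x' hx' => Finset.sum_congr rfl fun a _ =>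
      initialMeasure_eq hx' hx a]
    simp only [Finset.sum_const, nsmul_eq_mul, Finset.card_univ]
    field_simp

lemma sum_log_le {n : ℕ} (hn : 0 < n) {u : ℕ → ℝ} {m : ℝ} (hu : ∀ k < n, 0 < u k)
    (hm : ∑ k ∈ Finset.range n, u k ≤ m) :
    ∑ k ∈ Finset.range n, Real.log (u k) ≤ n * Real.log (m / n) := by
  have hn0 : (0 : ℝ) < n := by exact_mod_cast hn
  have hm0 : 0 < m := lt_of_lt_of_le (Finset.sum_pos (fun k hk => hu k (Finset.mem_range.1 hk))
    (Finset.nonempty_range_iff.2 hn.ne')) hm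
  have h1 : ∀ k ∈ Finset.range n, Real.log (u k) ≤ Real.log (m / n) + (u k / (m / n) - 1) := by
    intro k hk
    have h2 := hu k (Finset.mem_range.1 hk)
    have h3 : 0 < m / n := by positivity
    have h4 := Real.log_le_sub_one_of_pos (div_pos h2 h3)
    rw [Real.log_div h2.ne' h3.ne'] at h4
    linarith
  refine (Finset.sum_le_sum h1).trans ?_
  rw [Finset.sum_add_distrib, Finset.sum_sub_distrib, ← Finset.sum_div]
  simp only [Finset.sum_const, Finset.card_range, nsmul_eq_mul, mul_one]
  have h5 : (∑ k ∈ Finset.range n, u k) / (m / n) ≤ n := by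
    rw [div_le_iff₀ (by positivity)]
    have : (n : ℝ) * (m / n) = m := by field_simp
    rw [this]
    exact hm
  linarith

lemma unnormKL_initialMeasure_le [Nonempty A] (hL : 0 < L) (hP : IsTransition S P)
    {p : X → A → X → ℝ} (hp : IsOccupancyMeasure S p) :
    unnormKL p (initialMeasure S) ≤
      L * Real.log ((Fintype.card X : ℝ) ^ 2 * Fintype.card A / (L : ℝ) ^ 2) := by
  have hq := isOccupancyMeasure_initialMeasure (A := A) hP
  have hA : (0 : ℝ) < Fintype.card A := by exact_mod_cast Fintype.card_pos (α := A)
  have hL0 : (0 : ℝ) < L := by exact_mod_cast hL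
  have hX : (0 : ℝ) < Fintype.card X := by
    have := two_le_card hL S
    positivity
  have hcard : ∀ k ≤ L, (0 : ℝ) < (S.states k).card := fun k hk => by
    exact_mod_cast Finset.card_pos.2 (hP.states_nonempty hk)
  have hlayer : ∀ k ∈ Finset.range L, ∑ i ∈ layerTriples S A k,
      klTerm (p i.1 i.2.1 i.2.2) (initialMeasure S i.1 i.2.1 i.2.2) ≤
      Real.log ((S.states k).card) + Real.log (Fintype.card A) +
        Real.log ((S.states (k + 1)).card) := by
    intro k hk
    rw [Finset.mem_range] at hk
    have h1 := hcard k hk.le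
    have h2 := hcard (k + 1) hk
    set n : ℝ := ((S.states k).card : ℝ) * Fintype.card A * (S.states (k + 1)).card with hn
    have hn0 : 0 < n := by positivity
    have h3 : ∀ i ∈ layerTriples S A k,
        klTerm (p i.1 i.2.1 i.2.2) (initialMeasure S i.1 i.2.1 i.2.2) ≤
        p i.1 i.2.1 i.2.2 * Real.log n - p i.1 i.2.1 i.2.2 +
          initialMeasure S i.1 i.2.1 i.2.2 := by
      intro i hi
      have hi' := hi
      rw [layerTriples, Finset.mem_product, Finset.mem_product] at hi'
      have h4 := hp.mem_cube i.1 i.2.1 i.2.2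
      rw [initialMeasure_eq hi'.1 hi'.2.2, ← hn, klTerm]
      rcases h4.1.eq_or_lt with h5 | h5
      · rw [← h5]
        simp
      · rw [div_div_eq_mul_div, div_one, Real.log_mul h5.ne' hn0.ne']
        have h6 := mul_nonpos_of_nonneg_of_nonpos h5.le (Real.log_nonpos h5.le h4.2)
        linarith
    refine (Finset.sum_le_sum h3).trans ?_
    rw [Finset.sum_add_distrib, Finset.sum_sub_distrib, ← Finset.sum_mul, sum_layerTriples,
      sum_layerTriples, hp.sum_one k hk, hq.sum_one k hk, hn, Real.log_mul (by positivity) h2.ne',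
      Real.log_mul h1.ne' hA.ne']
    linarith
  rw [unnormKL_eq_sum, sum_triples_eq S]
  · refine (Finset.sum_le_sum hlayer).trans ?_
    rw [Finset.sum_add_distrib, Finset.sum_add_distrib, Finset.sum_const, nsmul_eq_mul,
      Finset.card_range]
    have h1 := sum_log_le hL (u := fun k => ((S.states k).card : ℝ))
      (fun k hk => hcard k hk.le) (sum_card_states_le S).1
    have h2 := sum_log_le hL (u := fun k => ((S.states (k + 1)).card : ℝ))
      (fun k hk => hcard (k + 1) hk) (sum_card_states_le S).2
    have h3 : Real.log ((Fintype.card X : ℝ) ^ 2 * Fintype.card A / (L : ℝ) ^ 2) =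
        Real.log (Fintype.card X / L) + Real.log (Fintype.card A) +
          Real.log (Fintype.card X / L) := by
      rw [← Real.log_mul (by positivity) (by positivity),
        ← Real.log_mul (by positivity) (by positivity)]
      congr 1
      field_simp
    rw [h3]
    linarith
  · intro x a x' h
    simp [klTerm, hp.loop_free x a x' h, initialMeasure, h]

end

/-! ### Runs of the algorithm -/

section

variable {X A : Type*} [Fintype X] [Fintype A] [DecidableEq X] [DecidableEq A] {L d : ℕ}
variable {S : Layering X L} {P : X → A → X → ℝ}

/-- Before the first episode the confidence balls contain every distribution, in particular the
ones induced by the uniform initial measure. -/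
lemma inConfidenceSet_initialMeasure [Nonempty A] (hL : 0 < L) (hP : IsTransition S P) {T : ℕ}
    (hT : 0 < T) {δ : ℝ} (hδ : 0 < δ) (hδ1 : δ < 1) (r : ℕ) (h : Fin 0 → Trajectory S A) :
    InConfidenceSet S T δ (countersAt S r 0 h) (initialMeasure S) := by
  have hq := isOccupancyMeasure_initialMeasure (A := A) hP
  refine ⟨hq.mem_cube, hq.loop_free, hq.sum_one, hq.flow, fun x a hm => ?_⟩
  have hx : S.layer x ≠ Fin.last L := by
    intro hx
    rw [pairMass, S.next_eq_empty hx, Finset.sum_empty] at hm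
    exact hm rfl
  refine le_trans (le_of_eq ?_) (one_le_radius hL hP hT hδ hδ1 hx rfl)
  rw [← sum_inducedTransition hq hm]
  refine Finset.sum_congr rfl fun x' _ => ?_
  simp only [Counters.estimate, countersAt, Nat.cast_zero, zero_div, sub_zero]
  exact abs_of_nonneg (inducedTransition_nonneg hq x a x')

variable {r T : ℕ} {η δ : ℝ} {f : (X → A → X → Fin d → ℝ) → (X → A → X → ℝ) → ℝ}
  {l : Fin T → X → A → X → Fin d → ℝ}
  {q : (t : ℕ) → (Fin t → Trajectory S A) → X → A → X → ℝ}

/-- All iterates lie in the respective confidence sets and stay positive. -/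
lemma IsUCOREPS.mem_and_pos [Nonempty A] (hL : 0 < L) (hP : IsTransition S P)
    (hT : 0 < T) (hδ : 0 < δ) (hδ1 : δ < 1) (hr : r ≤ 1) (hq : IsUCOREPS S r T η δ f l q)
    (H : ℕ → Trajectory S A) (t : ℕ) (ht : t ≤ T) :
    InConfidenceSet S T δ (countersAt S r t (prefixOf H t)) (q t (prefixOf H t)) ∧
      ∀ x a x', x' ∈ S.next x → 0 < q t (prefixOf H t) x a x' := by
  induction t with
  | zero =>
    rw [hq.init]
    exact ⟨inConfidenceSet_initialMeasure hL hP hT hδ hδ1 r _,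
      fun x a x' h => initialMeasure_pos h a⟩
  | succ t ih =>
    obtain ⟨hmem, hpos⟩ := ih (by omega)
    obtain ⟨z, -, hmem', hmin⟩ := hq.step ⟨t, ht⟩ (prefixOf H (t + 1))
    refine ⟨hmem', fun x a x' h => ?_⟩
    obtain ⟨p, hp, hppos⟩ := exists_pos_mem_confidenceSet hL hP hT hδ hδ1 hr H (t + 1)
    have hseg := sum_of_isMinOn (convex_confidenceSet S T δ _) hmem' hp hmin
    exact pos_of_isMin (c := (x, a, x')) (fun i => (hmem'.mem_cube _ _ _).1)
      (fun i => (hp.mem_cube _ _ _).1) (fun i => (hmem.mem_cube _ _ _).1) hseg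
      (hpos x a x' h) (hppos x a x' h)

lemma learnerPolicy_eq [Nonempty A] (hP : IsTransition S P) (hq : IsUCOREPS S r T η δ f l q)
    (t : ℕ) (h : Fin t → Trajectory S A) (x : X) (a : A) (hx : S.layer x ≠ Fin.last L) :
    learnerPolicy S q t h x a = inducedPolicy S (q t h) x a := by
  cases t with
  | succ t => rfl
  | zero =>
    have h1 : (0 : ℝ) < (S.next x).card := by
      exact_mod_cast Finset.card_pos.2 (hP.next_nonempty hx)
    have h2 : (0 : ℝ) < (S.states (S.layer x)).card := by
      exact_mod_cast Finset.card_pos.2 ⟨x, Layering.mem_states.2 rfl⟩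
    have h3 : (0 : ℝ) < Fintype.card A := by exact_mod_cast Fintype.card_pos (α := A)
    have h4 : ∀ b, pairMass S (initialMeasure S : X → A → X → ℝ) x b =
        1 / ((S.states (S.layer x)).card * Fintype.card A) := by
      intro b
      rw [pairMass, Finset.sum_congr rfl fun y hy => by rw [initialMeasure, if_pos hy],
        Finset.sum_const, nsmul_eq_mul]
      field_simp
    simp only [learnerPolicy, inducedPolicy, hq.init, h4, Finset.sum_const, nsmul_eq_mul,
      Finset.card_univ]
    field_simp

lemma isPolicy_learnerPolicy [Nonempty A] (hL : 0 < L) (hP : IsTransition S P)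
    (hT : 0 < T) (hδ : 0 < δ) (hδ1 : δ < 1) (hr : r ≤ 1) (hq : IsUCOREPS S r T η δ f l q)
    (t : ℕ) (ht : t < T) (h : Fin t → Trajectory S A) : IsPolicy S (learnerPolicy S q t h) := by
  cases t with
  | zero => exact isPolicy_uniform S
  | succ t =>
    obtain ⟨H, rfl⟩ := exists_prefixOf_eq (Nat.succ_pos t) h
    obtain ⟨h1, h2⟩ := hq.mem_and_pos hL hP hT hδ hδ1 hr H (t + 1) ht.le
    exact isPolicy_inducedPolicy hP h1.isOccupancyMeasure h2

lemma transitionDist_mem_Icc [Nonempty A] (hL : 0 < L) (hP : IsTransition S P)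
    (hT : 0 < T) (hδ : 0 < δ) (hδ1 : δ < 1) (hr : r ≤ 1) (hq : IsUCOREPS S r T η δ f l q)
    (t : ℕ) (ht : t < T) (h : Fin t → Trajectory S A) (x : X) (a : A)
    (hx : S.layer x ≠ Fin.last L) : transitionDist S P (q t h) x a ∈ Set.Icc (0 : ℝ) 2 := by
  refine ⟨transitionDist_nonneg S P _ x a, ?_⟩
  have hn := hP.next_nonempty hx
  cases t with
  | zero =>
    rw [hq.init]
    exact transitionDist_le_two hP (isOccupancyMeasure_initialMeasure hP) hx
      (pairMass_pos (fun x a x' h => initialMeasure_pos h a) hn a).ne'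
  | succ t =>
    obtain ⟨H, rfl⟩ := exists_prefixOf_eq (Nat.succ_pos t) h
    obtain ⟨h1, h2⟩ := hq.mem_and_pos hL hP hT hδ hδ1 hr H (t + 1) ht.le
    exact transitionDist_le_two hP h1.isOccupancyMeasure hx (pairMass_pos h2 hn a).ne'

/-- The progress of one step towards a comparator in the confidence set. -/
lemma IsUCOREPS.step_le [Nonempty A] (hL : 0 < L) (hP : IsTransition S P)
    (hT : 0 < T) (hδ : 0 < δ) (hδ1 : δ < 1) (hr : r ≤ 1) (hq : IsUCOREPS S r T η δ f l q)
    (hl : ∀ t, IsLoss (l t)) {F : ℝ} (hF : 0 < F) (hLip : IsLipschitzCriterion F f) (hη : 0 ≤ η)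
    (H : ℕ → Trajectory S A) (t : Fin T) {p : X → A → X → ℝ}
    (hp : InConfidenceSet S T δ (countersAt S r (t + 1) (prefixOf H (t + 1))) p) :
    η * (f (l t) (q t (prefixOf H t)) - f (l t) p) ≤ unnormKL p (q t (prefixOf H t)) -
      unnormKL p (q (t + 1) (prefixOf H (t + 1))) + L * ((η * F) ^ 2 / 2) := by
  obtain ⟨hv, hvpos⟩ := hq.mem_and_pos hL hP hT hδ hδ1 hr H t t.2.le
  obtain ⟨hw, hwpos⟩ := hq.mem_and_pos hL hP hT hδ hδ1 hr H (t + 1) t.2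
  obtain ⟨z, hz, -, hmin⟩ := hq.step t (prefixOf H (t + 1))
  rw [init_prefixOf] at hz hmin
  set v := q t (prefixOf H t) with hv_def
  set w := q (t + 1) (prefixOf H (t + 1)) with hw_def
  have h1 := hz p hp.mem_cube
  have hseg := sum_of_isMinOn (convex_confidenceSet S T δ _) hw hp hmin
  have h2 := three_point_of_isMin (fun i => (hw.mem_cube _ _ _).1) (fun i => (hp.mem_cube _ _ _).1)
    (fun i h => hp.loop_free _ _ _ fun hx' => (hwpos _ _ _ hx').ne' h)
    (fun i h => hw.loop_free _ _ _ fun hx' => (hvpos _ _ _ hx').ne' h) hseg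
  rw [← unnormKL_eq_sum, ← unnormKL_eq_sum, ← unnormKL_eq_sum] at h2
  have h3 := pairing_sub_le_unnormKL hw.isOccupancyMeasure hv.isOccupancyMeasure hvpos hF.le hz
    (hLip (l t) (hl t)) hη
  have h4 : ∑ i : X × A × X, (w i.1 i.2.1 i.2.2 - p i.1 i.2.1 i.2.2) * z i.1 i.2.1 i.2.2 =
      pairing (w - p) z := by
    rw [pairing_eq_sum]
    rfl
  have h5 : pairing (v - w) z + pairing (w - p) z = -pairing (p - v) z := by
    simp only [pairing_eq_sum, ← Finset.sum_add_distrib, ← Finset.sum_neg_distrib, Pi.sub_apply]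
    exact Finset.sum_congr rfl fun i _ => by ring
  rw [h4] at h2
  have h6 : η * (f (l t) v - f (l t) p) ≤ η * (-pairing (p - v) z) :=
    mul_le_mul_of_nonneg_left (by linarith) hη
  rw [← h5] at h6
  linarith

/-- The regret of mirror descent against a comparator that lies in all confidence sets. -/
lemma IsUCOREPS.sum_sub_le [Nonempty A] (hL : 0 < L) (hP : IsTransition S P)
    (hT : 0 < T) (hδ : 0 < δ) (hδ1 : δ < 1) (hr : r ≤ 1) (hq : IsUCOREPS S r T η δ f l q)
    (hl : ∀ t, IsLoss (l t)) {F : ℝ} (hF : 0 < F) (hLip : IsLipschitzCriterion F f)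
    (hη : η = Real.sqrt (Real.log ((Fintype.card X : ℝ) ^ 2 * Fintype.card A / (L : ℝ) ^ 2)
      / (F ^ 2 * T)))
    (hK : 0 < Real.log ((Fintype.card X : ℝ) ^ 2 * Fintype.card A / (L : ℝ) ^ 2))
    (H : ℕ → Trajectory S A) {p : X → A → X → ℝ}
    (hp : ∀ t ≤ T, InConfidenceSet S T δ (countersAt S r t (prefixOf H t)) p) :
    ∑ t : Fin T, f (l t) (q t (prefixOf H t)) - ∑ t : Fin T, f (l t) p ≤
      3 / 2 * L * F * Real.sqrt (T *
        Real.log ((Fintype.card X : ℝ) ^ 2 * Fintype.card A / (L : ℝ) ^ 2)) := by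
  set K := Real.log ((Fintype.card X : ℝ) ^ 2 * Fintype.card A / (L : ℝ) ^ 2) with hK_def
  have hT0 : (0 : ℝ) < T := by exact_mod_cast hT
  have hη0 : 0 < η := by
    rw [hη]
    exact Real.sqrt_pos.2 (by positivity)
  have hηsq : η ^ 2 * (F ^ 2 * T) = K := by
    rw [hη, Real.sq_sqrt (by positivity)]
    field_simp
  have hroot : Real.sqrt (T * K) = η * F * T := by
    rw [← hηsq, show (T : ℝ) * (η ^ 2 * (F ^ 2 * T)) = (η * F * T) ^ 2 by ring]
    exact Real.sqrt_sq (by positivity)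
  have h1 : η * (∑ t : Fin T, f (l t) (q t (prefixOf H t)) - ∑ t : Fin T, f (l t) p) ≤
      unnormKL p (q 0 (prefixOf H 0)) - unnormKL p (q T (prefixOf H T)) +
        T * (L * ((η * F) ^ 2 / 2)) := by
    rw [← Finset.sum_sub_distrib, Finset.mul_sum]
    refine (Finset.sum_le_sum fun t _ => hq.step_le hL hP hT hδ hδ1 hr hl hF hLip hη0.le H t
      (hp (t + 1) t.2)).trans (le_of_eq ?_)
    rw [Finset.sum_add_distrib, Finset.sum_const, nsmul_eq_mul, Finset.card_univ, Fintype.card_fin,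
      Fin.sum_univ_eq_sum_range fun t => unnormKL p (q t (prefixOf H t)) -
        unnormKL p (q (t + 1) (prefixOf H (t + 1))), Finset.sum_range_sub']
  obtain ⟨hw, hwpos⟩ := hq.mem_and_pos hL hP hT hδ hδ1 hr H T le_rfl
  have hpo := (hp T le_rfl).isOccupancyMeasure
  have h2 := unnormKL_nonneg hpo hw.isOccupancyMeasure hwpos
  have h3 := unnormKL_initialMeasure_le hL hP hpo
  rw [hq.init] at h1
  rw [hroot]
  have h4 : (L : ℝ) * K = η * (L * F * (η * F * T)) := by
    rw [← hηsq]
    ring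
  refine le_of_mul_le_mul_left ?_ hη0
  rw [← hK_def] at h3
  nlinarith

/-! ### Visits to poorly estimated pairs -/

lemma transitionDist_le [Nonempty A] (hL : 0 < L) (hP : IsTransition S P)
    (hT : 0 < T) (hδ : 0 < δ) (hδ1 : δ < 1) (hr : r ≤ 1) (hq : IsUCOREPS S r T η δ f l q)
    {H : ℕ → Trajectory S A} (hH : prefixOf H T ∉ transitionBadEvent S P T δ) {t : ℕ} (ht : t ≤ T)
    {x : X} (hx : S.layer x ≠ Fin.last L) (a : A) :
    transitionDist S P (q t (prefixOf H t)) x a ≤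
      2 * (countersAt S r t (prefixOf H t)).radius S T δ x a := by
  obtain ⟨h1, h2⟩ := hq.mem_and_pos hL hP hT hδ hδ1 hr H t ht
  have h3 := h1.l1_dist x a (pairMass_pos h2 (hP.next_nonempty hx) a).ne'
  have h4 := sum_abs_sub_estimate_le hL hP hT hδ hδ1 hr hH ht hx a
  refine le_trans (Finset.sum_le_sum fun x' _ => abs_sub_le _
    ((countersAt S r t (prefixOf H t)).estimate x a x') _) ?_
  rw [Finset.sum_add_distrib]
  simp_rw [abs_sub_comm _ (P x a _)]
  linarith

/-- The confidence radii add up to `O(|X| √(T|A| ln (T|X||A|/δ)))` along the trajectories: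
the visits to a pair contribute the square root of their number, and then the Cauchy-Schwarz
inequality applies in each layer. -/
lemma sum_transitionDist_le [Nonempty A] (hL : 0 < L) (hP : IsTransition S P)
    (hT : 0 < T) (hδ : 0 < δ) (hδ1 : δ < 1) (hr : r ≤ 1) (hq : IsUCOREPS S r T η δ f l q)
    {H : ℕ → Trajectory S A} (hH : prefixOf H T ∉ transitionBadEvent S P T δ) :
    ∑ t ∈ Finset.range T, ∑ k : Fin L,
      transitionDist S P (q t (prefixOf H t)) ((H t).state k) ((H t).action k) ≤
    8 * Fintype.card X * Real.sqrt (T * Fintype.card A *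
      Real.log (T * Fintype.card X * Fintype.card A / δ)) := by
  set Λ := Real.log (T * Fintype.card X * Fintype.card A / δ) with hΛ
  have hΛ0 : 0 < Λ := by linarith [half_le_log (A := A) hL S hT hδ hδ1]
  set R := Real.sqrt (T * Fintype.card A * Λ) with hR
  have hR0 : 0 ≤ R := Real.sqrt_nonneg _
  have hpair : ∀ (k : Fin L), ∀ x ∈ S.states k, ∀ a, ∑ t ∈ Finset.range T,
      (visits (H t) x a : ℝ) * transitionDist S P (q t (prefixOf H t)) x a ≤
      8 * Real.sqrt ((S.states (k + 1)).card * Λ) * Real.sqrt (totalVisits H T x a) := by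
    intro k x hx a
    have hxl := S.ne_last_of_mem k.2 hx
    set c := Real.sqrt (2 * (S.states (k + 1)).card * Λ) with hc
    have h1 : ∀ t ∈ Finset.range T,
        (visits (H t) x a : ℝ) * transitionDist S P (q t (prefixOf H t)) x a ≤
        2 * c * ((visits (H t) x a : ℝ) /
          Real.sqrt (max 1 ((countersAt S r t (prefixOf H t)).N x a : ℝ))) := by
      intro t ht
      have h2 := transitionDist_le hL hP hT hδ hδ1 hr hq hH (Finset.mem_range.1 ht).le hxl a
      rw [Counters.radius, S.next_eq hx, Real.sqrt_div (by positivity), ← hc] at h2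
      refine (mul_le_mul_of_nonneg_left h2 (Nat.cast_nonneg _)).trans (le_of_eq ?_)
      ring
    refine (Finset.sum_le_sum h1).trans ?_
    rw [← Finset.mul_sum]
    refine (mul_le_mul_of_nonneg_left (sum_visits_div_sqrt_le hr H T x a) (by positivity)).trans
      (le_of_eq ?_)
    rw [hc, mul_assoc 2 ((S.states (k + 1)).card : ℝ) Λ, Real.sqrt_mul (by norm_num)]
    have h3 := Real.mul_self_sqrt (show (0 : ℝ) ≤ 2 by norm_num)
    linear_combination (4 * Real.sqrt ((S.states (k + 1)).card * Λ) *
      Real.sqrt (totalVisits H T x a)) * h3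
  have hlayer : ∀ k : Fin L, ∑ x ∈ S.states k, ∑ a, Real.sqrt (totalVisits H T x a) ≤
      Real.sqrt ((S.states k).card * Fintype.card A * T) := by
    intro k
    refine Real.le_sqrt_of_sq_le ?_
    rw [← Finset.sum_product']
    refine sq_sum_le_card_mul_sum_sq.trans (le_of_eq ?_)
    rw [Finset.card_product, Finset.card_univ]
    simp_rw [Real.sq_sqrt (Nat.cast_nonneg _)]
    rw [Finset.sum_product, sum_states_totalVisits]
    push_cast
    ring
  have hk : ∀ k : Fin L, ∑ t ∈ Finset.range T,
      transitionDist S P (q t (prefixOf H t)) ((H t).state k) ((H t).action k) ≤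
      4 * R * ((S.states k).card + (S.states (k + 1)).card) := by
    intro k
    have h1 : ∀ t, transitionDist S P (q t (prefixOf H t)) ((H t).state k) ((H t).action k) =
        ∑ x ∈ S.states k, ∑ a,
          (visits (H t) x a : ℝ) * transitionDist S P (q t (prefixOf H t)) x a :=
      fun t => (sum_states_visits_mul (H t) k _).symm
    simp_rw [h1]
    rw [Finset.sum_comm]
    have h2 : ∀ x ∈ S.states k, ∑ t ∈ Finset.range T, ∑ a,
        (visits (H t) x a : ℝ) * transitionDist S P (q t (prefixOf H t)) x a ≤
        ∑ a, 8 * Real.sqrt ((S.states (k + 1)).card * Λ) *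
          Real.sqrt (totalVisits H T x a) := by
      intro x hx
      rw [Finset.sum_comm]
      exact Finset.sum_le_sum fun a _ => hpair k x hx a
    refine (Finset.sum_le_sum h2).trans ?_
    simp_rw [← Finset.mul_sum]
    refine (mul_le_mul_of_nonneg_left (hlayer k) (by positivity)).trans ?_
    have h3 : Real.sqrt ((S.states (k + 1)).card * Λ) *
        Real.sqrt ((S.states k).card * Fintype.card A * T) =
        R * (Real.sqrt (S.states k).card * Real.sqrt (S.states (k + 1)).card) := by
      rw [hR, ← Real.sqrt_mul (by positivity), ← Real.sqrt_mul (by positivity),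
        ← Real.sqrt_mul (by positivity)]
      congr 1
      ring
    rw [mul_assoc 8, h3]
    have h4 := Real.sq_sqrt (Nat.cast_nonneg (S.states k).card : (0 : ℝ) ≤ _)
    have h5 := Real.sq_sqrt (Nat.cast_nonneg (S.states (k + 1)).card : (0 : ℝ) ≤ _)
    have h6 : Real.sqrt (S.states k).card * Real.sqrt (S.states (k + 1)).card ≤
        ((S.states k).card + (S.states (k + 1)).card) / 2 := by
      nlinarith [sq_nonneg (Real.sqrt (S.states k).card - Real.sqrt (S.states (k + 1)).card)]
    have h7 := mul_le_mul_of_nonneg_left h6 hR0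
    linarith
  rw [Finset.sum_comm]
  refine (Finset.sum_le_sum fun k _ => hk k).trans ?_
  rw [← Finset.mul_sum, Finset.sum_add_distrib, Fin.sum_univ_eq_sum_range
    fun k => ((S.states k).card : ℝ), Fin.sum_univ_eq_sum_range
    fun k => ((S.states (k + 1)).card : ℝ)]
  obtain ⟨h1, h2⟩ := sum_card_states_le S
  have h3 := mul_le_mul_of_nonneg_left (add_le_add h1 h2) (show 0 ≤ 4 * R by positivity)
  linarith

/-! ### The regret bound -/

lemma add_one_le_card [Nonempty A] (hP : IsTransition S P) : L + 1 ≤ Fintype.card X := by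
  have h : Function.Surjective S.layer := by
    intro k
    obtain ⟨x, hx⟩ := hP.states_nonempty (Nat.lt_succ_iff.1 k.2)
    exact ⟨x, Fin.ext (Layering.mem_states.1 hx)⟩
  simpa using Fintype.card_le_of_surjective _ h

/-- Off the two bad events the regret bound holds. -/
lemma regret_le [Nonempty A] (hL : 0 < L) (hP : IsTransition S P)
    (hT : 0 < T) (hδ : 0 < δ) (hδ1 : δ < 1) (hr : r ≤ 1) (hq : IsUCOREPS S r T η δ f l q)
    (hl : ∀ t, IsLoss (l t)) {C : (Fin L → Fin d → ℝ) → ℝ≥0} (hf : IsCriterionFunction S C f)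
    {F : ℝ} (hF : 0 < F) (hLip : IsLipschitzCriterion F f)
    (hη : η = Real.sqrt (Real.log ((Fintype.card X : ℝ) ^ 2 * Fintype.card A / (L : ℝ) ^ 2)
      / (F ^ 2 * T)))
    {H : ℕ → Trajectory S A} (hH : prefixOf H T ∉ transitionBadEvent S P T δ)
    (hH' : prefixOf H T ∉ sumBadEvent S P (learnerPolicy S q)
      (fun t h => transitionDist S P (q t h)) T δ) :
    regret S P C l (learnerPolicy S q) (prefixOf H T) ≤ 15 * F * L * Fintype.card X *
      Real.sqrt (T * Fintype.card A * Real.log (T * Fintype.card X * Fintype.card A / δ)) := by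
  set Λ := Real.log (T * Fintype.card X * Fintype.card A / δ) with hΛ
  set R := Real.sqrt (T * Fintype.card A * Λ) with hR
  set K := Real.log ((Fintype.card X : ℝ) ^ 2 * Fintype.card A / (L : ℝ) ^ 2) with hK_def
  have hR0 : 0 ≤ R := Real.sqrt_nonneg _
  have hΛ0 : 0 < Λ := by linarith [half_le_log (A := A) hL S hT hδ hδ1]
  have hT1 : (1 : ℝ) ≤ T := by exact_mod_cast hT
  have hA1 : (1 : ℝ) ≤ Fintype.card A := by exact_mod_cast Fintype.card_pos (α := A)
  have hL1 : (1 : ℝ) ≤ L := by exact_mod_cast hL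
  have hXL : (L : ℝ) + 1 ≤ Fintype.card X := by exact_mod_cast add_one_le_card (A := A) hP
  have hX0 : (0 : ℝ) < Fintype.card X := by linarith
  have hK0 : 0 < K := by
    refine Real.log_pos ?_
    rw [lt_div_iff₀ (by positivity), one_mul]
    nlinarith
  have hKΛ : K ≤ 2 * Λ := by
    have h1 : (2 : ℝ) * Λ = Real.log ((T * Fintype.card X * Fintype.card A / δ) ^ 2) := by
      rw [Real.log_pow, Nat.cast_ofNat]
    rw [h1]
    refine Real.log_le_log (by positivity) ?_
    have h2 : (Fintype.card X : ℝ) ^ 2 * Fintype.card A / (L : ℝ) ^ 2 ≤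
        (Fintype.card X : ℝ) ^ 2 * Fintype.card A :=
      div_le_self (by positivity) (one_le_pow₀ hL1)
    have h3 : (Fintype.card X : ℝ) * Fintype.card A ≤
        T * Fintype.card X * Fintype.card A / δ := by
      rw [le_div_iff₀ hδ]
      have h4 : (Fintype.card X : ℝ) * Fintype.card A ≤
          T * (Fintype.card X * Fintype.card A) := le_mul_of_one_le_left (by positivity) hT1
      have h5 : (Fintype.card X : ℝ) * Fintype.card A * δ ≤ Fintype.card X * Fintype.card A :=
        mul_le_of_le_one_right (by positivity) hδ1.le
      linarith
    have h6 : ((Fintype.card X : ℝ) * Fintype.card A) ^ 2 ≤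
        (T * Fintype.card X * Fintype.card A / δ) ^ 2 := pow_le_pow_left₀ (by positivity) h3 2
    have h7 : (Fintype.card X : ℝ) ^ 2 * Fintype.card A ≤
        (Fintype.card X : ℝ) ^ 2 * Fintype.card A * Fintype.card A :=
      le_mul_of_one_le_right (by positivity) hA1
    nlinarith
  have hδΛ : Real.log (1 / δ) ≤ Λ := by
    refine Real.log_le_log (by positivity) ?_
    gcongr
    have h1 : (1 : ℝ) ≤ Fintype.card X := by linarith
    exact one_le_mul_of_one_le_of_one_le (one_le_mul_of_one_le_of_one_le hT1 h1) hA1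
  have hroot : ∀ y, y ≤ 2 * (T * Λ) → Real.sqrt y ≤ 2 * R := by
    intro y hy
    refine Real.sqrt_le_iff.2 ⟨by positivity, ?_⟩
    rw [mul_pow, hR, Real.sq_sqrt (by positivity)]
    have h1 : T * Λ ≤ T * Λ * Fintype.card A := le_mul_of_one_le_right (by positivity) hA1
    have h2 : 0 < T * Λ := by positivity
    linarith
  have hpol := isPolicy_learnerPolicy hL hP hT hδ hδ1 hr hq
  -- the distance of the chosen occupancy measures from those of the executed policies
  have hdist : ∑ t ∈ Finset.range T, ∑ x, ∑ a, ∑ x', |q t (prefixOf H t) x a x' -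
      occupancy S P (learnerPolicy S q t (prefixOf H t)) x a x'| ≤
      L * (10 * Fintype.card X * R) := by
    have h1 : ∀ t ∈ Finset.range T, ∑ x, ∑ a, ∑ x', |q t (prefixOf H t) x a x' -
        occupancy S P (learnerPolicy S q t (prefixOf H t)) x a x'| ≤
        L * expectedSum S P (learnerPolicy S q t (prefixOf H t))
          (transitionDist S P (q t (prefixOf H t))) := by
      intro t ht
      rw [Finset.mem_range] at ht
      obtain ⟨h2, h3⟩ := hq.mem_and_pos hL hP hT hδ hδ1 hr H t ht.le
      exact sum_abs_sub_occupancy_le hP h2.isOccupancyMeasure h3 (hpol t ht _)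
        fun x a hx => learnerPolicy_eq hP hq t _ x a hx
    refine (Finset.sum_le_sum h1).trans ?_
    rw [← Finset.mul_sum]
    refine mul_le_mul_of_nonneg_left ?_ (by positivity)
    have h2 := sum_expectedSum_le hL hT hδ hδ1 hH'
    have h3 := sum_transitionDist_le hL hP hT hδ hδ1 hr hq hH
    have h4 : Real.sqrt (2 * T * Real.log (1 / δ)) ≤ 2 * R := by
      refine hroot _ ?_
      rw [mul_assoc]
      gcongr
    have h5 : L * Real.sqrt (2 * T * Real.log (1 / δ)) ≤ Fintype.card X * (2 * R) :=
      mul_le_mul (by linarith) h4 (Real.sqrt_nonneg _) hX0.le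
    linarith
  have : Nonempty {ρ : X → A → ℝ // IsPolicy S ρ} := ⟨⟨_, isPolicy_uniform S⟩⟩
  rw [regret, sub_le_iff_le_add, ← sub_le_iff_le_add']
  refine le_ciInf fun ρ => ?_
  rw [sub_le_iff_le_add']
  set p := occupancy S P ρ.1 with hp_def
  have hp : ∀ t ≤ T, InConfidenceSet S T δ (countersAt S r t (prefixOf H t)) p := fun t ht =>
    inConfidenceSet_occupancy hP ρ.2 fun x a hx =>
      sum_abs_sub_estimate_le hL hP hT hδ hδ1 hr hH ht hx a
  have homd := hq.sum_sub_le hL hP hT hδ hδ1 hr hl hF hLip hη hK0 H hp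
  have hlearn : ∀ t : Fin T, (C (expectedLosses S P (learnerPolicy S q t
      fun s => prefixOf H T (s.castLE t.2.le)) (l t)) : ℝ) ≤ f (l t) (q t (prefixOf H t)) +
      F * ∑ x, ∑ a, ∑ x', |q t (prefixOf H t) x a x' -
        occupancy S P (learnerPolicy S q t (prefixOf H t)) x a x'| := by
    intro t
    have hpt := hpol t t.2 (prefixOf H t)
    change (C (expectedLosses S P (learnerPolicy S q t (prefixOf H t)) (l t)) : ℝ) ≤ _
    rw [hf.eq_occupancy _ (hl t) P hP _ hpt]
    have h1 := hLip (l t) (hl t) _ (hq.mem_and_pos hL hP hT hδ hδ1 hr H t t.2.le).1.mem_cube _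
      (isOccupancyMeasure_occupancy hP hpt).mem_cube
    have h2 := (abs_le.1 h1).1
    linarith
  have hcomp : ∑ t : Fin T, (C (expectedLosses S P ρ.1 (l t)) : ℝ) = ∑ t : Fin T, f (l t) p :=
    Finset.sum_congr rfl fun t _ => hf.eq_occupancy _ (hl t) P hP _ ρ.2
  rw [hcomp]
  have hsum := Finset.sum_le_sum fun t (_ : t ∈ (Finset.univ : Finset (Fin T))) => hlearn t
  rw [Finset.sum_add_distrib, ← Finset.mul_sum, Fin.sum_univ_eq_sum_range fun t =>
    ∑ x, ∑ a, ∑ x', |q t (prefixOf H t) x a x' -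
      occupancy S P (learnerPolicy S q t (prefixOf H t)) x a x'|] at hsum
  have h1 := mul_le_mul_of_nonneg_left hdist hF.le
  have h2 : 3 / 2 * L * F * Real.sqrt (T * K) ≤ 3 / 2 * L * F * (2 * R) :=
    mul_le_mul_of_nonneg_left (hroot _ (by nlinarith)) (by positivity)
  have h3 : L * F * R ≤ L * F * R * Fintype.card X :=
    le_mul_of_one_le_right (by positivity) (by linarith)
  have h4 : 0 ≤ L * F * R * Fintype.card X := by positivity
  linarith

end

end UCOREPS

end

theorem theorem5p1 {X A : Type*} [Fintype X] [Fintype A] [DecidableEq X] [DecidableEq A]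
    [Nonempty A] {L d T : ℕ} (hL : 0 < L) (hT : 0 < T)
    (S : Layering X L)
    (P : X → A → X → ℝ) (hP : IsTransition S P)
    (l : Fin T → X → A → X → Fin d → ℝ) (hl : ∀ t, IsLoss (l t))
    (C : (Fin L → Fin d → ℝ) → NNReal)
    (f : (X → A → X → Fin d → ℝ) → (X → A → X → ℝ) → ℝ)
    (hf : IsCriterionFunction S C f)
    (F : ℝ) (hF : 0 < F) (hLip : IsLipschitzCriterion F f)
    (δ : ℝ) (hδ : 0 < δ) (hδ1 : δ < 1)
    (η : ℝ)
    (hη : η = Real.sqrt (Real.log ((Fintype.card X : ℝ) ^ 2 * Fintype.card A / (L : ℝ) ^ 2)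
      / (F ^ 2 * T)))
    (r : ℕ) (hr : r = 0 ∨ r = 1)
    (q : (t : ℕ) → (Fin t → Trajectory S A) → X → A → X → ℝ)
    (hq : IsUCOREPS S r T η δ f l q) :
    1 - 2 * δ ≤ eventProb S P (learnerPolicy S q) T
      {h | regret S P C l (learnerPolicy S q) h ≤
        15 * F * L * Fintype.card X *
          Real.sqrt (T * Fintype.card A *
            Real.log (T * Fintype.card X * Fintype.card A / δ))} := by
  have hr' : r ≤ 1 := by omega
  have hpol := isPolicy_learnerPolicy hL hP hT hδ hδ1 hr' hq
  have h1 := eventProb_transitionBadEvent_le hL hT hP hpol hδ hδ1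
  have h2 := eventProb_sumBadEvent_le hL hP hpol
    (g := fun t h => transitionDist S P (q t h))
    (transitionDist_mem_Icc hL hP hT hδ hδ1 hr' hq) hδ
  have h3 := eventProb_union_le hP hpol (transitionBadEvent S P T δ)
    (sumBadEvent S P (learnerPolicy S q) (fun t h => transitionDist S P (q t h)) T δ)
  have h4 := eventProb_compl hL hP hpol (transitionBadEvent S P T δ ∪
    sumBadEvent S P (learnerPolicy S q) (fun t h => transitionDist S P (q t h)) T δ)
  refine le_trans (by linarith) (eventProb_mono hP hpol fun h hh => ?_)
  obtain ⟨H, rfl⟩ := exists_prefixOf_eq hT h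
  rw [Set.mem_compl_iff, Set.mem_union, not_or] at hh
  exact regret_le hL hP hT hδ hδ1 hr' hq hl hf hF hLip hη hh.1 hh.2
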